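/- **Conventions.** An exact category is an additive category $\mathcal A$ with a family of kernel-cokernel pairs $A\rightarrowtail B\twoheadrightarrow C$, closed under isomorphism, such that (calling the first maps admissible monomorphisms, forming the class $\mathcal M$, and the second maps admissible epimorphisms, forming the class $\mathcal E$) the identity of a zero object is in $\mathcal E$, $\mathcal E$ is closed under composition, pullbacks of maps in $\mathcal E$ along arbitrary maps exist and are in $\mathcal E$, and pushouts of maps in $\mathcal M$ along arbitrary maps exist and are in $\mathcal M$. An exact functor is an additive functor preserving the distinguished sequences. Let $\Sigma$ be $\Delta\times\Delta$ with a new terminal object $[-1]$ adjoined. A preaugmented bisimplicial groupoid is a functor $Y\colon\Sigma^{\mathrm{op}}\to\mathcal{G}pd$, with values $Y_{q,r}$ and $Y_{-1}$. The vertical source and target $s_v,t_v\colon Y_{k,\ell}\to Y_{0,\ell}$ are induced by $0\mapsto 0$ and $0\mapsto k$ in the first variable; the horizontal ones $s_h,t_h\colon Y_{k,\ell}\to Y_{k,0}$ by $0\mapsto 0$ and $0\mapsto \ell$ in the second. Write $\times^2$ for the 2-pullback (homotopy pullback) of groupoids. $Y$ is an *augmented stable double Segal groupoid* if the following functors are equivalences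 of groupoids: 1. (double Segal) for all $q\ge 0$, $r\ge1$, the map $Y_{q,r}\to Y_{q,1}\times^2_{Y_{q,0}}\cdots\times^2_{Y_{q,0}}Y_{q,1}$ ($r$ factors), and for all $q\ge1$, $r\ge 0$, the map $Y_{q,r}\to Y_{1,r}\times^2_{Y_{0,r}}\cdots\times^2_{Y_{0,r}}Y_{1,r}$ ($q$ factors), induced by the spine inclusions; 2. (stable) the maps $Y_{1,1}\to Y_{0,1}\times^2_{Y_{0,0}}Y_{1,0}$ induced by the sources $(s_v,s_h)$, and $Y_{1,1}\to Y_{1,0}\times^2_{Y_{0,0}}Y_{0,1}$ induced by the targets $(t_h,t_v)$; 3. (augmented) the composites $Y_{1,0}\,{}^{t_v}\!\times^2_{Y_{0,0}}Y_{-1}\to Y_{1,0}\xrightarrow{s_v}Y_{0,0}$ and $Y_{0,1}\,{}^{s_h}\!\times^2_{Y_{0,0}}Y_{-1}\to Y_{0,1}\xrightarrow{t_h}Y_{0,0}$. The *exact nerve* $N^e\mathcal A$ of an exact category has $(N^e\mathcal A)_{q,r}$ the full subgroupoid of $\mathrm{Fun}([q]\times[r],\mathcal A)_{\mathrm{iso}}$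 on the diagrams $F$ whose maps $F(i,j)\to F(i,\ell)$ are in $\mathcal M$, whose maps $F(i,j)\to F(k,j)$ are in $\mathcal E$, and all of whose squares are bicartesian; $(N^e\mathcal A)_{-1}$ is the full subgroupoid of $\mathcal A_{\mathrm{iso}}$ on the zero objects, included in $(N^e\mathcal A)_{0,0}=\mathcal A_{\mathrm{iso}}$. An exact functor $f$ induces $N^ef$ by composition. The *initial path construction* $P^{\triangleleft}Y$ has $(P^{\triangleleft}Y)_{q,r}=Y_{1+q,r}$ (precomposition with $[q]\mapsto[0]\star[q]$ in the first variable) and $(P^{\triangleleft}Y)_{-1}=Y_{1,0}\times_{Y_{0,0}}Y_{-1}$, the strict pullback along $d_0=t_v$ and the augmentation, with augmentation the first projection. The map $d_0\colon P^{\triangleleft}Y\to Y$ is the face map $Y_{1+q,r}\to Y_{q,r}$ omitting the new initial vertex, and the second projection in degree $-1$. **Theorem.** Let $f\colon\mathcal A\to\mathcal B$ be an exact functor between exact categories. Let $N^{\mathrm{rel}}f$, its *relative exact nerve*, be the preaugmented bisimplicial groupoid defined as the (strict, levelwise) pullback of $$N^e\mathcal A\xrightarrow{\;N^ef\;}N^e\mathcal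 B\xleftarrow{\;d_0\;}P^{\triangleleft}(N^e\mathcal B).$$ Then $N^{\mathrm{rel}}f$ is an augmented stable double Segal groupoid. -/

import Mathlib

open CategoryTheory CategoryTheory.Limits Opposite Simplicial

universe v u

noncomputable section

/-! ### Exact categories -/

section Exact

variable {A : Type u} [Category.{v} A] [Preadditive A]

/-- `i` is the first map of a sequence in the family `P`. -/
def IsAdmissibleMono (P : ShortComplex A → Prop) {X Y : A} (i : X ⟶ Y) : Prop :=
  ∃ (Z : A) (p : Y ⟶ Z) (w : i ≫ p = 0), P (ShortComplex.mk i p w)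

/-- `p` is the second map of a sequence in the family `P`. -/
def IsAdmissibleEpi (P : ShortComplex A → Prop) {Y Z : A} (p : Y ⟶ Z) : Prop :=
  ∃ (X : A) (i : X ⟶ Y) (w : i ≫ p = 0), P (ShortComplex.mk i p w)

variable (A) in
/-- An exact structure on an additive category: a family `conflation` of exact sequences
(kernel-cokernel pairs) subject to the axioms of Quillen in Keller's form. -/
structure ExactStructure [HasFiniteBiproducts A] where
  conflation : ShortComplex A → Prop
  isKernel : ∀ S, conflation S → Nonempty (IsLimit (KernelFork.ofι S.f S.zero))
  isCokernel : ∀ S, conflation S → Nonempty (IsColimit (CokernelCofork.ofπ S.g S.zero))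
  of_iso : ∀ {S T : ShortComplex A}, (S ≅ T) → conflation S → conflation T
  id_zero : ∀ Z : A, IsZero Z → IsAdmissibleEpi conflation (𝟙 Z)
  epi_comp : ∀ {X Y Z : A} (p : X ⟶ Y) (q : Y ⟶ Z), IsAdmissibleEpi conflation p →
    IsAdmissibleEpi conflation q → IsAdmissibleEpi conflation (p ≫ q)
  pullback_epi : ∀ {C C' B' : A} (f : C ⟶ C') (p' : B' ⟶ C'), IsAdmissibleEpi conflation p' →
    ∃ (B : A) (g : B ⟶ B') (p : B ⟶ C), IsPullback g p p' f ∧ IsAdmissibleEpi conflation p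
  pushout_mono : ∀ {X X' Y : A} (g : X ⟶ X') (i : X ⟶ Y), IsAdmissibleMono conflation i →
    ∃ (Y' : A) (h : Y ⟶ Y') (i' : X' ⟶ Y'), IsPushout i g h i' ∧ IsAdmissibleMono conflation i'

namespace ExactStructure

variable [HasFiniteBiproducts A] (S : ExactStructure A)

/-- The class of admissible monomorphisms. -/
def M {X Y : A} (i : X ⟶ Y) : Prop := IsAdmissibleMono S.conflation i

/-- The class of admissible epimorphisms. -/
def E {Y Z : A} (p : Y ⟶ Z) : Prop := IsAdmissibleEpi S.conflation p

lemma E_id_of_isZero {Z : A} (hZ : IsZero Z) : S.E (𝟙 Z) := S.id_zero Z hZ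

lemma M_id_of_isZero {Z : A} (hZ : IsZero Z) : S.M (𝟙 Z) := by
  obtain ⟨X, i, w, h⟩ := S.id_zero Z hZ
  have hX : IsZero X := by
    obtain ⟨hl⟩ := S.isKernel _ h
    have : Mono i := by
      have := mono_of_isLimit_fork hl
      simpa using this
    exact IsZero.of_mono i hZ
  refine ⟨Z, 𝟙 Z, hZ.eq_of_src _ _, S.of_iso ?_ h⟩
  exact ShortComplex.isoMk (hX.iso hZ) (Iso.refl Z) (Iso.refl Z)
    (hX.eq_of_src _ _) (hZ.eq_of_src _ _)

end ExactStructure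

/-- An exact functor: an additive functor that preserves the distinguished exact sequences. -/
structure IsExactFunctor {B : Type u} [Category.{v} B] [Preadditive B] [HasFiniteBiproducts A]
    [HasFiniteBiproducts B] (SA : ExactStructure A) (SB : ExactStructure B) (f : A ⥤ B) : Prop where
  additive : f.Additive
  map_conflation : ∀ {X Y Z : A} (i : X ⟶ Y) (p : Y ⟶ Z) (w : i ≫ p = 0),
    SA.conflation (ShortComplex.mk i p w) →
      ∃ w' : f.map i ≫ f.map p = 0, SB.conflation (ShortComplex.mk (f.map i) (f.map p) w')

namespace IsExactFunctor

variable {B : Type u} [Category.{v} B] [Preadditive B] [HasFiniteBiproducts A]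
  [HasFiniteBiproducts B] {SA : ExactStructure A} {SB : ExactStructure B} {f : A ⥤ B}

lemma map_M (hf : IsExactFunctor SA SB f) {X Y : A} {i : X ⟶ Y} (hi : SA.M i) :
    SB.M (f.map i) := by
  obtain ⟨Z, p, w, h⟩ := hi
  obtain ⟨w', h'⟩ := hf.map_conflation i p w h
  exact ⟨_, _, w', h'⟩

lemma map_E (hf : IsExactFunctor SA SB f) {Y Z : A} {p : Y ⟶ Z} (hp : SA.E p) :
    SB.E (f.map p) := by
  obtain ⟨X, i, w, h⟩ := hp
  obtain ⟨w', h'⟩ := hf.map_conflation i p w h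
  exact ⟨_, _, w', h'⟩

lemma map_isZero (hf : IsExactFunctor SA SB f) {Z : A} (hZ : IsZero Z) : IsZero (f.obj Z) := by
  have := hf.additive
  exact f.map_isZero hZ

/-- An exact functor preserves bicartesian squares with horizontal maps in `M` and vertical
maps in `E`. -/
lemma map_bicartesianSq (hf : IsExactFunctor SA SB f) {a b c d : A} {i : a ⟶ b} {p : a ⟶ c}
    {q : b ⟶ d} {j : c ⟶ d} (sq : BicartesianSq i p q j) (hi : SA.M i) (hp : SA.E p)
    (hq : SA.E q) (hj : SA.M j) :
    BicartesianSq (f.map i) (f.map p) (f.map q) (f.map j) := by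
  have hw : i ≫ q = p ≫ j := sq.w
  have comm : f.map i ≫ f.map q = f.map p ≫ f.map j := by
    rw [← f.map_comp, ← f.map_comp, hw]
  -- the cokernel of `j` is also a cokernel of `i`
  have hpull : IsPullback (f.map i) (f.map p) (f.map q) (f.map j) := by
    obtain ⟨L, l, wl, hl⟩ := hj
    obtain ⟨L', l', wl', hl'⟩ := hi
    obtain ⟨cl⟩ := SA.isCokernel _ hl
    have e2 : i ≫ l' = p ≫ (0 : c ⟶ L') := by rw [wl', comp_zero]
    let m : d ⟶ L' := sq.toIsPushout.desc l' 0 e2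
    have hm1 : q ≫ m = l' := sq.toIsPushout.inl_desc _ _ _
    have hm2 : j ≫ m = 0 := sq.toIsPushout.inr_desc _ _ _
    obtain ⟨ψ, hψ⟩ := CokernelCofork.IsColimit.desc' cl m hm2
    have hψ : l ≫ ψ = m := hψ
    obtain ⟨w1, k1⟩ := hf.map_conflation _ _ _ hl
    obtain ⟨w2, k2⟩ := hf.map_conflation _ _ _ hl'
    obtain ⟨n1⟩ := SB.isKernel _ k1
    obtain ⟨n2⟩ := SB.isKernel _ k2
    have mono1 : Mono (f.map j) := by simpa using mono_of_isLimit_fork n1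
    have mono2 : Mono (f.map i) := by simpa using mono_of_isLimit_fork n2
    have key : ∀ s : PullbackCone (f.map q) (f.map j), s.fst ≫ f.map l' = 0 := by
      intro s
      have hl2 : l' = q ≫ l ≫ ψ := by rw [hψ, hm1]
      have hs : s.fst ≫ f.map q = s.snd ≫ f.map j := s.condition
      have w1 : f.map j ≫ f.map l = 0 := w1
      rw [hl2, f.map_comp, f.map_comp, reassoc_of% hs, reassoc_of% w1, zero_comp, comp_zero]
    refine ⟨⟨comm⟩, ⟨PullbackCone.IsLimit.mk comm
      (fun s => (KernelFork.IsLimit.lift' n2 s.fst (key s)).1) ?_ ?_ ?_⟩⟩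
    · intro s
      exact (KernelFork.IsLimit.lift' n2 s.fst _).2
    · intro s
      have h := (KernelFork.IsLimit.lift' n2 s.fst (key s)).2
      have h : _ ≫ f.map i = s.fst := h
      rw [← cancel_mono (f.map j), Category.assoc, ← comm, reassoc_of% h]
      exact s.condition
    · intro s m h1 h2
      rw [← cancel_mono (f.map i), h1]
      exact (KernelFork.IsLimit.lift' n2 s.fst _).2.symm
  -- the kernel of `p` is also a kernel of `q`
  have hpush : IsPushout (f.map i) (f.map p) (f.map q) (f.map j) := by
    obtain ⟨L, l, wl, hl⟩ := hp
    obtain ⟨L', l', wl', hl'⟩ := hq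
    obtain ⟨cl⟩ := SA.isKernel _ hl
    have e2 : l' ≫ q = (0 : L' ⟶ c) ≫ j := by rw [wl', zero_comp]
    let m : L' ⟶ a := sq.toIsPullback.lift l' 0 e2
    have hm1 : m ≫ i = l' := sq.toIsPullback.lift_fst _ _ _
    have hm2 : m ≫ p = 0 := sq.toIsPullback.lift_snd _ _ _
    obtain ⟨ψ, hψ⟩ := KernelFork.IsLimit.lift' cl m hm2
    have hψ : ψ ≫ l = m := hψ
    obtain ⟨w1, k1⟩ := hf.map_conflation _ _ _ hl
    obtain ⟨w2, k2⟩ := hf.map_conflation _ _ _ hl'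
    obtain ⟨n1⟩ := SB.isCokernel _ k1
    obtain ⟨n2⟩ := SB.isCokernel _ k2
    have epi1 : Epi (f.map p) := by simpa using epi_of_isColimit_cofork n1
    have epi2 : Epi (f.map q) := by simpa using epi_of_isColimit_cofork n2
    have key : ∀ s : PushoutCocone (f.map i) (f.map p), f.map l' ≫ s.inl = 0 := by
      intro s
      have hl2 : l' = ψ ≫ l ≫ i := by rw [reassoc_of% hψ, hm1]
      have hs : f.map i ≫ s.inl = f.map p ≫ s.inr := s.condition
      have w1 : f.map l ≫ f.map p = 0 := w1
      rw [hl2, f.map_comp, f.map_comp, Category.assoc, Category.assoc, hs, reassoc_of% w1,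
        zero_comp, comp_zero]
    refine ⟨⟨comm⟩, ⟨PushoutCocone.IsColimit.mk comm
      (fun s => (CokernelCofork.IsColimit.desc' n2 s.inl (key s)).1) ?_ ?_ ?_⟩⟩
    · intro s
      exact (CokernelCofork.IsColimit.desc' n2 s.inl _).2
    · intro s
      have h := (CokernelCofork.IsColimit.desc' n2 s.inl (key s)).2
      have h : f.map q ≫ _ = s.inl := h
      rw [← cancel_epi (f.map p), ← Category.assoc, ← comm, Category.assoc, h]
      exact s.condition
    · intro s m h1 h2
      rw [← cancel_epi (f.map q), h1]
      exact (CokernelCofork.IsColimit.desc' n2 s.inl _).2.symm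
  exact ⟨hpull, hpush.isColimit'⟩

end IsExactFunctor

end Exact

/-! ### Strict pullbacks, 2-pullbacks and iterated 2-pullbacks of groupoids -/

section Pullbacks

/-- The strict pullback of groupoids: pairs of objects with equal images, pairs of morphisms with
equal images. -/
@[ext]
structure StrictPullback {C D E : Type u} [Groupoid.{v} C] [Groupoid.{v} D] [Groupoid.{v} E]
    (F : C ⥤ E) (G : D ⥤ E) : Type u where
  fst : C
  snd : D
  eq : F.obj fst = G.obj snd

namespace StrictPullback

variable {C D E : Type u} [Groupoid.{v} C] [Groupoid.{v} D] [Groupoid.{v} E]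
  {F : C ⥤ E} {G : D ⥤ E}

/-- Morphisms of the strict pullback; `eqToHom` only identifies the equal (co)domains. -/
@[ext]
structure Hom (x y : StrictPullback F G) : Type v where
  fst : x.fst ⟶ y.fst
  snd : x.snd ⟶ y.snd
  eq : F.map fst ≫ eqToHom y.eq = eqToHom x.eq ≫ G.map snd

instance : Groupoid (StrictPullback F G) where
  Hom := Hom
  id x := ⟨𝟙 _, 𝟙 _, by simp⟩
  comp f g := ⟨f.fst ≫ g.fst, f.snd ≫ g.snd, by
    rw [F.map_comp, G.map_comp, Category.assoc, g.eq, ← Category.assoc, f.eq, Category.assoc]⟩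
  id_comp _ := Hom.ext (Category.id_comp _) (Category.id_comp _)
  comp_id _ := Hom.ext (Category.comp_id _) (Category.comp_id _)
  assoc _ _ _ := Hom.ext (Category.assoc _ _ _) (Category.assoc _ _ _)
  inv f := ⟨Groupoid.inv f.fst, Groupoid.inv f.snd, by
    have h := f.eq
    rw [Groupoid.inv_eq_inv, Groupoid.inv_eq_inv, F.map_inv, G.map_inv, IsIso.inv_comp_eq,
      ← Category.assoc, h, Category.assoc, IsIso.hom_inv_id, Category.comp_id]⟩
  inv_comp _ := Hom.ext (Groupoid.inv_comp _) (Groupoid.inv_comp _)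
  comp_inv _ := Hom.ext (Groupoid.comp_inv _) (Groupoid.comp_inv _)

variable (F G)

/-- The first projection. -/
def pr₁ : StrictPullback F G ⥤ C where
  obj x := x.fst
  map f := f.fst
  map_id _ := rfl
  map_comp _ _ := rfl

/-- The second projection. -/
def pr₂ : StrictPullback F G ⥤ D where
  obj x := x.snd
  map f := f.snd
  map_id _ := rfl
  map_comp _ _ := rfl

lemma condition : pr₁ F G ⋙ F = pr₂ F G ⋙ G :=
  CategoryTheory.Functor.ext (fun x => x.eq) (fun x y f => by
    have h := f.eq
    change F.map f.fst = eqToHom x.eq ≫ G.map f.snd ≫ eqToHom y.eq.symm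
    rw [← Category.assoc, ← h, Category.assoc, eqToHom_trans, eqToHom_refl, Category.comp_id])

variable {F G}

/-- The functor into the strict pullback induced by a strictly commutative square. -/
def lift {W : Type u} [Groupoid.{v} W] (H : W ⥤ C) (K : W ⥤ D) (h : H ⋙ F = K ⋙ G) :
    W ⥤ StrictPullback F G where
  obj w := ⟨H.obj w, K.obj w, Functor.congr_obj h w⟩
  map φ := ⟨H.map φ, K.map φ, by
    have := Functor.congr_hom h φ
    simp only [Functor.comp_map] at this
    rw [this]
    simp⟩
  map_id _ := Hom.ext (H.map_id _) (K.map_id _)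
  map_comp _ _ := Hom.ext (H.map_comp _ _) (K.map_comp _ _)

lemma functor_ext {W : Type u} [Groupoid.{v} W] {H K : W ⥤ StrictPullback F G}
    (h₁ : H ⋙ pr₁ F G = K ⋙ pr₁ F G) (h₂ : H ⋙ pr₂ F G = K ⋙ pr₂ F G) : H = K := by
  have hobj : ∀ w, H.obj w = K.obj w := fun w =>
    StrictPullback.ext (Functor.congr_obj h₁ w) (Functor.congr_obj h₂ w)
  refine CategoryTheory.Functor.ext hobj fun w w' φ => Hom.ext ?_ ?_
  · have := Functor.congr_hom h₁ φ
    change _ = (pr₁ F G).map (eqToHom (hobj w) ≫ K.map φ ≫ eqToHom (hobj w').symm)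
    rw [Functor.map_comp, Functor.map_comp, eqToHom_map, eqToHom_map]
    exact this
  · have := Functor.congr_hom h₂ φ
    change _ = (pr₂ F G).map (eqToHom (hobj w) ≫ K.map φ ≫ eqToHom (hobj w').symm)
    rw [Functor.map_comp, Functor.map_comp, eqToHom_map, eqToHom_map]
    exact this

end StrictPullback

section Levelwise

variable {J : Type*} [Category* J] {X Y Z : J ⥤ Grpd.{v, u}} (α : X ⟶ Z) (β : Y ⟶ Z)

/-- The pullback of diagrams of groupoids, formed levelwise. -/
def levelwisePullback : J ⥤ Grpd.{v, u} where
  obj j := Grpd.of (StrictPullback (α.app j) (β.app j))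
  map {j k} φ := StrictPullback.lift (StrictPullback.pr₁ (α.app j) (β.app j) ⋙ X.map φ)
    (StrictPullback.pr₂ (α.app j) (β.app j) ⋙ Y.map φ) (by
      have h₁ : X.map φ ⋙ α.app k = α.app j ⋙ Z.map φ := α.naturality φ
      have h₂ : Y.map φ ⋙ β.app k = β.app j ⋙ Z.map φ := β.naturality φ
      have h := StrictPullback.condition (α.app j) (β.app j)
      exact ((congrArg (fun T => StrictPullback.pr₁ (α.app j) (β.app j) ⋙ T) h₁).trans
        (congrArg (fun T => T ⋙ Z.map φ) h)).trans
        (congrArg (fun T => StrictPullback.pr₂ (α.app j) (β.app j) ⋙ T) h₂).symm)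
  map_id j := StrictPullback.functor_ext
    (congrArg (fun T => StrictPullback.pr₁ (α.app j) (β.app j) ⋙ T) (X.map_id j))
    (congrArg (fun T => StrictPullback.pr₂ (α.app j) (β.app j) ⋙ T) (Y.map_id j))
  map_comp {j k l} φ ψ := StrictPullback.functor_ext
    (congrArg (fun T => StrictPullback.pr₁ (α.app j) (β.app j) ⋙ T) (X.map_comp φ ψ))
    (congrArg (fun T => StrictPullback.pr₂ (α.app j) (β.app j) ⋙ T) (Y.map_comp φ ψ))

/-- The first projection of the levelwise pullback. -/
def levelwisePullbackFst : levelwisePullback α β ⟶ X where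
  app j := StrictPullback.pr₁ (α.app j) (β.app j)
  naturality _ _ _ := rfl

/-- The second projection of the levelwise pullback. -/
def levelwisePullbackSnd : levelwisePullback α β ⟶ Y where
  app j := StrictPullback.pr₂ (α.app j) (β.app j)
  naturality _ _ _ := rfl

/-- The levelwise pullback is a pullback in the category of diagrams of groupoids. -/
theorem levelwisePullback_isPullback :
    IsPullback (levelwisePullbackFst α β) (levelwisePullbackSnd α β) α β := by
  have comm : levelwisePullbackFst α β ≫ α = levelwisePullbackSnd α β ≫ β := by
    ext j
    exact StrictPullback.condition (α.app j) (β.app j)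
  refine ⟨⟨comm⟩, ⟨PullbackCone.IsLimit.mk comm (fun s =>
    { app := fun j => StrictPullback.lift (s.fst.app j) (s.snd.app j)
        (congrArg (fun T => T.app j) s.condition)
      naturality := fun j k φ => StrictPullback.functor_ext
        (s.fst.naturality φ) (s.snd.naturality φ) }) ?_ ?_ ?_⟩⟩
  · intro s; rfl
  · intro s; rfl
  · intro s m h₁ h₂
    ext j
    exact StrictPullback.functor_ext (congrArg (fun T => T.app j) h₁)
      (congrArg (fun T => T.app j) h₂)

end Levelwise

/-- The canonical functor from the corner of a strictly commutative square of groupoids to the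
2-pullback (iso-comma groupoid) of the remaining cospan. -/
def toTwoPullback {W X Y Z : Grpd.{v, u}} (f : W ⟶ X) (g : W ⟶ Y) (h : X ⟶ Z) (k : Y ⟶ Z)
    (w : f ≫ h = g ≫ k) : W ⥤ CategoricalPullback (C := Y) (B := Z) (A := X) h k :=
  (CategoricalPullback.CatCommSqOver.toFunctorToCategoricalPullback (A := X) (C := Y) (B := Z)
    h k W).obj ⟨f, g, eqToIso w⟩

/-- The iterated 2-pullback `E ×_O E ×_O ⋯ ×_O E` with `n` factors, along `t : E ⥤ O` on the left
factor and `s : E ⥤ O` on the right factor: families of `n` objects of `E` with chosen isomorphisms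
in `O` between the target of each and the source of the next. -/
structure IteratedTwoPullback {E O : Type u} [Groupoid.{v} E] [Groupoid.{v} O] (s t : E ⥤ O)
    (n : ℕ) : Type (max u v) where
  obj : Fin n → E
  iso : ∀ (i : ℕ) (h : i + 1 < n), t.obj (obj ⟨i, by lia⟩) ≅ s.obj (obj ⟨i + 1, h⟩)

namespace IteratedTwoPullback

variable {E O : Type u} [Groupoid.{v} E] [Groupoid.{v} O] {s t : E ⥤ O} {n : ℕ}

/-- Families of morphisms compatible with the chosen isomorphisms. -/
@[ext]
structure Hom (x y : IteratedTwoPullback s t n) : Type v where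
  app : ∀ i, x.obj i ⟶ y.obj i
  comm : ∀ (i : ℕ) (h : i + 1 < n), t.map (app ⟨i, by lia⟩) ≫ (y.iso i h).hom =
    (x.iso i h).hom ≫ s.map (app ⟨i + 1, h⟩)

instance : Category (IteratedTwoPullback s t n) where
  Hom := Hom
  id x := ⟨fun _ => 𝟙 _, by simp⟩
  comp f g := ⟨fun i => f.app i ≫ g.app i, fun i h => by
    rw [t.map_comp, s.map_comp, Category.assoc, g.comm, ← Category.assoc, f.comm, Category.assoc]⟩
  id_comp _ := Hom.ext (funext fun _ => Category.id_comp _)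
  comp_id _ := Hom.ext (funext fun _ => Category.comp_id _)
  assoc _ _ _ := Hom.ext (funext fun _ => Category.assoc _ _ _)

end IteratedTwoPullback

end Pullbacks

/-! ### Segal objects -/

/-- The source vertex `0 ↦ 0` of `⦋k⦌`. -/
def srcVertex (k : ℕ) : ⦋0⦌ ⟶ ⦋k⦌ := SimplexCategory.const ⦋0⦌ ⦋k⦌ 0

/-- The target vertex `0 ↦ k` of `⦋k⦌`. -/
def tgtVertex (k : ℕ) : ⦋0⦌ ⟶ ⦋k⦌ := SimplexCategory.const ⦋0⦌ ⦋k⦌ (Fin.last k)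

lemma tgtVertex_mkOfSucc (n i : ℕ) (h : i + 1 < n) :
    tgtVertex 1 ≫ SimplexCategory.mkOfSucc (⟨i, by lia⟩ : Fin n) =
      srcVertex 1 ≫ SimplexCategory.mkOfSucc (⟨i + 1, h⟩ : Fin n) := by
  ext j; rfl

section Segal

variable (X : SimplexCategoryᵒᵖ ⥤ Grpd.{v, u})

lemma segal_aux (n i : ℕ) (h : i + 1 < n) :
    X.map (SimplexCategory.mkOfSucc (⟨i, by lia⟩ : Fin n)).op ≫ X.map (tgtVertex 1).op =
      X.map (SimplexCategory.mkOfSucc (⟨i + 1, h⟩ : Fin n)).op ≫ X.map (srcVertex 1).op := by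
  rw [← X.map_comp, ← X.map_comp, ← op_comp, ← op_comp, tgtVertex_mkOfSucc]

/-- The Segal map `X_n → X_1 ×_{X_0} ⋯ ×_{X_0} X_1` into the iterated 2-pullback, induced by the
inclusion of the spine of the `n`-simplex. -/
def segalMap (n : ℕ) : X.obj (op ⦋n⦌) ⥤
    IteratedTwoPullback (E := X.obj (op ⦋1⦌)) (O := X.obj (op ⦋0⦌))
      (X.map (srcVertex 1).op) (X.map (tgtVertex 1).op) n where
  obj x := ⟨fun i => (X.map (SimplexCategory.mkOfSucc i).op).obj x,
    fun i h => eqToIso (Functor.congr_obj (segal_aux X n i h) x)⟩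
  map φ := ⟨fun i => (X.map (SimplexCategory.mkOfSucc i).op).map φ, fun i h => by
    have := Functor.congr_hom (segal_aux X n i h) φ
    change (X.map (tgtVertex 1).op).map ((X.map (SimplexCategory.mkOfSucc _).op).map φ) = _ at this
    rw [this]
    simp only [eqToIso.hom, Category.assoc, eqToHom_trans, eqToHom_refl, Category.comp_id]
    rfl⟩
  map_id _ := IteratedTwoPullback.Hom.ext (funext fun _ => CategoryTheory.Functor.map_id _ _)
  map_comp _ _ := IteratedTwoPullback.Hom.ext (funext fun _ => CategoryTheory.Functor.map_comp _ _ _)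

/-- A Segal groupoid: all Segal maps are equivalences. -/
def IsSegal : Prop := ∀ n : ℕ, 1 ≤ n → (segalMap X n).IsEquivalence

end Segal

/-! ### Augmented stable double Segal groupoids -/

/-- The category `Δ × Δ` with a new terminal object `[-1]` (called `star`) adjoined. -/
abbrev SigmaCat : Type := WithTerminal (SimplexCategory × SimplexCategory)

/-- The inclusion `Δ × Δ ⥤ Σ`. -/
abbrev sigmaIncl : SimplexCategory × SimplexCategory ⥤ SigmaCat := WithTerminal.incl

/-- The unique map `(0, 0) ⟶ [-1]`. -/
def sigmaAug : sigmaIncl.obj (⦋0⦌, ⦋0⦌) ⟶ WithTerminal.star := WithTerminal.starTerminal.from _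

/-- The groupoid `Y_{q,r}` as a functor of `(q,r)`: the underlying bisimplicial object. -/
abbrev underlying {C : Type*} [Category* C] (Y : SigmaCatᵒᵖ ⥤ C) :
    (SimplexCategory × SimplexCategory)ᵒᵖ ⥤ C :=
  sigmaIncl.op ⋙ Y

/-- The augmentation map `Y_{-1} ⟶ Y_{0,0}`. -/
abbrev augMap {C : Type*} [Category* C] (Y : SigmaCatᵒᵖ ⥤ C) :
    Y.obj (op WithTerminal.star) ⟶ (underlying Y).obj (op (⦋0⦌, ⦋0⦌)) :=
  Y.map sigmaAug.op

section ASDS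

variable (Y : SigmaCatᵒᵖ ⥤ Grpd.{v, u})

/-- The simplicial groupoid `Y_{q,•}`. -/
def fixFirst (q : ℕ) : SimplexCategoryᵒᵖ ⥤ Grpd.{v, u} :=
  (Prod.sectR ⦋q⦌ SimplexCategory).op ⋙ underlying Y

/-- The simplicial groupoid `Y_{•,r}`. -/
def fixSecond (r : ℕ) : SimplexCategoryᵒᵖ ⥤ Grpd.{v, u} :=
  (Prod.sectL SimplexCategory ⦋r⦌).op ⋙ underlying Y

/-- `Y` is double Segal: it is Segal in each variable separately. -/
structure IsDoubleSegal : Prop where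
  segal_snd : ∀ q : ℕ, IsSegal (fixFirst Y q)
  segal_fst : ∀ r : ℕ, IsSegal (fixSecond Y r)

/-- The map `Y_{k,l} ⟶ Y_{k',l'}` induced by a map `(k',l') ⟶ (k,l)` of `Δ × Δ`. -/
abbrev bimap {k l k' l' : ℕ} (a : ⦋k'⦌ ⟶ ⦋k⦌) (b : ⦋l'⦌ ⟶ ⦋l⦌) :
    (underlying Y).obj (op (⦋k⦌, ⦋l⦌)) ⟶ (underlying Y).obj (op (⦋k'⦌, ⦋l'⦌)) :=
  (underlying Y).map (Quiver.Hom.op (X := (⦋k'⦌, ⦋l'⦌)) (Y := (⦋k⦌, ⦋l⦌)) (a, b))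

lemma bimap_square {k l : ℕ} (a : ⦋0⦌ ⟶ ⦋k⦌) (b : ⦋0⦌ ⟶ ⦋l⦌) :
    bimap Y a (𝟙 ⦋l⦌) ≫ bimap Y (𝟙 ⦋0⦌) b = bimap Y (𝟙 ⦋k⦌) b ≫ bimap Y a (𝟙 ⦋0⦌) := by
  rw [← Functor.map_comp, ← Functor.map_comp, ← op_comp, ← op_comp]
  rfl

/-- `Y` is stable: a square is determined by its span of sources, and by its cospan of targets. -/
structure IsStable : Prop where
  span : (toTwoPullback (bimap Y (srcVertex 1) (𝟙 ⦋1⦌)) (bimap Y (𝟙 ⦋1⦌) (srcVertex 1))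
    (bimap Y (𝟙 ⦋0⦌) (srcVertex 1)) (bimap Y (srcVertex 1) (𝟙 ⦋0⦌))
    (bimap_square Y (srcVertex 1) (srcVertex 1))).IsEquivalence
  cospan : (toTwoPullback (bimap Y (𝟙 ⦋1⦌) (tgtVertex 1)) (bimap Y (tgtVertex 1) (𝟙 ⦋1⦌))
    (bimap Y (tgtVertex 1) (𝟙 ⦋0⦌)) (bimap Y (𝟙 ⦋0⦌) (tgtVertex 1))
    (bimap_square Y (tgtVertex 1) (tgtVertex 1)).symm).IsEquivalence

/-- The composite `Y_{1,0} ×_{Y_{0,0}} Y_{-1} ⥤ Y_{1,0} ⥤ Y_{0,0}`, where the 2-pullback is taken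
along the vertical target map and the last functor is the vertical source map. -/
def augFunctorVertical :
    CategoricalPullback (A := (underlying Y).obj (op (⦋1⦌, ⦋0⦌)))
      (B := (underlying Y).obj (op (⦋0⦌, ⦋0⦌))) (C := Y.obj (op WithTerminal.star))
      (bimap Y (tgtVertex 1) (𝟙 ⦋0⦌)) (augMap Y) ⥤ (underlying Y).obj (op (⦋0⦌, ⦋0⦌)) :=
  CategoricalPullback.π₁ _ _ ⋙ bimap Y (srcVertex 1) (𝟙 ⦋0⦌)

/-- The composite `Y_{0,1} ×_{Y_{0,0}} Y_{-1} ⥤ Y_{0,1} ⥤ Y_{0,0}`, where the 2-pullback is taken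
along the horizontal source map and the last functor is the horizontal target map. -/
def augFunctorHorizontal :
    CategoricalPullback (A := (underlying Y).obj (op (⦋0⦌, ⦋1⦌)))
      (B := (underlying Y).obj (op (⦋0⦌, ⦋0⦌))) (C := Y.obj (op WithTerminal.star))
      (bimap Y (𝟙 ⦋0⦌) (srcVertex 1)) (augMap Y) ⥤ (underlying Y).obj (op (⦋0⦌, ⦋0⦌)) :=
  CategoricalPullback.π₁ _ _ ⋙ bimap Y (𝟙 ⦋0⦌) (tgtVertex 1)

/-- `Y` is augmented. -/
structure IsAugmented : Prop where
  vertical : (augFunctorVertical Y).IsEquivalence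
  horizontal : (augFunctorHorizontal Y).IsEquivalence

/-- `Y` is an augmented stable double Segal groupoid. -/
structure IsAugmentedStableDoubleSegal : Prop where
  doubleSegal : IsDoubleSegal Y
  stable : IsStable Y
  augmented : IsAugmented Y

end ASDS

/-! ### Preaugmented bisimplicial objects from a map into the bottom level -/

/-- As `(0, 0)` is terminal in `Δ × Δ`, a bisimplicial object `X` with a map `E ⟶ X_{0,0}` is the
same as a preaugmented bisimplicial object with value `E` at `[-1]`. -/
def mkPreaugmented {C : Type*} [Category* C] (X : (SimplexCategory × SimplexCategory)ᵒᵖ ⥤ C)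
    (E : C) (a : E ⟶ X.obj (op (⦋0⦌, ⦋0⦌))) : SigmaCatᵒᵖ ⥤ C :=
  (WithTerminal.lift X.rightOp (Z := op E)
    (fun x => (a ≫ X.map (Quiver.Hom.op (X := x) (Y := (⦋0⦌, ⦋0⦌))
      (SimplexCategory.isTerminalZero.from x.1, SimplexCategory.isTerminalZero.from x.2))).op)
    (fun x y f => by
      apply Quiver.Hom.unop_inj
      change (a ≫ X.map _) ≫ X.map f.op = a ≫ X.map _
      rw [Category.assoc, ← X.map_comp]
      congr 2)).leftOp

/-- A map out of `mkPreaugmented X E a`: a map of bisimplicial objects and a compatible map of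
augmentations. -/
def mkPreaugmentedHom {C : Type*} [Category* C] (X : (SimplexCategory × SimplexCategory)ᵒᵖ ⥤ C)
    (E : C) (a : E ⟶ X.obj (op (⦋0⦌, ⦋0⦌))) (Y : SigmaCatᵒᵖ ⥤ C) (α : X ⟶ underlying Y)
    (ε : E ⟶ Y.obj (op WithTerminal.star)) (h : a ≫ α.app (op (⦋0⦌, ⦋0⦌)) = ε ≫ augMap Y) :
    mkPreaugmented X E a ⟶ Y where
  app x := match x with
    | op (WithTerminal.of x) => α.app (op x)
    | op WithTerminal.star => ε
  naturality := by
    rintro ⟨x⟩ ⟨y⟩ ⟨φ⟩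
    cases x with
    | of x =>
      cases y with
      | of y => exact α.naturality (Quiver.Hom.op φ)
      | star => exact φ.elim
    | star =>
      cases y with
      | of y =>
        let τ : y ⟶ (⦋0⦌, ⦋0⦌) :=
          (SimplexCategory.isTerminalZero.from y.1, SimplexCategory.isTerminalZero.from y.2)
        have h₁ : X.map τ.op ≫ α.app (op y) = α.app (op (⦋0⦌, ⦋0⦌)) ≫ (underlying Y).map τ.op :=
          α.naturality τ.op
        have h₂ : augMap Y ≫ (underlying Y).map τ.op = Y.map (Quiver.Hom.op φ) := by
          change Y.map _ ≫ Y.map _ = _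
          rw [← Functor.map_comp]
          rfl
        change (a ≫ X.map τ.op) ≫ α.app (op y) = ε ≫ Y.map (Quiver.Hom.op φ)
        rw [Category.assoc, h₁, ← Category.assoc, h, Category.assoc, h₂]
        rfl
      | star =>
        change 𝟙 E ≫ ε = ε ≫ Y.map (𝟙 _)
        rw [Y.map_id, Category.id_comp, Category.comp_id]

/-! ### The exact nerve -/

section ExactNerve

lemma bicartesianSq_id {D : Type u} [Category.{v} D] (Z : D) :
    BicartesianSq (𝟙 Z) (𝟙 Z) (𝟙 Z) (𝟙 Z) :=
  ⟨IsPullback.of_horiz_isIso ⟨rfl⟩, (IsPushout.of_horiz_isIso ⟨rfl⟩).isColimit'⟩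

variable {A : Type u} [Category.{v} A] [Preadditive A] [HasFiniteBiproducts A]

/-- A `(q × r)`-grid in `A` whose horizontal maps (second coordinate) are admissible
monomorphisms, whose vertical maps (first coordinate) are admissible epimorphisms and all of whose
squares are bicartesian. -/
@[ext]
structure Grid (S : ExactStructure A) (q r : SimplexCategory) : Type (max u v) where
  diagram : Fin (q.len + 1) × Fin (r.len + 1) ⥤ A
  horizontal : ∀ (i : Fin (q.len + 1)) {j l : Fin (r.len + 1)} (h : j ≤ l),
    S.M (diagram.map (X := (i, j)) (Y := (i, l)) (𝟙 i, homOfLE h))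
  vertical : ∀ {i k : Fin (q.len + 1)} (h : i ≤ k) (j : Fin (r.len + 1)),
    S.E (diagram.map (X := (i, j)) (Y := (k, j)) (homOfLE h, 𝟙 j))
  bicartesian : ∀ {i k : Fin (q.len + 1)} (h : i ≤ k) {j l : Fin (r.len + 1)} (h' : j ≤ l),
    BicartesianSq (diagram.map (X := (i, j)) (Y := (i, l)) (𝟙 i, homOfLE h'))
      (diagram.map (X := (i, j)) (Y := (k, j)) (homOfLE h, 𝟙 j))
      (diagram.map (X := (i, l)) (Y := (k, l)) (homOfLE h, 𝟙 l))
      (diagram.map (X := (k, j)) (Y := (k, l)) (𝟙 k, homOfLE h'))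

/-- Grids form a full subgroupoid of the maximal subgroupoid of the category of diagrams. -/
instance (S : ExactStructure A) (q r : SimplexCategory) : Groupoid.{v} (Grid S q r) where
  Hom F G := F.diagram ≅ G.diagram
  id F := Iso.refl F.diagram
  comp φ ψ := Iso.trans φ ψ
  id_comp φ := Iso.refl_trans φ
  comp_id φ := Iso.trans_refl φ
  assoc φ ψ χ := Iso.trans_assoc φ ψ χ
  inv φ := Iso.symm φ
  inv_comp φ := Iso.symm_self_id φ
  comp_inv φ := Iso.self_symm_id φ

/-- The functor `[q'] × [r'] ⥤ [q] × [r]` induced by a pair of monotone maps. -/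
def gridReindex {x y : SimplexCategory × SimplexCategory} (θ : x ⟶ y) :
    Fin (x.1.len + 1) × Fin (x.2.len + 1) ⥤ Fin (y.1.len + 1) × Fin (y.2.len + 1) :=
  Functor.prod (SimplexCategory.Hom.toOrderHom θ.1).monotone.functor
    (SimplexCategory.Hom.toOrderHom θ.2).monotone.functor

/-- Reindexing of grids. -/
def Grid.reindex (S : ExactStructure A) {x y : SimplexCategory × SimplexCategory} (θ : x ⟶ y) :
    Grid S y.1 y.2 ⥤ Grid S x.1 x.2 where
  obj F :=
    { diagram := gridReindex θ ⋙ F.diagram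
      horizontal := fun _ _ _ h =>
        F.horizontal _ ((SimplexCategory.Hom.toOrderHom θ.2).monotone h)
      vertical := fun h _ => F.vertical ((SimplexCategory.Hom.toOrderHom θ.1).monotone h) _
      bicartesian := fun h _ _ h' =>
        F.bicartesian ((SimplexCategory.Hom.toOrderHom θ.1).monotone h)
          ((SimplexCategory.Hom.toOrderHom θ.2).monotone h') }
  map φ := Functor.isoWhiskerLeft (gridReindex θ) φ
  map_id _ := rfl
  map_comp _ _ := rfl

/-- The underlying bisimplicial groupoid of the exact nerve. -/
def exactNerveBisimplicial (S : ExactStructure A) :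
    (SimplexCategory × SimplexCategory)ᵒᵖ ⥤ Grpd.{v, max u v} where
  obj x := Grpd.of (Grid S x.unop.1 x.unop.2)
  map θ := Grid.reindex S θ.unop
  map_id _ := rfl
  map_comp _ _ := rfl

variable (A) in
/-- The zero objects of `A`. -/
structure ZeroObj : Type (max u v) where
  obj : A
  isZero : IsZero obj

/-- The full subgroupoid of the maximal subgroupoid of `A` on the zero objects. -/
instance : Groupoid.{v} (ZeroObj.{v} A) where
  Hom X Y := X.obj ≅ Y.obj
  id X := Iso.refl X.obj
  comp φ ψ := Iso.trans φ ψ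
  id_comp φ := Iso.refl_trans φ
  comp_id φ := Iso.trans_refl φ
  assoc φ ψ χ := Iso.trans_assoc φ ψ χ
  inv φ := Iso.symm φ
  inv_comp φ := Iso.symm_self_id φ
  comp_inv φ := Iso.self_symm_id φ

/-- The inclusion of the zero objects into the groupoid of `(0 × 0)`-grids, that is, into the
maximal subgroupoid of `A`. -/
def ZeroObj.incl (S : ExactStructure A) : ZeroObj.{v} A ⥤ Grid S ⦋0⦌ ⦋0⦌ where
  obj Z :=
    { diagram := (Functor.const _).obj Z.obj
      horizontal := fun _ _ _ _ => S.M_id_of_isZero Z.isZero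
      vertical := fun _ _ => S.E_id_of_isZero Z.isZero
      bicartesian := fun _ _ _ _ => bicartesianSq_id Z.obj }
  map φ := (Functor.const _).mapIso φ
  map_id _ := rfl
  map_comp _ _ := rfl

/-- The exact nerve of an exact category. -/
def exactNerve (S : ExactStructure A) : SigmaCatᵒᵖ ⥤ Grpd.{v, max u v} :=
  mkPreaugmented (exactNerveBisimplicial S) (Grpd.of (ZeroObj.{v} A)) (ZeroObj.incl S)

variable {B : Type u} [Category.{v} B] [Preadditive B] [HasFiniteBiproducts B]
  {SA : ExactStructure A} {SB : ExactStructure B} {f : A ⥤ B}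

/-- Application of an exact functor to grids. -/
def Grid.mapFunctor (hf : IsExactFunctor SA SB f) (q r : SimplexCategory) :
    Grid SA q r ⥤ Grid SB q r where
  obj F :=
    { diagram := F.diagram ⋙ f
      horizontal := fun i _ _ h => hf.map_M (F.horizontal i h)
      vertical := fun h j => hf.map_E (F.vertical h j)
      bicartesian := fun {i k} h {j l} h' => hf.map_bicartesianSq (F.bicartesian h h')
        (F.horizontal i h') (F.vertical h j) (F.vertical h l) (F.horizontal k h') }
  map φ := Functor.isoWhiskerRight φ f
  map_id _ := Iso.ext (Functor.whiskerRight_id' f)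
  map_comp φ ψ := Iso.ext (Functor.whiskerRight_comp φ.hom ψ.hom f)

/-- Application of an exact functor to zero objects. -/
def ZeroObj.mapFunctor (hf : IsExactFunctor SA SB f) : ZeroObj.{v} A ⥤ ZeroObj.{v} B where
  obj Z := ⟨f.obj Z.obj, hf.map_isZero Z.isZero⟩
  map φ := f.mapIso φ
  map_id _ := f.mapIso_refl _
  map_comp φ ψ := f.mapIso_trans φ ψ

lemma ZeroObj.incl_mapFunctor (hf : IsExactFunctor SA SB f) :
    ZeroObj.incl SA ⋙ Grid.mapFunctor hf ⦋0⦌ ⦋0⦌ = ZeroObj.mapFunctor hf ⋙ ZeroObj.incl SB := by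
  have hd : ∀ Z : ZeroObj.{v} A, ((Functor.const (Fin (0 + 1) × Fin (0 + 1))).obj Z.obj) ⋙ f =
      (Functor.const _).obj (f.obj Z.obj) := fun Z =>
    CategoryTheory.Functor.ext (fun _ => rfl) (fun _ _ _ => by simp)
  have hobj : ∀ Z : ZeroObj.{v} A, (ZeroObj.incl SA ⋙ Grid.mapFunctor hf ⦋0⦌ ⦋0⦌).obj Z =
      (ZeroObj.mapFunctor hf ⋙ ZeroObj.incl SB).obj Z := fun Z => Grid.ext (hd Z)
  have e : ∀ {F G : Grid SB ⦋0⦌ ⦋0⦌} (h : F = G),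
      Iso.hom (C := Fin (0 + 1) × Fin (0 + 1) ⥤ B) (X := F.diagram) (Y := G.diagram) (eqToHom h) =
        eqToHom (congrArg Grid.diagram h) := by
    rintro F _ rfl; rfl
  refine CategoryTheory.Functor.ext hobj fun Z W φ => ?_
  apply Iso.ext
  apply NatTrans.ext
  funext x
  change f.map φ.hom = (Iso.hom (C := Fin (0 + 1) × Fin (0 + 1) ⥤ B) (eqToHom (hobj Z))).app x ≫
    f.map φ.hom ≫ (Iso.hom (C := Fin (0 + 1) × Fin (0 + 1) ⥤ B) (eqToHom (hobj W).symm)).app x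
  rw [e, e, eqToHom_app, eqToHom_app]
  exact ((Category.id_comp _).trans (Category.comp_id _)).symm

/-- The map of exact nerves induced by an exact functor. -/
def exactNerveMap (hf : IsExactFunctor SA SB f) : exactNerve SA ⟶ exactNerve SB :=
  mkPreaugmentedHom _ _ _ (exactNerve SB)
    { app := fun x => Grid.mapFunctor hf x.unop.1 x.unop.2
      naturality := fun _ _ _ => rfl }
    (ZeroObj.mapFunctor hf) (ZeroObj.incl_mapFunctor hf)

end ExactNerve

/-! ### The initial path construction and the relative exact nerve -/

/-- The functor `[n] ↦ [0] ⋆ [n]` on `Δ`, adjoining a new initial element. -/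
def joinPoint : SimplexCategory ⥤ SimplexCategory where
  obj n := ⦋n.len + 1⦌
  map {m n} θ := SimplexCategory.Hom.mk
    ⟨Fin.cases 0 (fun i => (SimplexCategory.Hom.toOrderHom θ i).succ), by
      intro i j h
      induction i using Fin.cases with
      | zero => exact Fin.zero_le _
      | succ i =>
        induction j using Fin.cases with
        | zero => exact absurd h (by simp)
        | succ j =>
          exact Fin.succ_le_succ_iff.2
            ((SimplexCategory.Hom.toOrderHom θ).monotone (Fin.succ_le_succ_iff.1 h))⟩
  map_id _ := by
    ext i : 3
    induction i using Fin.cases <;> rfl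
  map_comp θ θ' := by
    ext i : 3
    induction i using Fin.cases <;> rfl

/-- The coface `d⁰ : [n] ⟶ [0] ⋆ [n]` omitting the new initial element. -/
def joinPointFace : 𝟭 SimplexCategory ⟶ joinPoint where
  app _ := SimplexCategory.Hom.mk ⟨Fin.succ, fun _ _ h => Fin.succ_le_succ_iff.2 h⟩
  naturality _ _ _ := rfl

section Path

variable (Y : SigmaCatᵒᵖ ⥤ Grpd.{v, u})

/-- The face map `d₀ : Y_{1+q,r} ⟶ Y_{q,r}`, as a map of bisimplicial groupoids. -/
def pathFace : (joinPoint.prod (𝟭 SimplexCategory)).op ⋙ underlying Y ⟶ underlying Y where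
  app x := (underlying Y).map (Quiver.Hom.op (X := x.unop)
    (Y := (joinPoint.obj x.unop.1, x.unop.2)) (joinPointFace.app x.unop.1, 𝟙 x.unop.2))
  naturality x y θ := by
    change (underlying Y).map _ ≫ (underlying Y).map _ = (underlying Y).map _ ≫ _
    rw [← Functor.map_comp, ← Functor.map_comp]
    rfl

/-- The groupoid `Y_{1,0} ×_{Y_{0,0}} Y_{-1}`, a strict pullback along `d₀` (the vertical target)
and the augmentation. -/
abbrev pathAug : Grpd.{v, u} :=
  Grpd.of (StrictPullback ((pathFace Y).app (op (⦋0⦌, ⦋0⦌))) (augMap Y))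

/-- The initial path construction: `(P Y)_{q,r} = Y_{1+q,r}` and
`(P Y)_{-1} = Y_{1,0} ×_{Y_{0,0}} Y_{-1}`, with augmentation the first projection. -/
def initialPath : SigmaCatᵒᵖ ⥤ Grpd.{v, u} :=
  mkPreaugmented ((joinPoint.prod (𝟭 SimplexCategory)).op ⋙ underlying Y) (pathAug Y)
    (StrictPullback.pr₁ ((pathFace Y).app (op (⦋0⦌, ⦋0⦌))) (augMap Y))

/-- The canonical map `d₀ : P Y ⟶ Y`: the face map `d₀` in degree `(q,r)` and the second projection
`Y_{1,0} ×_{Y_{0,0}} Y_{-1} ⟶ Y_{-1}` in degree `-1`. -/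
def initialPathFace : initialPath Y ⟶ Y :=
  mkPreaugmentedHom _ _ _ Y (pathFace Y)
    (StrictPullback.pr₂ ((pathFace Y).app (op (⦋0⦌, ⦋0⦌))) (augMap Y))
    (StrictPullback.condition ((pathFace Y).app (op (⦋0⦌, ⦋0⦌))) (augMap Y))

end Path

/-- The relative exact nerve of an exact functor: the pullback of
`N^e A ⟶ N^e B ⟵ P (N^e B)` in the category of preaugmented bisimplicial groupoids. -/
def relativeExactNerve {A B : Type u} [Category.{v} A] [Preadditive A] [HasFiniteBiproducts A]
    [Category.{v} B] [Preadditive B] [HasFiniteBiproducts B] {SA : ExactStructure A}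
    {SB : ExactStructure B} {f : A ⥤ B} (hf : IsExactFunctor SA SB f) :
    SigmaCatᵒᵖ ⥤ Grpd.{v, max u v} :=
  levelwisePullback (exactNerveMap hf) (initialPathFace (exactNerve SB))

/-- The relative exact nerve has the universal property of the pullback. -/
theorem relativeExactNerve_isPullback {A B : Type u} [Category.{v} A] [Preadditive A]
    [HasFiniteBiproducts A] [Category.{v} B] [Preadditive B] [HasFiniteBiproducts B]
    {SA : ExactStructure A} {SB : ExactStructure B} {f : A ⥤ B} (hf : IsExactFunctor SA SB f) :
    IsPullback (P := relativeExactNerve hf)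
      (levelwisePullbackFst (exactNerveMap hf) (initialPathFace (exactNerve SB)))
      (levelwisePullbackSnd (exactNerveMap hf) (initialPathFace (exactNerve SB)))
      (exactNerveMap hf) (initialPathFace (exactNerve SB)) :=
  levelwisePullback_isPullback _ _

end

/-! An object of the relative nerve in degree (q, r) is a (q × r)-grid in `A` together with one
further row in `B`, placed before the first row of its image under `f` and mapping to it by
admissible epimorphisms. Read position by position, this is a (q × r)-grid in the category `RelObj`
of triples (b, a, b ↠ f a), in which b does not change in the vertical direction. Call a map of
triples horizontal if both components are in M and the square it forms in `B` is bicartesian,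
vertical if its `B`-component is invertible and its `A`-component is in E, and call a commutative
square distinguished if its `A`-part is bicartesian (`RelObj.squareClass`). Asking for an invertible
`B`-component rather than an identity makes the notion invariant under isomorphism and changes
nothing up to equivalence: `RelGrid.comparison` is an equivalence, strictly natural in (q, r). All
three conditions are invariant under such equivalences, so they can be checked on grids of triples.

The Segal conditions hold for every `SquareClass`, because squares paste: a chain of grids of length
one, glued along isomorphisms of columns, composes to a longer grid (`assemble`). Transposition
gives the other direction.

Stability is `RelObj.squareClass_isStable`. Distinguished squares are pushouts and pullbacks of
triples, so each is determined by its span or cospan. A span is completed by a pushout in `A`, a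
cospan by a pullback in `A`. For the cospan the new structure map exists because `f` preserves the
bicartesian square, and it is in E because it is a pullback of a given one.

For the augmentation, degree -1 corresponds to the triples with a = 0. A triple b ↠ f a has an
essentially unique vertical map to b ↠ f 0, and an essentially unique horizontal map from K ↠ f 0
with K the kernel of b ↠ f a: a bicartesian square with a zero object in that corner exhibits a
kernel.

From exact categories this needs the consequences of the axioms that are not among them: M is closed
under composition (`M.comp`), pushouts of maps in M and pullbacks of maps in E are bicartesian, E is
stable under pushout along M, and M under pullback along E. -/

noncomputable section

/-! ### Elementary properties of exact categories -/

attribute [local instance] hasBinaryBiproducts_of_finite_biproducts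

open scoped ZeroObject

namespace ExactStructure

variable {A : Type u} [Category.{v} A] [Preadditive A] [HasFiniteBiproducts A]
  {S : ExactStructure A}

section Conflation

variable {X Y Z : A} {i : X ⟶ Y} {p : Y ⟶ Z} {w : i ≫ p = 0}

lemma mono_of_conflation (h : S.conflation (ShortComplex.mk i p w)) : Mono i := by
  obtain ⟨l⟩ := S.isKernel _ h
  simpa using mono_of_isLimit_fork l

lemma epi_of_conflation (h : S.conflation (ShortComplex.mk i p w)) : Epi p := by
  obtain ⟨l⟩ := S.isCokernel _ h
  simpa using epi_of_isColimit_cofork l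

lemma exists_lift_of_conflation (h : S.conflation (ShortComplex.mk i p w)) {T : A} (t : T ⟶ Y)
    (ht : t ≫ p = 0) : ∃ l : T ⟶ X, l ≫ i = t := by
  obtain ⟨l⟩ := S.isKernel _ h
  exact ⟨_, (KernelFork.IsLimit.lift' l t ht).2⟩

lemma exists_desc_of_conflation (h : S.conflation (ShortComplex.mk i p w)) {T : A} (t : Y ⟶ T)
    (ht : i ≫ t = 0) : ∃ l : Z ⟶ T, p ≫ l = t := by
  obtain ⟨l⟩ := S.isCokernel _ h
  exact ⟨_, (CokernelCofork.IsColimit.desc' l t ht).2⟩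

/-- A kernel of an admissible epimorphism completes it to a conflation. -/
lemma conflation_of_kernel (hp : S.E p) [Mono i]
    (hl : ∀ {T : A} (t : T ⟶ Y), t ≫ p = 0 → ∃ l : T ⟶ X, l ≫ i = t) :
    S.conflation (ShortComplex.mk i p w) := by
  obtain ⟨K, k, wk, h⟩ := hp
  have := mono_of_conflation h
  obtain ⟨a, ha⟩ := exists_lift_of_conflation h i w
  obtain ⟨b, hb⟩ := hl k wk
  have hab : a ≫ b = 𝟙 _ := by rw [← cancel_mono i, Category.assoc, hb, ha, Category.id_comp]
  have hba : b ≫ a = 𝟙 _ := by rw [← cancel_mono k, Category.assoc, ha, hb, Category.id_comp]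
  refine S.of_iso ?_ h
  exact ShortComplex.isoMk ⟨b, a, hba, hab⟩ (Iso.refl _) (Iso.refl _)
    (by simpa using hb) (by simp)

/-- A cokernel of an admissible monomorphism completes it to a conflation. -/
lemma conflation_of_cokernel (hi : S.M i) [Epi p]
    (hl : ∀ {T : A} (t : Y ⟶ T), i ≫ t = 0 → ∃ l : Z ⟶ T, p ≫ l = t) :
    S.conflation (ShortComplex.mk i p w) := by
  obtain ⟨K, k, wk, h⟩ := hi
  have := epi_of_conflation h
  obtain ⟨a, ha⟩ := exists_desc_of_conflation h p w
  obtain ⟨b, hb⟩ := hl k wk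
  have hab : a ≫ b = 𝟙 _ := by rw [← cancel_epi k, ← Category.assoc, ha, hb, Category.comp_id]
  have hba : b ≫ a = 𝟙 _ := by rw [← cancel_epi p, ← Category.assoc, hb, ha, Category.comp_id]
  refine S.of_iso ?_ h
  exact ShortComplex.isoMk (Iso.refl _) (Iso.refl _) ⟨a, b, hab, hba⟩
    (by simp) (by simpa using ha.symm)

end Conflation

lemma M.mono {X Y : A} {i : X ⟶ Y} (hi : S.M i) : Mono i := by
  obtain ⟨_, _, _, h⟩ := hi
  exact mono_of_conflation h

lemma E.epi {X Y : A} {p : X ⟶ Y} (hp : S.E p) : Epi p := by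
  obtain ⟨_, _, _, h⟩ := hp
  exact epi_of_conflation h

lemma E.comp {X Y Z : A} {p : X ⟶ Y} {q : Y ⟶ Z} (hp : S.E p) (hq : S.E q) : S.E (p ≫ q) :=
  S.epi_comp p q hp hq

variable (S) in
-- Pulling back the identity of a zero object along `X ⟶ 0` gives an admissible epimorphism onto `X`
-- that is invertible, and its conflation is carried over to `e`. The kernel is zero because its
-- inclusion is both monic and zero.
lemma exists_conflation_zero_iso {X Y : A} (e : X ⟶ Y) [IsIso e] :
    ∃ (K : A) (_ : IsZero K) (i : K ⟶ X) (w : i ≫ e = 0),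
      S.conflation (ShortComplex.mk i e w) := by
  have := hasZeroObject_of_hasFiniteBiproducts A
  have hZ : IsZero (0 : A) := isZero_zero A
  obtain ⟨B, g, p, sq, K, i, w, h⟩ := S.pullback_epi (0 : X ⟶ 0) (𝟙 0) (S.id_zero _ hZ)
  have : IsIso p := sq.isIso_snd_of_isIso
  have := mono_of_conflation h
  have hi : i = 0 := by rw [← cancel_mono p, w, zero_comp]
  have hK : IsZero K := by
    rw [IsZero.iff_id_eq_zero, ← cancel_mono i, hi, comp_zero, comp_zero]
  refine ⟨K, hK, 0, zero_comp, S.of_iso ?_ h⟩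
  exact ShortComplex.isoMk (Iso.refl _) (asIso p) (asIso e) (by simp [hi]) (by simp)

variable (S) in
lemma exists_conflation_iso_zero {X Y : A} (e : X ⟶ Y) [IsIso e] :
    ∃ (K : A) (_ : IsZero K) (p : Y ⟶ K) (w : e ≫ p = 0),
      S.conflation (ShortComplex.mk e p w) := by
  have := hasZeroObject_of_hasFiniteBiproducts A
  have hZ : IsZero (0 : A) := isZero_zero A
  obtain ⟨B, g, i, sq, K, p, w, h⟩ := S.pushout_mono (0 : 0 ⟶ X) (𝟙 0) (S.M_id_of_isZero hZ)
  have : IsIso i := sq.isIso_inr_of_isIso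
  have := epi_of_conflation h
  have hi : p = 0 := by rw [← cancel_epi i, w, comp_zero]
  have hK : IsZero K := by
    rw [IsZero.iff_id_eq_zero, ← cancel_epi p, hi, zero_comp, zero_comp]
  refine ⟨K, hK, 0, comp_zero, S.of_iso ?_ h⟩
  exact ShortComplex.isoMk (Iso.refl _) (asIso (inv i ≫ e)) (Iso.refl _) (by simp) (by simp [hi])

variable (S) in
lemma E_of_isIso {X Y : A} (e : X ⟶ Y) [IsIso e] : S.E e := by
  obtain ⟨K, _, i, w, h⟩ := S.exists_conflation_zero_iso e
  exact ⟨K, i, w, h⟩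

variable (S) in
lemma M_of_isIso {X Y : A} (e : X ⟶ Y) [IsIso e] : S.M e := by
  obtain ⟨K, _, i, w, h⟩ := S.exists_conflation_iso_zero e
  exact ⟨K, i, w, h⟩

/-- The cokernel of `𝟙 X` is a zero object, so `X` maps to some zero object by an admissible
epimorphism; any other zero object differs from it by an isomorphism. -/
lemma E_of_isZero {X Z : A} (hZ : IsZero Z) (p : X ⟶ Z) : S.E p := by
  obtain ⟨K, hK, i, w, h⟩ := S.exists_conflation_iso_zero (𝟙 X)
  have : IsIso ((hK.iso hZ).hom) := inferInstance
  have e : p = i ≫ (hK.iso hZ).hom := hZ.eq_of_tgt _ _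
  rw [e]
  exact E.comp ⟨_, _, w, h⟩ (S.E_of_isIso _)

lemma M_of_isZero {X Z : A} (hZ : IsZero Z) (i : Z ⟶ X) : S.M i := by
  obtain ⟨K, hK, k, w, h⟩ := S.exists_conflation_zero_iso (𝟙 X)
  refine ⟨X, 𝟙 X, hZ.eq_of_src _ _, S.of_iso ?_ h⟩
  exact ShortComplex.isoMk (hK.iso hZ) (Iso.refl _) (Iso.refl _) (hK.eq_of_src _ _) (by simp)

lemma E.of_isPullback {P X Y Z : A} {g : P ⟶ X} {p : P ⟶ Y} {p' : X ⟶ Z} {f : Y ⟶ Z}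
    (sq : IsPullback g p p' f) (hp : S.E p') : S.E p := by
  obtain ⟨B, g', q, sq', hq⟩ := S.pullback_epi f p' hp
  have e : p = (sq.isoIsPullback _ _ sq').hom ≫ q := by simp
  rw [e]
  exact (S.E_of_isIso _).comp hq

lemma M.of_isPushout {X Y X' Y' : A} {i : X ⟶ Y} {g : X ⟶ X'} {h : Y ⟶ Y'} {i' : X' ⟶ Y'}
    (sq : IsPushout i g h i') (hi : S.M i) : S.M i' := by
  obtain ⟨W, h', j, sq', C, p, w, hc⟩ := S.pushout_mono g i hi
  let e := sq'.isoIsPushout _ _ sq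
  have he : j ≫ e.hom = i' := by simp [e]
  refine ⟨C, e.inv ≫ p, by simp [← he, w], S.of_iso ?_ hc⟩
  exact ShortComplex.isoMk (Iso.refl _) e (Iso.refl _) (by simp [he]) (by simp)

/-- The kernel of `q` lifts through the pullback to a map killed by `p`. Hence in any cocone the leg
out of `b` kills this kernel and factors through `q`, which is its cokernel. -/
lemma isPushout_of_isPullback_of_E {a b c d : A} {i : a ⟶ b} {p : a ⟶ c} {q : b ⟶ d} {j : c ⟶ d}
    (sq : IsPullback i p q j) (hq : S.E q) : IsPushout i p q j := by
  have hp := E.of_isPullback sq hq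
  have := hp.epi
  have := hq.epi
  obtain ⟨L, k, wk, h⟩ := hq
  have key (s : PushoutCocone i p) : ∃ l : d ⟶ s.pt, q ≫ l = s.inl :=
    exists_desc_of_conflation h s.inl (by
      have hm : sq.lift k (0 : L ⟶ c) (by rw [wk, zero_comp]) ≫ i = k := sq.lift_fst _ _ _
      rw [← hm, Category.assoc, s.condition, sq.lift_snd_assoc, zero_comp])
  choose l hl using key
  exact ⟨⟨sq.w⟩, ⟨PushoutCocone.IsColimit.mk sq.w l hl
    (fun s => by rw [← cancel_epi p, ← sq.w_assoc, hl, s.condition])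
    (fun s m h1 _ => by rw [← cancel_epi q, h1, hl])⟩⟩

lemma isPullback_of_isPushout_of_M {a b c d : A} {i : a ⟶ b} {p : a ⟶ c} {q : b ⟶ d} {j : c ⟶ d}
    (sq : IsPushout i p q j) (hi : S.M i) : IsPullback i p q j := by
  have hj := M.of_isPushout sq hi
  have := hj.mono
  have := hi.mono
  obtain ⟨L, k, wk, h⟩ := hi
  have key (s : PullbackCone q j) : ∃ l : s.pt ⟶ a, l ≫ i = s.fst :=
    exists_lift_of_conflation h s.fst (by
      have hm : q ≫ sq.desc k (0 : c ⟶ L) (by rw [wk, comp_zero]) = k := sq.inl_desc _ _ _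
      rw [← hm, ← Category.assoc, s.condition, Category.assoc, sq.inr_desc, comp_zero])
  choose l hl using key
  exact ⟨⟨sq.w⟩, ⟨PullbackCone.IsLimit.mk sq.w l hl
    (fun s => by rw [← cancel_mono j, Category.assoc, ← sq.w, reassoc_of% (hl s), s.condition])
    (fun s m h1 _ => by rw [← cancel_mono i, h1, hl])⟩⟩

/-- Cobase change does not alter the cokernel: the new one is induced by `p` on `Y` and by zero on
`X'`. -/
lemma conflation_of_isPushout {X Y Z X' Y' : A} {i : X ⟶ Y} {p : Y ⟶ Z} {w : i ≫ p = 0}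
    (h : S.conflation (ShortComplex.mk i p w)) {g : X ⟶ X'} {k : Y ⟶ Y'} {i' : X' ⟶ Y'}
    (sq : IsPushout i g k i') :
    ∃ (p' : Y' ⟶ Z) (w' : i' ≫ p' = 0), k ≫ p' = p ∧ S.conflation (ShortComplex.mk i' p' w') := by
  have hk : k ≫ sq.desc p (0 : X' ⟶ Z) (by rw [w, comp_zero]) = p := sq.inl_desc _ _ _
  have := epi_of_conflation h
  have : Epi (sq.desc p (0 : X' ⟶ Z) (by rw [w, comp_zero])) := epi_of_epi_fac hk
  refine ⟨_, sq.inr_desc _ _ _, hk, conflation_of_cokernel (M.of_isPushout sq ⟨_, _, w, h⟩) ?_⟩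
  intro T t ht
  obtain ⟨l, hl⟩ := exists_desc_of_conflation h (k ≫ t) (by rw [sq.w_assoc, ht, comp_zero])
  exact ⟨l, sq.hom_ext (by rw [reassoc_of% hk, hl]) (by rw [sq.inr_desc_assoc, ht, zero_comp])⟩

/-- If `i' : P ⟶ W` is a pushout of `j : Y ⟶ Z` in `M`, the map `Z ⊞ P ⟶ W` is in `E`. -/
lemma E_biprodDesc_of_isPushout {Y Z P W : A} {j : Y ⟶ Z} {p : Y ⟶ P} {h : Z ⟶ W} {j' : P ⟶ W}
    (sq : IsPushout j p h j') (hj : S.M j) : S.E (biprod.desc h j') := by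
  obtain ⟨Q, q, w, hc⟩ := hj
  obtain ⟨q', w', hq, hc'⟩ := conflation_of_isPushout hc sq
  have := mono_of_conflation hc'
  have comm : biprod.fst ≫ q = biprod.desc h j' ≫ q' := by
    apply biprod.hom_ext' <;> simp [hq, w']
  -- `Z ⊞ P` is the fibre product of `Z` and `W` over `Q`: a pair (z, w) with equal images in `Q`
  -- corresponds to (z, w - h z), whose second entry lies in the kernel `P` of `q'`.
  have key (s : PullbackCone q q') : ∃ l : s.pt ⟶ P, l ≫ j' = s.snd - s.fst ≫ h :=
    exists_lift_of_conflation hc' _ (by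
      rw [Preadditive.sub_comp, Category.assoc, hq, s.condition, sub_self])
  choose l hl using key
  have pb : IsPullback biprod.fst (biprod.desc h j') q q' :=
    ⟨⟨comm⟩, ⟨PullbackCone.IsLimit.mk comm (fun s => biprod.lift s.fst (l s))
      (fun s => by simp) (fun s => by simp [hl]) (fun s m h1 h2 => by
        apply biprod.hom_ext
        · simpa using h1
        · rw [← cancel_mono j', biprod.lift_snd, hl, ← h1, ← h2, biprod.desc_eq]
          simp)⟩⟩
  exact E.of_isPullback pb ⟨_, _, w, hc⟩

lemma E_biprodMap_id {Y P : A} (Z : A) {p : Y ⟶ P} (hp : S.E p) :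
    S.E (biprod.map (𝟙 Z) p) := by
  have comm : biprod.snd ≫ p = biprod.map (𝟙 Z) p ≫ biprod.snd := by simp
  have pb : IsPullback biprod.snd (biprod.map (𝟙 Z) p) p biprod.snd :=
    ⟨⟨comm⟩, ⟨PullbackCone.IsLimit.mk comm (fun s => biprod.lift (s.snd ≫ biprod.fst) s.fst)
      (fun s => by simp) (fun s => by
        apply biprod.hom_ext
        · simp
        · simpa using s.condition) (fun s m h1 h2 => by
        apply biprod.hom_ext
        · simp [← h2]
        · simpa using h1)⟩⟩
  exact E.of_isPullback pb hp

/-- Admissible monomorphisms are closed under composition. -/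
lemma M.comp {X Y Z : A} {i : X ⟶ Y} {j : Y ⟶ Z} (hi : S.M i) (hj : S.M j) : S.M (i ≫ j) := by
  obtain ⟨P, p, w, hc⟩ := hi
  obtain ⟨W, h, j', sq, hj'⟩ := S.pushout_mono p j hj
  have sq' := isPullback_of_isPushout_of_M sq hj
  have := mono_of_conflation hc
  have := hj.mono
  have := M.mono hj'
  -- The cokernel of `i ≫ j` should be `h`, but `h` is not yet known to be in `E`. An additional
  -- summand `Y` repairs this: the map (h, j ≫ h) is 𝟙 ⊞ p followed by (h, j'), and both of these
  -- are in `E`.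
  have hE : S.E (biprod.desc h (j ≫ h)) := by
    have e : biprod.map (𝟙 Z) p ≫ biprod.desc h j' = biprod.desc h (j ≫ h) := by
      apply biprod.hom_ext' <;> simp [sq.w]
    rw [← e]
    exact (E_biprodMap_id Z ⟨_, _, w, hc⟩).comp (E_biprodDesc_of_isPushout sq hj)
  have wh : i ≫ j ≫ h = 0 := by rw [sq.w, reassoc_of% w, zero_comp]
  -- In elements κ(x, y) = (j i x - j y, y). This is a kernel of (z, y) ↦ h (z + j y), since the
  -- elements killed by `h` are those in the image of `i ≫ j`.
  let κ : X ⊞ Y ⟶ Z ⊞ Y := biprod.desc (i ≫ j ≫ biprod.inl) (biprod.inr - j ≫ biprod.inl)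
  have κfst : κ ≫ biprod.fst = biprod.fst ≫ i ≫ j - biprod.snd ≫ j := by
    apply biprod.hom_ext' <;> simp [κ]
  have κsnd : κ ≫ biprod.snd = biprod.snd := by apply biprod.hom_ext' <;> simp [κ]
  have κz : κ ≫ biprod.desc h (j ≫ h) = 0 := by apply biprod.hom_ext' <;> simp [κ, wh]
  have : Mono κ := by
    refine Preadditive.mono_of_cancel_zero _ fun g hg => ?_
    have h2 : g ≫ biprod.snd = 0 := by rw [← κsnd, reassoc_of% hg, zero_comp]
    have h1 : g ≫ biprod.fst ≫ i ≫ j = 0 := by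
      have : g ≫ κ ≫ biprod.fst = 0 := by rw [reassoc_of% hg, zero_comp]
      rwa [κfst, Preadditive.comp_sub, reassoc_of% h2, zero_comp, sub_zero] at this
    apply biprod.hom_ext
    · rw [← cancel_mono (i ≫ j), Category.assoc, h1, zero_comp, zero_comp]
    · rw [h2, zero_comp]
  have hκ : S.conflation (ShortComplex.mk κ _ κz) := by
    refine conflation_of_kernel hE fun {T} t ht => ?_
    have ht' : (t ≫ biprod.fst + t ≫ biprod.snd ≫ j) ≫ h = (0 : T ⟶ P) ≫ j' := by
      rw [biprod.desc_eq] at ht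
      simpa using ht
    obtain ⟨l, hl⟩ := exists_lift_of_conflation hc (sq'.lift _ _ ht') (sq'.lift_snd _ _ _)
    have hl' : l ≫ i ≫ j = t ≫ biprod.fst + t ≫ biprod.snd ≫ j := by
      rw [reassoc_of% hl, sq'.lift_fst]
    refine ⟨biprod.lift l (t ≫ biprod.snd), ?_⟩
    apply biprod.hom_ext
    · rw [Category.assoc, κfst]
      simp [hl']
    · rw [Category.assoc, κsnd]
      simp
  have comm : κ ≫ biprod.desc (𝟙 Z) j = biprod.fst ≫ i ≫ j := by
    apply biprod.hom_ext' <;> simp [κ]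
  -- Pushing `κ` out along the projection to `X` removes the auxiliary summand and leaves `i ≫ j`.
  have po : IsPushout κ biprod.fst (biprod.desc (𝟙 Z) j) (i ≫ j) := by
    refine ⟨⟨comm⟩, ⟨PushoutCocone.IsColimit.mk comm (fun s => biprod.inl ≫ s.inl)
      (fun s => ?_) (fun s => ?_) (fun s m h1 h2 => ?_)⟩⟩
    · have := biprod.inr ≫= s.condition
      have h0 : biprod.inr ≫ s.inl = j ≫ biprod.inl ≫ s.inl := by
        simpa [κ, sub_eq_zero] using this
      apply biprod.hom_ext' <;> simp [h0]
    · have := biprod.inl ≫= s.condition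
      simpa [κ] using this
    · rw [← h1]
      simp
  exact M.of_isPushout po ⟨_, _, κz, hκ⟩

/-- With `k` the kernel of `p`, the map `q` is a cokernel of `k ≫ i`, which is admissible by
`M.comp`. -/
lemma E.of_isPushout {a b c d : A} {i : a ⟶ b} {p : a ⟶ c} {q : b ⟶ d} {j : c ⟶ d}
    (sq : IsPushout i p q j) (hi : S.M i) (hp : S.E p) : S.E q := by
  obtain ⟨L, k, w, h⟩ := hp
  have hk : S.M k := ⟨_, _, w, h⟩
  have hepi := epi_of_conflation h
  have : Epi q := ⟨fun s t hst => sq.hom_ext hst (by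
    rw [← cancel_epi p, ← sq.w_assoc, ← sq.w_assoc, hst])⟩
  refine ⟨L, k ≫ i, by rw [Category.assoc, sq.w, reassoc_of% w, zero_comp],
    conflation_of_cokernel (hk.comp hi) fun {T} t ht => ?_⟩
  obtain ⟨l, hl⟩ := exists_desc_of_conflation h (i ≫ t) (by simpa using ht)
  exact ⟨sq.desc t l hl.symm, sq.inl_desc _ _ _⟩

/-- With `k` the cokernel of `j`, the map `i` is a kernel of `q ≫ k`, which is in `E` as a
composite. -/
lemma M.of_isPullback {a b c d : A} {i : a ⟶ b} {p : a ⟶ c} {q : b ⟶ d} {j : c ⟶ d}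
    (sq : IsPullback i p q j) (hq : S.E q) (hj : S.M j) : S.M i := by
  obtain ⟨L, k, w, h⟩ := hj
  have hk : S.E k := ⟨_, _, w, h⟩
  have hmono := mono_of_conflation h
  have : Mono i := ⟨fun s t hst => sq.hom_ext hst (by
    rw [← cancel_mono j, Category.assoc, Category.assoc, ← sq.w, reassoc_of% hst])⟩
  refine ⟨L, q ≫ k, by rw [sq.w_assoc, w, comp_zero],
    conflation_of_kernel (hq.comp hk) fun {T} t ht => ?_⟩
  obtain ⟨l, hl⟩ := exists_lift_of_conflation h (t ≫ q) (by simpa using ht)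
  exact ⟨sq.lift t l hl.symm, sq.lift_fst _ _ _⟩

lemma bicartesianSq_of_isPullback {a b c d : A} {i : a ⟶ b} {p : a ⟶ c} {q : b ⟶ d} {j : c ⟶ d}
    (sq : IsPullback i p q j) (hq : S.E q) : BicartesianSq i p q j :=
  .of_isPullback_isPushout sq (isPushout_of_isPullback_of_E sq hq)

lemma bicartesianSq_of_isPushout {a b c d : A} {i : a ⟶ b} {p : a ⟶ c} {q : b ⟶ d} {j : c ⟶ d}
    (sq : IsPushout i p q j) (hi : S.M i) : BicartesianSq i p q j :=
  .of_isPullback_isPushout (isPullback_of_isPushout_of_M sq hi) sq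

/-- A conflation is a bicartesian square with a zero object as lower left corner. -/
lemma bicartesianSq_of_conflation {X Y Z O : A} {i : X ⟶ Y} {p : Y ⟶ Z} {w : i ≫ p = 0}
    (h : S.conflation (ShortComplex.mk i p w)) (hO : IsZero O) (a : X ⟶ O) (b : O ⟶ Z) :
    BicartesianSq i a p b := by
  have := mono_of_conflation h
  have comm : i ≫ p = a ≫ b := by rw [w, hO.eq_of_src b 0, comp_zero]
  have key (s : PullbackCone p b) : ∃ l : s.pt ⟶ X, l ≫ i = s.fst :=
    exists_lift_of_conflation h s.fst (by
      rw [s.condition]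
      exact (congrArg (s.snd ≫ ·) (hO.eq_of_src b 0)).trans comp_zero)
  choose l hl using key
  exact bicartesianSq_of_isPullback ⟨⟨comm⟩, ⟨PullbackCone.IsLimit.mk comm l hl
    (fun s => hO.eq_of_tgt _ _) (fun s m h1 _ => by rw [← cancel_mono i, h1, hl])⟩⟩ ⟨_, _, w, h⟩

end ExactStructure

end

noncomputable section

/-! ### Invariance of the Segal, stability and augmentation conditions under equivalence -/

section Invariance

/-- This keeps the invariance arguments short: the functor induced on (iterated) 2-pullbacks by
levelwise equivalences only has to be fully faithful, and its essential surjectivity is never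
needed. -/
lemma isEquivalence_of_comp_fullyFaithful {C D E : Type*} [Category* C] [Category* D]
    [Category* E] (T : C ⥤ D) (U : D ⥤ E) [U.Full] [U.Faithful] (h : (T ⋙ U).IsEquivalence) :
    T.IsEquivalence where
  faithful := Functor.Faithful.of_comp T U
  full := Functor.Full.of_comp_faithful T U
  essSurj := ⟨fun y => ⟨_, ⟨U.preimageIso ((T ⋙ U).objObjPreimageIso (U.obj y))⟩⟩⟩

namespace IteratedTwoPullback

variable {E O E' O' : Type u} [Groupoid.{v} E] [Groupoid.{v} O] [Groupoid.{v} E']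
  [Groupoid.{v} O'] {s t : E ⥤ O} {s' t' : E' ⥤ O'} (a : E ⥤ E') (b : O ⥤ O')
  (es : s ⋙ b ≅ a ⋙ s') (et : t ⋙ b ≅ a ⋙ t') (n : ℕ)

/-- Functoriality of iterated 2-pullbacks. -/
def mapFunctor : IteratedTwoPullback s t n ⥤ IteratedTwoPullback s' t' n where
  obj x := ⟨fun i => a.obj (x.obj i),
    fun i h => (et.app _).symm ≪≫ b.mapIso (x.iso i h) ≪≫ es.app _⟩
  map φ := ⟨fun i => a.map (φ.app i), fun i h => by
    have h₁ := es.hom.naturality (φ.app ⟨i + 1, h⟩)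
    have h₂ := et.inv.naturality (φ.app ⟨i, by lia⟩)
    have h₃ := congrArg b.map (φ.comm i h)
    simp only [Functor.comp_map, Functor.map_comp] at h₁ h₂ h₃
    simp only [Iso.trans_hom, Iso.symm_hom, Functor.mapIso_hom, Iso.app_inv, Iso.app_hom,
      Category.assoc, ← h₁, reassoc_of% h₂, reassoc_of% h₃]⟩
  map_id x := Hom.ext (funext fun _ => a.map_id _)
  map_comp φ ψ := Hom.ext (funext fun _ => a.map_comp _ _)

instance [a.Faithful] : (mapFunctor a b es et n).Faithful where
  map_injective h := Hom.ext (funext fun i => a.map_injective (congrFun (congrArg Hom.app h) i))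

instance [a.Full] [b.Faithful] : (mapFunctor a b es et n).Full where
  map_surjective {x y} φ := by
    refine ⟨⟨fun i => a.preimage (φ.app i), fun i h => b.map_injective ?_⟩,
      Hom.ext (funext fun i => a.map_preimage _)⟩
    have h₁ := es.hom.naturality (a.preimage (φ.app ⟨i + 1, h⟩))
    have h₂ := et.inv.naturality (a.preimage (φ.app ⟨i, by lia⟩))
    have h₃ := φ.comm i h
    simp only [Functor.comp_map, Functor.map_preimage, mapFunctor, Iso.trans_hom, Iso.symm_hom,
      Functor.mapIso_hom, Iso.app_inv, Iso.app_hom, Category.assoc] at h₁ h₂ h₃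
    -- Naturality of `es` and `et` moves the comparison isomorphisms to the two ends, where they
    -- cancel.
    rw [reassoc_of% h₂, ← h₁, cancel_epi, ← Category.assoc, ← Category.assoc, cancel_mono] at h₃
    simpa using h₃

/-- Every morphism of an iterated 2-pullback of groupoids is invertible. -/
def isoOfHom {x y : IteratedTwoPullback s t n} (φ : x ⟶ y) : x ≅ y where
  hom := φ
  inv := ⟨fun i => inv (φ.app i), fun i h => by
    have h₁ := φ.comm i h
    rw [Functor.map_inv, Functor.map_inv, IsIso.inv_comp_eq, ← Category.assoc, h₁, Category.assoc,
      IsIso.hom_inv_id, Category.comp_id]⟩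
  hom_inv_id := Hom.ext (funext fun _ => IsIso.hom_inv_id _)
  inv_hom_id := Hom.ext (funext fun _ => IsIso.inv_hom_id _)

end IteratedTwoPullback

/-- The morphism `φ` is of the form `eqToHom`. -/
def IsEqToHom {C : Type*} [Category* C] {x y : C} (φ : x ⟶ y) : Prop :=
  ∃ h : x = y, φ = eqToHom h

namespace IsEqToHom

variable {C D : Type*} [Category* C] [Category* D]

/-- Strictly commutative squares of groupoids produce coherence conditions between composites of
transports along equalities. Each side is shown to be of this form, and they then agree without
computation. -/
lemma unique {x y : C} {φ ψ : x ⟶ y} (h₁ : IsEqToHom φ) (h₂ : IsEqToHom ψ) : φ = ψ := by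
  obtain ⟨_, rfl⟩ := h₁
  obtain ⟨_, rfl⟩ := h₂
  rfl

lemma eqToHom {x y : C} (h : x = y) : IsEqToHom (eqToHom h) := ⟨h, rfl⟩

lemma comp {x y z : C} {φ : x ⟶ y} {ψ : y ⟶ z} (h₁ : IsEqToHom φ) (h₂ : IsEqToHom ψ) :
    IsEqToHom (φ ≫ ψ) := by
  obtain ⟨rfl, rfl⟩ := h₁
  obtain ⟨rfl, rfl⟩ := h₂
  exact ⟨rfl, by simp⟩

lemma map (F : C ⥤ D) {x y : C} {φ : x ⟶ y} (h : IsEqToHom φ) : IsEqToHom (F.map φ) := by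
  obtain ⟨rfl, rfl⟩ := h
  exact ⟨rfl, by simp⟩

lemma hom_app {F G : C ⥤ D} (h : F = G) (x : C) : IsEqToHom ((eqToIso h).hom.app x) := by
  subst h
  exact ⟨rfl, rfl⟩

lemma inv_app {F G : C ⥤ D} (h : F = G) (x : C) : IsEqToHom ((eqToIso h).inv.app x) := by
  subst h
  exact ⟨rfl, rfl⟩

end IsEqToHom

lemma eqToHom_congr_functor_obj {C D : Type*} [Category* C] [Category* D] {F G : C ⥤ D}
    (h : F = G) {x y : C} (φ : x ⟶ y) :
    F.map φ ≫ eqToHom (Functor.congr_obj h y) = eqToHom (Functor.congr_obj h x) ≫ G.map φ := by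
  subst h; simp

/-- The Segal condition is invariant under levelwise equivalence. -/
lemma IsSegal.of_levelwise_equivalence {X X' : SimplexCategoryᵒᵖ ⥤ Grpd.{v, u}} (α : X ⟶ X')
    (hα : ∀ n : ℕ, Functor.IsEquivalence (C := X.obj (op ⦋n⦌)) (D := X'.obj (op ⦋n⦌))
      (α.app (op ⦋n⦌)))
    (h : IsSegal X') : IsSegal X := by
  intro n hn
  have nat {k m : ℕ} (θ : ⦋k⦌ ⟶ ⦋m⦌) : Functor.comp (C := X.obj (op ⦋m⦌))
      (D := X.obj (op ⦋k⦌)) (E := X'.obj (op ⦋k⦌)) (X.map θ.op) (α.app (op ⦋k⦌)) =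
      Functor.comp (D := X'.obj (op ⦋m⦌)) (α.app (op ⦋m⦌)) (X'.map θ.op) := α.naturality θ.op
  have h0 := hα 0
  have h1 := hα 1
  have hn' := hα n
  have hT := h n hn
  let U := IteratedTwoPullback.mapFunctor (E := X.obj (op ⦋1⦌)) (O := X.obj (op ⦋0⦌))
    (E' := X'.obj (op ⦋1⦌)) (O' := X'.obj (op ⦋0⦌)) (α.app (op ⦋1⦌)) (α.app (op ⦋0⦌))
    (eqToIso (nat (srcVertex 1))) (eqToIso (nat (tgtVertex 1))) n
  apply isEquivalence_of_comp_fullyFaithful _ U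
  have hi : Functor.comp (C := X.obj (op ⦋n⦌)) (D := X'.obj (op ⦋n⦌)) (α.app (op ⦋n⦌))
    (segalMap X' n) ≅ segalMap X n ⋙ U := by
    refine NatIso.ofComponents (fun x => IteratedTwoPullback.isoOfHom _
      ⟨fun i => eqToHom (Functor.congr_obj (nat (SimplexCategory.mkOfSucc i)) x).symm,
        fun i h => ?_⟩) fun φ => IteratedTwoPullback.Hom.ext (funext fun i => ?_)
    · exact IsEqToHom.unique (((IsEqToHom.eqToHom _).map _).comp ((IsEqToHom.inv_app _ _).comp
        (((IsEqToHom.eqToHom (Functor.congr_obj (segal_aux X n i h) x)).map _).comp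
          (IsEqToHom.hom_app _ _))))
        ((IsEqToHom.eqToHom (Functor.congr_obj (segal_aux X' n i h) _)).comp
          ((IsEqToHom.eqToHom _).map _))
    · exact eqToHom_congr_functor_obj (nat (SimplexCategory.mkOfSucc i)).symm φ
  exact Functor.isEquivalence_of_iso hi

section TwoPullback

variable {A B C A' B' C' : Type*} [Category* A] [Category* B] [Category* C] [Category* A']
  [Category* B'] [Category* C'] {F : A ⥤ B} {G : C ⥤ B} {F' : A' ⥤ B'} {H : C' ⥤ B'}
  (a : A ⥤ A') (b : B ⥤ B') (c : C ⥤ C') (e₁ : F ⋙ b ≅ a ⋙ F') (e₂ : G ⋙ b ≅ c ⋙ H)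

/-- Functoriality of 2-pullbacks. -/
def twoPullbackMap : CategoricalPullback F G ⥤ CategoricalPullback F' H where
  obj x := ⟨a.obj x.fst, c.obj x.snd, (e₁.app _).symm ≪≫ b.mapIso x.iso ≪≫ e₂.app _⟩
  map φ := ⟨a.map φ.fst, c.map φ.snd, by
    have h₁ := e₂.hom.naturality φ.snd
    have h₂ := e₁.inv.naturality φ.fst
    have h₃ := congrArg b.map φ.w
    simp only [Functor.comp_map, Functor.map_comp] at h₁ h₂ h₃
    simp only [Iso.trans_hom, Iso.symm_hom, Functor.mapIso_hom, Iso.app_inv, Iso.app_hom,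
      Category.assoc, ← h₁, reassoc_of% h₂, reassoc_of% h₃]⟩
  map_id x := CategoricalPullback.hom_ext (a.map_id _) (c.map_id _)
  map_comp φ ψ := CategoricalPullback.hom_ext (a.map_comp _ _) (c.map_comp _ _)

instance [a.Faithful] [c.Faithful] : (twoPullbackMap a b c e₁ e₂).Faithful where
  map_injective h := CategoricalPullback.hom_ext
    (a.map_injective (congrArg CategoricalPullback.Hom.fst h))
    (c.map_injective (congrArg CategoricalPullback.Hom.snd h))

instance [a.Full] [c.Full] [b.Faithful] : (twoPullbackMap a b c e₁ e₂).Full where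
  map_surjective {x y} φ := by
    refine ⟨⟨a.preimage φ.fst, c.preimage φ.snd, b.map_injective ?_⟩,
      CategoricalPullback.hom_ext (a.map_preimage _) (c.map_preimage _)⟩
    have h₁ := e₂.hom.naturality (c.preimage φ.snd)
    have h₂ := e₁.inv.naturality (a.preimage φ.fst)
    have h₃ := φ.w
    simp only [Functor.comp_map, Functor.map_preimage, twoPullbackMap, Iso.trans_hom,
      Iso.symm_hom, Functor.mapIso_hom, Iso.app_inv, Iso.app_hom, Category.assoc] at h₁ h₂ h₃
    rw [reassoc_of% h₂, ← h₁, cancel_epi, ← Category.assoc, ← Category.assoc, cancel_mono] at h₃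
    simpa using h₃

end TwoPullback

/-- The condition that a square of groupoids be a 2-pullback is invariant under equivalence. -/
lemma toTwoPullback_isEquivalence_of_equivalence {W X Y Z W' X' Y' Z' : Grpd.{v, u}} {f : W ⟶ X}
    {g : W ⟶ Y} {h : X ⟶ Z} {k : Y ⟶ Z} {w : f ≫ h = g ≫ k} {f' : W' ⟶ X'} {g' : W' ⟶ Y'}
    {h' : X' ⟶ Z'} {k' : Y' ⟶ Z'} {w' : f' ≫ h' = g' ≫ k'} (αW : W ⟶ W') (αX : X ⟶ X')
    (αY : Y ⟶ Y') (αZ : Z ⟶ Z') (hf : f ≫ αX = αW ≫ f') (hg : g ≫ αY = αW ≫ g')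
    (hh : h ≫ αZ = αX ≫ h') (hk : k ≫ αZ = αY ≫ k')
    (eW : Functor.IsEquivalence (C := W) (D := W') αW)
    (eX : Functor.IsEquivalence (C := X) (D := X') αX)
    (eY : Functor.IsEquivalence (C := Y) (D := Y') αY)
    (eZ : Functor.IsEquivalence (C := Z) (D := Z') αZ)
    (hT : (toTwoPullback f' g' h' k' w').IsEquivalence) :
    (toTwoPullback f g h k w).IsEquivalence := by
  let U := twoPullbackMap (A := X) (B := Z) (C := Y) (A' := X') (B' := Z') (C' := Y') (F := h)
    (G := k) (F' := h') (H := k') αX αZ αY (eqToIso hh) (eqToIso hk)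
  apply isEquivalence_of_comp_fullyFaithful _ U
  have hf : Functor.comp (C := W) (D := X) (E := X') f αX = Functor.comp (D := W') αW f' := hf
  have hg : Functor.comp (C := W) (D := Y) (E := Y') g αY = Functor.comp (D := W') αW g' := hg
  have hi : Functor.comp (C := W) (D := W') αW (toTwoPullback f' g' h' k' w') ≅
      toTwoPullback f g h k w ⋙ U := by
    refine NatIso.ofComponents (fun x => CategoricalPullback.mkIso
      (eqToIso (Functor.congr_obj hf x).symm) (eqToIso (Functor.congr_obj hg x).symm) ?_)
      fun φ => CategoricalPullback.hom_ext ?_ ?_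
    · exact IsEqToHom.unique (((IsEqToHom.eqToHom (Functor.congr_obj hf x).symm).map _).comp
        ((IsEqToHom.inv_app _ _).comp
          (((IsEqToHom.hom_app _ _).map _).comp (IsEqToHom.hom_app _ _))))
        ((IsEqToHom.hom_app _ _).comp ((IsEqToHom.eqToHom (Functor.congr_obj hg x).symm).map _))
    · exact eqToHom_congr_functor_obj hf.symm φ
    · exact eqToHom_congr_functor_obj hg.symm φ
  exact Functor.isEquivalence_of_iso hi

section Augmentation

variable {E O N : Type*} [Category* E] [Category* O] [Category* N] {s t : E ⥤ O} {a : N ⥤ O}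

/-- If `a` is fully faithful, the projection of the 2-pullback of `t` and `a` is the inclusion of
the full subcategory on the objects whose image under `t` is in the essential image of `a`. -/
lemma twoPullback_fst_comp_isEquivalence [a.Full] [a.Faithful]
    (hs : ∀ x y : E, a.essImage (t.obj x) → a.essImage (t.obj y) →
      Function.Bijective (s.map : (x ⟶ y) → _))
    (hess : ∀ o : O, ∃ x : E, a.essImage (t.obj x) ∧ Nonempty (s.obj x ≅ o)) :
    (CategoricalPullback.π₁ t a ⋙ s).IsEquivalence where
  faithful := ⟨fun {x y φ ψ} h => by
    have h₁ : φ.fst = ψ.fst := (hs _ _ ⟨_, ⟨x.iso.symm⟩⟩ ⟨_, ⟨y.iso.symm⟩⟩).1 h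
    refine CategoricalPullback.hom_ext h₁ (a.map_injective ?_)
    rw [← cancel_epi x.iso.hom, ← φ.w, ← ψ.w, h₁]⟩
  full := ⟨fun {x y} φ => by
    obtain ⟨ψ, hψ⟩ := (hs _ _ ⟨_, ⟨x.iso.symm⟩⟩ ⟨_, ⟨y.iso.symm⟩⟩).2 φ
    exact ⟨⟨ψ, a.preimage (x.iso.inv ≫ t.map ψ ≫ y.iso.hom), by simp⟩, hψ⟩⟩
  essSurj := ⟨fun o => by
    obtain ⟨x, ⟨n, ⟨e⟩⟩, ⟨e'⟩⟩ := hess o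
    exact ⟨⟨x, n, e.symm⟩, ⟨e'⟩⟩⟩

variable {E' O' : Type*} [Category* E'] [Category* O'] {s' t' : E' ⥤ O'}

/-- Only `s` and `t` are replaced by an equivalent model. The augmentation `a` enters through its
essential image alone, described in the model by `P`, so no model of `N` is required. -/
lemma twoPullback_fst_comp_isEquivalence_of_equivalence (ha : a.Full) (ha' : a.Faithful)
    (αE : E ⥤ E') (αO : O ⥤ O') (hE : αE.IsEquivalence) (hO : αO.IsEquivalence)
    (es : s ⋙ αO ≅ αE ⋙ s')
    (et : t ⋙ αO ≅ αE ⋙ t') (P : ObjectProperty O') (_ : P.IsClosedUnderIsomorphisms)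
    (hP : ∀ o : O, a.essImage o ↔ P (αO.obj o))
    (hs : ∀ x y : E', P (t'.obj x) → P (t'.obj y) → Function.Bijective (s'.map : (x ⟶ y) → _))
    (hess : ∀ o : O', ∃ x : E', P (t'.obj x) ∧ Nonempty (s'.obj x ≅ o)) :
    (CategoricalPullback.π₁ t a ⋙ s).IsEquivalence := by
  apply twoPullback_fst_comp_isEquivalence
  · intro x y hx hy
    have hb := hs (αE.obj x) (αE.obj y) (P.prop_of_iso (et.app x) ((hP _).1 hx))
      (P.prop_of_iso (et.app y) ((hP _).1 hy))
    have key (φ : x ⟶ y) : αO.map (s.map φ) = es.hom.app x ≫ s'.map (αE.map φ) ≫ es.inv.app y := by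
      have := es.hom.naturality φ
      simp only [Functor.comp_map] at this
      rw [← reassoc_of% this, Iso.hom_inv_id_app]
      exact (Category.comp_id _).symm
    constructor
    · intro φ ψ h
      have := congrArg αO.map h
      rw [key, key, cancel_epi, cancel_mono] at this
      exact αE.map_injective (hb.1 this)
    · intro φ
      obtain ⟨ψ, hψ⟩ := hb.2 (es.inv.app x ≫ αO.map φ ≫ es.hom.app y)
      refine ⟨αE.preimage ψ, αO.map_injective ?_⟩
      rw [key, αE.map_preimage, hψ]
      simp
  · intro o
    obtain ⟨x, hx, ⟨e⟩⟩ := hess (αO.obj o)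
    let i := αE.objObjPreimageIso x
    refine ⟨αE.objPreimage x, (hP _).2 (P.prop_of_iso (t'.mapIso i.symm ≪≫ (et.app _).symm) hx),
      ⟨αO.preimageIso (es.app _ ≪≫ s'.mapIso i ≪≫ e)⟩⟩

end Augmentation

end Invariance

end

noncomputable section

/-! ### Nerves of categories with distinguished squares -/

/-- A relation on the ordered pairs of `Fin (n + 1)` that is reflexive, transitive and holds for
consecutive elements holds for all of them. -/
lemma Fin.le_induction_of_steps {n : ℕ} {P : ∀ j l : Fin (n + 1), j ≤ l → Prop}
    (refl : ∀ j, P j j le_rfl) (step : ∀ k : Fin n, P k.castSucc k.succ (Fin.castSucc_le_succ k))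
    (trans : ∀ {j k l : Fin (n + 1)} (h : j ≤ k) (h' : k ≤ l), P j k h → P k l h' →
      P j l (h.trans h')) (j l : Fin (n + 1)) (h : j ≤ l) : P j l h := by
  induction l using Fin.induction with
  | zero =>
    obtain rfl : j = 0 := Fin.le_zero_iff.1 h
    exact refl 0
  | succ k ih =>
    rcases h.eq_or_lt with rfl | h'
    · exact refl _
    · have hk : j ≤ k.castSucc := Fin.le_castSucc_iff.2 h'
      exact trans hk _ (ih hk) (step k)

section Grid

variable {D : Type u} [Category.{v} D] {P Q : Type*} [Preorder P] [Preorder Q] (F : P × Q ⥤ D)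

lemma map_prod_homOfLE_trans_snd (i : P) {j k l : Q} (h : j ≤ k) (h' : k ≤ l) :
    F.map (X := (i, j)) (Y := (i, l)) (𝟙 i, homOfLE (h.trans h')) =
      F.map (X := (i, j)) (Y := (i, k)) (𝟙 i, homOfLE h) ≫
        F.map (X := (i, k)) (Y := (i, l)) (𝟙 i, homOfLE h') := by
  rw [← F.map_comp]
  rfl

lemma map_prod_homOfLE_trans_fst {i j k : P} (h : i ≤ j) (h' : j ≤ k) (l : Q) :
    F.map (X := (i, l)) (Y := (k, l)) (homOfLE (h.trans h'), 𝟙 l) =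
      F.map (X := (i, l)) (Y := (j, l)) (homOfLE h, 𝟙 l) ≫
        F.map (X := (j, l)) (Y := (k, l)) (homOfLE h', 𝟙 l) := by
  rw [← F.map_comp]
  rfl

lemma map_prod_homOfLE_refl_snd (i : P) (j : Q) :
    F.map (X := (i, j)) (Y := (i, j)) (𝟙 i, homOfLE le_rfl) = 𝟙 (F.obj (i, j)) :=
  F.map_id (i, j)

lemma map_prod_homOfLE_refl_fst (i : P) (j : Q) :
    F.map (X := (i, j)) (Y := (i, j)) (homOfLE le_rfl, 𝟙 j) = 𝟙 (F.obj (i, j)) :=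
  F.map_id (i, j)

lemma map_prod_eq {x y : P × Q} (f : x ⟶ y) :
    F.map f = F.map (X := (x.1, x.2)) (Y := (y.1, x.2)) (homOfLE f.1.le, 𝟙 x.2) ≫
      F.map (X := (y.1, x.2)) (Y := (y.1, y.2)) (𝟙 y.1, homOfLE f.2.le) := by
  rw [← F.map_comp]
  rfl

lemma map_prod_comm {i k : P} (h : i ≤ k) {j l : Q} (h' : j ≤ l) :
    F.map (X := (i, j)) (Y := (i, l)) (𝟙 i, homOfLE h') ≫
      F.map (X := (i, l)) (Y := (k, l)) (homOfLE h, 𝟙 l) =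
    F.map (X := (i, j)) (Y := (k, j)) (homOfLE h, 𝟙 j) ≫
      F.map (X := (k, j)) (Y := (k, l)) (𝟙 k, homOfLE h') := by
  rw [← F.map_comp, ← F.map_comp]
  rfl

end Grid

/-- A category with two classes of morphisms and a class of commutative squares, closed under
composition and containing the isomorphisms. -/
structure SquareClass (D : Type u) [Category.{v} D] where
  horizontal : ∀ {x y : D}, (x ⟶ y) → Prop
  vertical : ∀ {x y : D}, (x ⟶ y) → Prop
  square : ∀ {a b c d : D}, (a ⟶ b) → (a ⟶ c) → (b ⟶ d) → (c ⟶ d) → Prop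
  horizontal_of_isIso : ∀ {x y : D} (f : x ⟶ y) [IsIso f], horizontal f
  horizontal_comp : ∀ {x y z : D} {f : x ⟶ y} {g : y ⟶ z}, horizontal f → horizontal g →
    horizontal (f ≫ g)
  vertical_of_isIso : ∀ {x y : D} (f : x ⟶ y) [IsIso f], vertical f
  vertical_comp : ∀ {x y z : D} {f : x ⟶ y} {g : y ⟶ z}, vertical f → vertical g →
    vertical (f ≫ g)
  square_of_horizontal_isIso : ∀ {a b c d : D} {i : a ⟶ b} {p : a ⟶ c} {q : b ⟶ d} {j : c ⟶ d}
    [IsIso i] [IsIso j], i ≫ q = p ≫ j → square i p q j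
  square_of_vertical_isIso : ∀ {a b c d : D} {i : a ⟶ b} {p : a ⟶ c} {q : b ⟶ d} {j : c ⟶ d}
    [IsIso p] [IsIso q], i ≫ q = p ≫ j → square i p q j
  square_paste_horizontal : ∀ {a b c a' b' c' : D} {i : a ⟶ b} {i' : b ⟶ c} {p : a ⟶ a'}
    {q : b ⟶ b'} {r : c ⟶ c'} {j : a' ⟶ b'} {j' : b' ⟶ c'}, square i p q j → square i' q r j' →
    square (i ≫ i') p r (j ≫ j')
  square_paste_vertical : ∀ {a b a' b' a'' b'' : D} {i : a ⟶ b} {j : a' ⟶ b'} {k : a'' ⟶ b''}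
    {p : a ⟶ a'} {q : b ⟶ b'} {p' : a' ⟶ a''} {q' : b' ⟶ b''}, square i p q j →
    square j p' q' k → square i (p ≫ p') (q ≫ q') k

namespace SquareClass

variable {D : Type u} [Category.{v} D]

/-- Exchange of the horizontal and the vertical direction. -/
def transpose (T : SquareClass D) : SquareClass D where
  horizontal := T.vertical
  vertical := T.horizontal
  square i p q j := T.square p i j q
  horizontal_of_isIso := T.vertical_of_isIso
  horizontal_comp := T.vertical_comp
  vertical_of_isIso := T.horizontal_of_isIso
  vertical_comp := T.horizontal_comp
  square_of_horizontal_isIso h := T.square_of_vertical_isIso h.symm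
  square_of_vertical_isIso h := T.square_of_horizontal_isIso h.symm
  square_paste_horizontal := T.square_paste_vertical
  square_paste_vertical := T.square_paste_horizontal

/-- A `(q × r)`-grid of distinguished squares. -/
@[ext]
structure Diagram (T : SquareClass D) (q r : SimplexCategory) : Type (max u v) where
  diagram : Fin (q.len + 1) × Fin (r.len + 1) ⥤ D
  horizontal : ∀ (i : Fin (q.len + 1)) {j l : Fin (r.len + 1)} (h : j ≤ l),
    T.horizontal (diagram.map (X := (i, j)) (Y := (i, l)) (𝟙 i, homOfLE h))
  vertical : ∀ {i k : Fin (q.len + 1)} (h : i ≤ k) (j : Fin (r.len + 1)),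
    T.vertical (diagram.map (X := (i, j)) (Y := (k, j)) (homOfLE h, 𝟙 j))
  square : ∀ {i k : Fin (q.len + 1)} (h : i ≤ k) {j l : Fin (r.len + 1)} (h' : j ≤ l),
    T.square (diagram.map (X := (i, j)) (Y := (i, l)) (𝟙 i, homOfLE h'))
      (diagram.map (X := (i, j)) (Y := (k, j)) (homOfLE h, 𝟙 j))
      (diagram.map (X := (i, l)) (Y := (k, l)) (homOfLE h, 𝟙 l))
      (diagram.map (X := (k, j)) (Y := (k, l)) (𝟙 k, homOfLE h'))

variable (T : SquareClass D)

instance (q r : SimplexCategory) : Groupoid.{v} (T.Diagram q r) where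
  Hom F G := F.diagram ≅ G.diagram
  id F := Iso.refl F.diagram
  comp φ ψ := Iso.trans φ ψ
  id_comp φ := Iso.refl_trans φ
  comp_id φ := Iso.trans_refl φ
  assoc φ ψ χ := Iso.trans_assoc φ ψ χ
  inv φ := Iso.symm φ
  inv_comp φ := Iso.symm_self_id φ
  comp_inv φ := Iso.self_symm_id φ

/-- Reindexing of grids. -/
def reindex {x y : SimplexCategory × SimplexCategory} (θ : x ⟶ y) :
    T.Diagram y.1 y.2 ⥤ T.Diagram x.1 x.2 where
  obj F :=
    { diagram := gridReindex θ ⋙ F.diagram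
      horizontal := fun _ _ _ h =>
        F.horizontal _ ((SimplexCategory.Hom.toOrderHom θ.2).monotone h)
      vertical := fun h _ => F.vertical ((SimplexCategory.Hom.toOrderHom θ.1).monotone h) _
      square := fun h _ _ h' =>
        F.square ((SimplexCategory.Hom.toOrderHom θ.1).monotone h)
          ((SimplexCategory.Hom.toOrderHom θ.2).monotone h') }
  map φ := Functor.isoWhiskerLeft (gridReindex θ) φ
  map_id _ := rfl
  map_comp _ _ := rfl

/-- The bisimplicial groupoid of grids of distinguished squares. -/
def nerve : (SimplexCategory × SimplexCategory)ᵒᵖ ⥤ Grpd.{v, max u v} where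
  obj x := Grpd.of (T.Diagram x.unop.1 x.unop.2)
  map θ := T.reindex θ.unop
  map_id _ := rfl
  map_comp _ _ := rfl

variable {T}

namespace Diagram

variable {q r : SimplexCategory}

/-- The component of a morphism of grids. -/
def comp {F G : T.Diagram q r} (φ : F ⟶ G) (i : Fin (q.len + 1)) (j : Fin (r.len + 1)) :
    F.diagram.obj (i, j) ⟶ G.diagram.obj (i, j) :=
  (Iso.hom (C := Fin (q.len + 1) × Fin (r.len + 1) ⥤ D) φ).app (i, j)

lemma hom_ext {F G : T.Diagram q r} {φ ψ : F ⟶ G} (h : ∀ i j, comp φ i j = comp ψ i j) :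
    φ = ψ := by
  apply Iso.ext
  ext ⟨i, j⟩
  exact h i j

lemma isEqToHom_comp {F G : T.Diagram q r} {φ : F ⟶ G} (h : IsEqToHom φ) (i : Fin (q.len + 1))
    (j : Fin (r.len + 1)) : IsEqToHom (comp φ i j) := by
  obtain ⟨rfl, rfl⟩ := h
  exact ⟨rfl, rfl⟩

end Diagram

/-- An isomorphism of grid-shaped diagrams is determined by its components, and has to be natural
for vertical maps and horizontal steps only. -/
def gridIso {q n : ℕ} {F G : Fin (q + 1) × Fin (n + 1) ⥤ D}
    (e : ∀ x, F.obj x ≅ G.obj x)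
    (hv : ∀ {i k : Fin (q + 1)} (h : i ≤ k) (j : Fin (n + 1)),
      F.map (X := (i, j)) (Y := (k, j)) (homOfLE h, 𝟙 j) ≫ (e (k, j)).hom =
        (e (i, j)).hom ≫ G.map (X := (i, j)) (Y := (k, j)) (homOfLE h, 𝟙 j))
    (hh : ∀ (i : Fin (q + 1)) (k : Fin n),
      F.map (X := (i, k.castSucc)) (Y := (i, k.succ)) (𝟙 i, homOfLE (Fin.castSucc_le_succ k)) ≫
        (e (i, k.succ)).hom = (e (i, k.castSucc)).hom ≫
          G.map (X := (i, k.castSucc)) (Y := (i, k.succ))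
            (𝟙 i, homOfLE (Fin.castSucc_le_succ k))) : F ≅ G :=
  NatIso.ofComponents e (by
    have hh' (i : Fin (q + 1)) (j l : Fin (n + 1)) (h : j ≤ l) :
        F.map (X := (i, j)) (Y := (i, l)) (𝟙 i, homOfLE h) ≫ (e (i, l)).hom =
          (e (i, j)).hom ≫ G.map (X := (i, j)) (Y := (i, l)) (𝟙 i, homOfLE h) := by
      refine Fin.le_induction_of_steps (P := fun j l h =>
        F.map (X := (i, j)) (Y := (i, l)) (𝟙 i, homOfLE h) ≫ (e (i, l)).hom =
          (e (i, j)).hom ≫ G.map (X := (i, j)) (Y := (i, l)) (𝟙 i, homOfLE h)) ?_ (hh i) ?_ j l h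
      · intro j
        rw [map_prod_homOfLE_refl_snd, map_prod_homOfLE_refl_snd, Category.id_comp,
          Category.comp_id]
      · intro j k l h h' h₁ h₂
        rw [map_prod_homOfLE_trans_snd F i h h', map_prod_homOfLE_trans_snd G i h h',
          Category.assoc, h₂, reassoc_of% h₁]
    rintro ⟨i, j⟩ ⟨k, l⟩ f
    rw [map_prod_eq F, map_prod_eq G, Category.assoc, hh', reassoc_of% (hv f.1.le j)])

section Chain

variable {q n : ℕ} (C : Fin (n + 1) → (Fin (q + 1) ⥤ D))
  (σ : ∀ k : Fin n, C k.castSucc ⟶ C k.succ)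

/-- The grid-shaped diagram with columns `C` and horizontal steps `σ`. -/
def chainDiagram : Fin (q + 1) × Fin (n + 1) ⥤ D :=
  Functor.uncurry.obj (ComposableArrows.mkOfObjOfMapSucc C σ).flip

lemma chainDiagram_map_vertical {i k : Fin (q + 1)} (h : i ≤ k) (j : Fin (n + 1)) :
    (chainDiagram C σ).map (X := (i, j)) (Y := (k, j)) (homOfLE h, 𝟙 j) =
      (C j).map (homOfLE h) := by
  simp [chainDiagram]

lemma chainDiagram_map_step (i : Fin (q + 1)) (k : Fin n) :
    (chainDiagram C σ).map (X := (i, k.castSucc)) (Y := (i, k.succ))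
      (𝟙 i, homOfLE (Fin.castSucc_le_succ k)) = (σ k).app i := by
  have h := congrArg (fun τ => NatTrans.app τ i)
    (ComposableArrows.mkOfObjOfMapSucc_map_succ C σ k k.2)
  exact ((congrArg (· ≫ _) ((C k.castSucc).map_id i)).trans (Category.id_comp _)).trans h

/-- Grids of distinguished squares from columns and horizontal steps. -/
def Diagram.ofChain
    (hv : ∀ (j : Fin (n + 1)) {i k : Fin (q + 1)} (h : i ≤ k), T.vertical ((C j).map (homOfLE h)))
    (hh : ∀ (k : Fin n) (i : Fin (q + 1)), T.horizontal ((σ k).app i))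
    (hs : ∀ (l : Fin n) {i k : Fin (q + 1)} (h : i ≤ k), T.square ((σ l).app i)
      ((C l.castSucc).map (homOfLE h)) ((C l.succ).map (homOfLE h)) ((σ l).app k)) :
    T.Diagram ⦋q⦌ ⦋n⦌ where
  diagram := chainDiagram C σ
  vertical h j := by
    rw [chainDiagram_map_vertical]
    exact hv j h
  horizontal i j l h := by
    refine Fin.le_induction_of_steps (P := fun j l h => T.horizontal ((chainDiagram C σ).map
      (X := (i, j)) (Y := (i, l)) (𝟙 i, homOfLE h))) (fun j => ?_) (fun k => ?_) ?_ j l h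
    · rw [map_prod_homOfLE_refl_snd]
      exact T.horizontal_of_isIso _
    · rw [chainDiagram_map_step]
      exact hh k i
    · intro j k l h h' h₁ h₂
      rw [map_prod_homOfLE_trans_snd _ i h h']
      exact T.horizontal_comp h₁ h₂
  square {i k} h j l h' := by
    refine Fin.le_induction_of_steps (P := fun j l h' => T.square
      ((chainDiagram C σ).map (X := (i, j)) (Y := (i, l)) (𝟙 i, homOfLE h'))
      ((chainDiagram C σ).map (X := (i, j)) (Y := (k, j)) (homOfLE h, 𝟙 j))
      ((chainDiagram C σ).map (X := (i, l)) (Y := (k, l)) (homOfLE h, 𝟙 l))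
      ((chainDiagram C σ).map (X := (k, j)) (Y := (k, l)) (𝟙 k, homOfLE h')))
      (fun j => ?_) (fun l => ?_) ?_ j l h'
    · rw [map_prod_homOfLE_refl_snd, map_prod_homOfLE_refl_snd]
      exact T.square_of_horizontal_isIso (by simp)
    · rw [chainDiagram_map_step, chainDiagram_map_step, chainDiagram_map_vertical,
        chainDiagram_map_vertical]
      exact hs l h
    · intro j k l h h' h₁ h₂
      rw [map_prod_homOfLE_trans_snd _ _ h h', map_prod_homOfLE_trans_snd _ _ h h']
      exact T.square_paste_horizontal h₁ h₂

end Chain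

end SquareClass

end

/-! ### The Segal conditions for grids of distinguished squares -/

noncomputable section

lemma IsEqToHom.eq_id {C : Type*} [Category* C] {x : C} {φ : x ⟶ x} (h : IsEqToHom φ) :
    φ = 𝟙 x := h.unique ⟨rfl, rfl⟩

namespace SquareClass

variable {D : Type u} [Category.{v} D] {T : SquareClass D}

namespace Diagram

variable {q r : SimplexCategory}

/-- A column of a grid. -/
def col (F : T.Diagram q r) (j : Fin (r.len + 1)) : Fin (q.len + 1) ⥤ D :=
  Prod.sectL _ j ⋙ F.diagram

/-- The horizontal maps of a grid of length one, as a map of columns. -/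
def edge (F : T.Diagram q ⦋1⦌) : F.col 0 ⟶ F.col 1 where
  app i := F.diagram.map (X := (i, 0)) (Y := (i, 1)) (𝟙 i, homOfLE (Fin.zero_le _))
  naturality _ _ f := (map_prod_comm F.diagram f.le (Fin.zero_le 1)).symm

end Diagram

section Segal

variable {q : SimplexCategory} {n : ℕ}

/-- The simplicial groupoid of grids with `q` fixed. -/
abbrev nerveRow (T : SquareClass D) (q : ℕ) : SimplexCategoryᵒᵖ ⥤ Grpd.{v, max u v} :=
  (Prod.sectR ⦋q⦌ SimplexCategory).op ⋙ T.nerve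

/-- Chains of composable grids of length one. -/
abbrev Chains (T : SquareClass D) (q n : ℕ) :=
  IteratedTwoPullback (E := T.Diagram ⦋q⦌ ⦋1⦌) (O := T.Diagram ⦋q⦌ ⦋0⦌)
    ((T.nerveRow q).map (srcVertex 1).op) ((T.nerveRow q).map (tgtVertex 1).op) n

variable {q m : ℕ}

/-- Every column lies on the spine: column 0 is the source of edge 0, and column `k + 1` is the
target of edge `k`. Edge 0 exists because the length is `m + 1`. -/
instance : ((segalMap (T.nerveRow q) (m + 1))).Faithful where
  map_injective {F G φ ψ} h := by
    have key (k : Fin (m + 1)) (i : Fin (q + 1)) (j : Fin 2) :=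
      congrArg (fun τ => Diagram.comp (T := T) (q := ⦋q⦌) (r := ⦋1⦌)
        (IteratedTwoPullback.Hom.app τ k) i j) h
    refine Diagram.hom_ext fun i j => ?_
    induction j using Fin.cases with
    | zero => exact key 0 i 0
    | succ k => exact key k i 1

/-- The components of a morphism of grids assembled from its restrictions to the spine. -/
def assembleIso (F G : T.Diagram ⦋q⦌ ⦋m + 1⦌)
    (φ : (segalMap (T.nerveRow q) (m + 1)).obj F ⟶ (segalMap (T.nerveRow q) (m + 1)).obj G)
    (i : Fin (q + 1)) (j : Fin (m + 2)) : F.diagram.obj (i, j) ≅ G.diagram.obj (i, j) :=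
  Fin.cases (motive := fun j => F.diagram.obj (i, j) ≅ G.diagram.obj (i, j))
    (Iso.app (C := Fin (q + 1) × Fin 2) (φ.app 0) (i, 0))
    (fun k => Iso.app (C := Fin (q + 1) × Fin 2) (φ.app k) (i, 1)) j

/-- An interior column carries two candidate components, one as the target of an edge and one as the
source of the next; `assembleIso` uses the former. They agree because the gluing isomorphisms of
chains in the image of the Segal map have identity components. -/
lemma assembleIso_castSucc (F G : T.Diagram ⦋q⦌ ⦋m + 1⦌)
    (φ : (segalMap (T.nerveRow q) (m + 1)).obj F ⟶ (segalMap (T.nerveRow q) (m + 1)).obj G)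
    (i : Fin (q + 1)) (k : Fin (m + 1)) : (assembleIso F G φ i k.castSucc).hom =
      Diagram.comp (T := T) (q := ⦋q⦌) (r := ⦋1⦌) (φ.app k) i 0 := by
  induction k using Fin.cases with
  | zero => rfl
  | succ l =>
    have h := congrArg (fun τ => Diagram.comp (T := T) (q := ⦋q⦌) (r := ⦋0⦌) τ i 0)
      (φ.comm l (by lia))
    have e := segal_aux (T.nerveRow q) (m + 1) l (by lia)
    have hF : IsEqToHom (C := D) (x := F.diagram.obj (i, l.succ.castSucc))
      (y := F.diagram.obj (i, l.succ.castSucc)) _ :=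
      Diagram.isEqToHom_comp (T := T) (q := ⦋q⦌) (r := ⦋0⦌)
        (IsEqToHom.eqToHom (Functor.congr_obj e F)) i 0
    have hG : IsEqToHom (C := D) (x := G.diagram.obj (i, l.succ.castSucc))
      (y := G.diagram.obj (i, l.succ.castSucc)) _ :=
      Diagram.isEqToHom_comp (T := T) (q := ⦋q⦌) (r := ⦋0⦌)
        (IsEqToHom.eqToHom (Functor.congr_obj e G)) i 0
    exact (Category.comp_id _).symm.trans ((congrArg (_ ≫ ·) hG.eq_id.symm).trans (h.trans
      ((congrArg (· ≫ _) hF.eq_id).trans (Category.id_comp _))))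

instance : (segalMap (T.nerveRow q) (m + 1)).Full where
  map_surjective {F G} φ := by
    refine ⟨gridIso (F := Diagram.diagram F) (G := Diagram.diagram G)
      (fun x => assembleIso F G φ x.1 x.2) ?_ ?_, ?_⟩
    · intro i k h j
      induction j using Fin.cases with
      | zero =>
        exact NatTrans.naturality (C := Fin (q + 1) × Fin 2) (φ.app 0).hom
          (X := (i, 0)) (Y := (k, 0)) (homOfLE h, 𝟙 _)
      | succ l =>
        exact NatTrans.naturality (C := Fin (q + 1) × Fin 2) (φ.app l).hom
          (X := (i, 1)) (Y := (k, 1)) (homOfLE h, 𝟙 _)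
    · intro i k
      exact (NatTrans.naturality (C := Fin (q + 1) × Fin 2) (φ.app k).hom
        (X := (i, 0)) (Y := (i, 1)) (𝟙 i, homOfLE (Fin.zero_le _))).trans
        (congrArg (· ≫ _) (assembleIso_castSucc F G φ i k).symm)
    · refine IteratedTwoPullback.Hom.ext (funext fun k =>
        Diagram.hom_ext (T := T) (q := ⦋q⦌) (r := ⦋1⦌) fun i j => ?_)
      induction j using Fin.cases with
      | zero => exact assembleIso_castSucc F G φ i k
      | succ l =>
        obtain rfl : l = 0 := Subsingleton.elim _ _
        rfl

section EssSurj

variable (x : T.Chains q (m + 1))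

/-- The columns of the grid assembled from a chain. -/
def assembleCol (j : Fin (m + 2)) : Fin (q + 1) ⥤ D :=
  Fin.cases (motive := fun _ => Fin (q + 1) ⥤ D) ((x.obj 0).col 0) (fun k => (x.obj k).col 1) j

/-- The columns of the assembled grid are isomorphic to the source columns of the chain. -/
def assembleColIso (k : Fin (m + 1)) : assembleCol x k.castSucc ≅ (x.obj k).col 0 :=
  Fin.cases (motive := fun k => assembleCol x k.castSucc ≅ (x.obj k).col 0) (Iso.refl _)
    (fun l => Functor.isoWhiskerLeft (Prod.sectL (Fin (q + 1)) (0 : Fin 1))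
      (x.iso l (by lia)).hom) k

/-- The horizontal steps of the grid assembled from a chain. -/
def assembleStep (k : Fin (m + 1)) : assembleCol x k.castSucc ⟶ assembleCol x k.succ :=
  (assembleColIso x k).hom ≫ (x.obj k).edge

/-- The grid assembled from a chain. -/
def assemble : T.Diagram ⦋q⦌ ⦋m + 1⦌ :=
  Diagram.ofChain (assembleCol x) (assembleStep x)
    (fun j i k h => by
      induction j using Fin.cases with
      | zero => exact (x.obj 0).vertical h 0
      | succ l => exact (x.obj l).vertical h 1)
    (fun k i => T.horizontal_comp (T.horizontal_of_isIso ((assembleColIso x k).hom.app i))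
      ((x.obj k).horizontal i (Fin.zero_le _)))
    -- The correction of the source column is an isomorphism, so its naturality square is
    -- distinguished and can be pasted in front of the square of edge `l`.
    (fun l i k h => T.square_paste_horizontal
      (T.square_of_horizontal_isIso ((assembleColIso x l).hom.naturality (homOfLE h)).symm)
      ((x.obj l).square h (Fin.zero_le _)))

/-- The restrictions of the assembled grid to the spine. -/
def assembleSpineIso (k : Fin (m + 1)) :
    ((T.nerveRow q).map (SimplexCategory.mkOfSucc k).op).obj (assemble x) ⟶ x.obj k :=
  gridIso (q := q) (n := 1) (F := Diagram.diagram (T := T)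
      (((T.nerveRow q).map (SimplexCategory.mkOfSucc k).op).obj (assemble x)))
    (G := (x.obj k).diagram)
    (fun y => Fin.cases (motive := fun j => (Diagram.diagram (T := T)
      (((T.nerveRow q).map (SimplexCategory.mkOfSucc k).op).obj (assemble x))).obj (y.1, j) ≅
        (x.obj k).diagram.obj (y.1, j)) ((assembleColIso x k).app y.1)
      (fun l => Fin.cases (motive := fun l => (Diagram.diagram (T := T)
        (((T.nerveRow q).map (SimplexCategory.mkOfSucc k).op).obj (assemble x))).obj
          (y.1, Fin.succ l) ≅ (x.obj k).diagram.obj (y.1, Fin.succ l))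
        (Iso.refl _) (fun l => l.elim0) l) y.2)
    (by
      intro i i' h j
      induction j using Fin.cases with
      | zero =>
        exact (congrArg (· ≫ _) (chainDiagram_map_vertical (assembleCol x) (assembleStep x) h
          k.castSucc)).trans ((assembleColIso x k).hom.naturality (homOfLE h))
      | succ l =>
        obtain rfl : l = 0 := Subsingleton.elim _ _
        exact (congrArg (· ≫ _) (chainDiagram_map_vertical (assembleCol x) (assembleStep x) h
          k.succ)).trans ((Category.comp_id _).trans (Category.id_comp _).symm))
    (by
      intro i l
      obtain rfl : l = 0 := Subsingleton.elim _ _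
      exact (congrArg (· ≫ _) (chainDiagram_map_step (assembleCol x) (assembleStep x) i k)).trans
        (Category.comp_id _))

/-- The assembled grid maps to the given chain. -/
def assembleSegalIso : (segalMap (T.nerveRow q) (m + 1)).obj (assemble x) ⟶ x :=
  ⟨assembleSpineIso x, fun l h => by
    refine Diagram.hom_ext (T := T) (q := ⦋q⦌) (r := ⦋0⦌) fun i j => ?_
    obtain rfl : j = 0 := Subsingleton.elim (α := Fin 1) _ _
    have e := segal_aux (T.nerveRow q) (m + 1) l h
    have hF : IsEqToHom (C := D) (x := (assemble x).diagram.obj (i, ⟨l + 1, by lia⟩))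
      (y := (assemble x).diagram.obj (i, ⟨l + 1, by lia⟩)) _ :=
      Diagram.isEqToHom_comp (T := T) (q := ⦋q⦌) (r := ⦋0⦌)
        (IsEqToHom.eqToHom (Functor.congr_obj e (assemble x))) i 0
    -- Both sides reduce to the component of `x.iso l`: the spine isomorphisms are identities on
    -- target columns, and on the source column of edge `l + 1` the correction is this gluing
    -- isomorphism.
    exact (Category.id_comp _).trans
      ((Category.id_comp _).symm.trans (congrArg (· ≫ _) hF.eq_id.symm))⟩

instance : (segalMap (T.nerveRow q) (m + 1)).EssSurj where
  mem_essImage x := ⟨assemble x, ⟨IteratedTwoPullback.isoOfHom _ (assembleSegalIso x)⟩⟩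

end EssSurj

variable (T) in
lemma isSegal_nerveRow (q : ℕ) : IsSegal (T.nerveRow q) := by
  rintro (_ | m) hn
  · lia
  · exact { }

/-- The simplicial groupoid of grids with `r` fixed. -/
abbrev nerveCol (T : SquareClass D) (r : ℕ) : SimplexCategoryᵒᵖ ⥤ Grpd.{v, max u v} :=
  (Prod.sectL SimplexCategory ⦋r⦌).op ⋙ T.nerve

/-- Transposition of grids. -/
def transposeDiagram (T : SquareClass D) (q r : SimplexCategory) :
    T.Diagram q r ⥤ T.transpose.Diagram r q where
  obj F :=
    { diagram := CategoryTheory.Prod.swap _ _ ⋙ F.diagram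
      horizontal := fun i _ _ h => F.vertical h i
      vertical := fun h j => F.horizontal j h
      square := fun h _ _ h' => F.square h' h }
  map φ := Functor.isoWhiskerLeft (CategoryTheory.Prod.swap _ _) φ
  map_id _ := rfl
  map_comp _ _ := rfl

/-- Transposing twice is the identity on the nose, hence the reflexive unit and counit. -/
instance (q r : SimplexCategory) : (transposeDiagram T q r).IsEquivalence :=
  Functor.IsEquivalence.mk' (transposeDiagram T.transpose r q)
    (eqToIso rfl) (eqToIso rfl)

variable (T) in
-- The axioms of `SquareClass` are symmetric in the two directions, so this is the row statement for
-- `T.transpose`.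
lemma isSegal_nerveCol (r : ℕ) : IsSegal (T.nerveCol r) :=
  IsSegal.of_levelwise_equivalence (X' := T.transpose.nerveRow r)
    { app := fun n => T.transposeDiagram n.unop ⦋r⦌
      naturality := fun _ _ _ => rfl }
    (fun n => (inferInstance : (T.transposeDiagram ⦋n⦌ ⦋r⦌).IsEquivalence))
    (T.transpose.isSegal_nerveRow r)

end Segal

end SquareClass

end

/-! ### Stability: squares determined by spans and by cospans -/

noncomputable section

lemma CategoryTheory.IsPushout.exists_iso {D : Type*} [Category* D] {a b c d a' b' c' d' : D}
    {i : a ⟶ b}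
    {p : a ⟶ c} {q : b ⟶ d} {j : c ⟶ d} {i' : a' ⟶ b'} {p' : a' ⟶ c'} {q' : b' ⟶ d'}
    {j' : c' ⟶ d'} (s : IsPushout i p q j) (s' : IsPushout i' p' q' j') (ea : a ≅ a')
    (eb : b ≅ b') (ec : c ≅ c') (hi : i ≫ eb.hom = ea.hom ≫ i') (hp : p ≫ ec.hom = ea.hom ≫ p') :
    ∃ ed : d ≅ d', q ≫ ed.hom = eb.hom ≫ q' ∧ j ≫ ed.hom = ec.hom ≫ j' := by
  have hi' : i' ≫ eb.inv = ea.inv ≫ i := by rw [Iso.comp_inv_eq, Category.assoc, hi]; simp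
  have hp' : p' ≫ ec.inv = ea.inv ≫ p := by rw [Iso.comp_inv_eq, Category.assoc, hp]; simp
  refine ⟨⟨s.desc (eb.hom ≫ q') (ec.hom ≫ j') ?_, s'.desc (eb.inv ≫ q) (ec.inv ≫ j) ?_,
    s.hom_ext ?_ ?_, s'.hom_ext ?_ ?_⟩, s.inl_desc _ _ _, s.inr_desc _ _ _⟩
  · rw [reassoc_of% hi, reassoc_of% hp, s'.w]
  · rw [reassoc_of% hi', reassoc_of% hp', s.w]
  all_goals simp

lemma CategoryTheory.IsPullback.exists_iso {D : Type*} [Category* D] {a b c d a' b' c' d' : D}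
    {i : a ⟶ b}
    {p : a ⟶ c} {q : b ⟶ d} {j : c ⟶ d} {i' : a' ⟶ b'} {p' : a' ⟶ c'} {q' : b' ⟶ d'}
    {j' : c' ⟶ d'} (s : IsPullback i p q j) (s' : IsPullback i' p' q' j') (eb : b ≅ b')
    (ec : c ≅ c') (ed : d ≅ d') (hq : q ≫ ed.hom = eb.hom ≫ q') (hj : j ≫ ed.hom = ec.hom ≫ j') :
    ∃ ea : a ≅ a', i ≫ eb.hom = ea.hom ≫ i' ∧ p ≫ ec.hom = ea.hom ≫ p' := by
  have hq' : q' ≫ ed.inv = eb.inv ≫ q := by rw [Iso.comp_inv_eq, Category.assoc, hq]; simp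
  have hj' : j' ≫ ed.inv = ec.inv ≫ j := by rw [Iso.comp_inv_eq, Category.assoc, hj]; simp
  refine ⟨⟨s'.lift (i ≫ eb.hom) (p ≫ ec.hom) ?_, s.lift (i' ≫ eb.inv) (p' ≫ ec.inv) ?_,
    s.hom_ext ?_ ?_, s'.hom_ext ?_ ?_⟩, (s'.lift_fst _ _ _).symm, (s'.lift_snd _ _ _).symm⟩
  · rw [Category.assoc, Category.assoc, ← hq, ← hj, s.w_assoc]
  · rw [Category.assoc, Category.assoc, ← hq', ← hj', s'.w_assoc]
  all_goals simp

namespace SquareClass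

variable {D : Type u} [Category.{v} D] {T : SquareClass D}

/-- Distinguished squares are bicartesian and can be filled in from spans and from cospans. -/
structure IsStable (T : SquareClass D) : Prop where
  isPushout : ∀ {a b c d : D} {i : a ⟶ b} {p : a ⟶ c} {q : b ⟶ d} {j : c ⟶ d}, T.horizontal i →
    T.vertical p → T.vertical q → T.horizontal j → T.square i p q j → IsPushout i p q j
  isPullback : ∀ {a b c d : D} {i : a ⟶ b} {p : a ⟶ c} {q : b ⟶ d} {j : c ⟶ d}, T.horizontal i →
    T.vertical p → T.vertical q → T.horizontal j → T.square i p q j → IsPullback i p q j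
  span : ∀ {a b c : D} (i : a ⟶ b) (p : a ⟶ c), T.horizontal i → T.vertical p →
    ∃ (d : D) (q : b ⟶ d) (j : c ⟶ d), i ≫ q = p ≫ j ∧ T.vertical q ∧ T.horizontal j ∧
      T.square i p q j
  cospan : ∀ {b c d : D} (q : b ⟶ d) (j : c ⟶ d), T.vertical q → T.horizontal j →
    ∃ (a : D) (i : a ⟶ b) (p : a ⟶ c), i ≫ q = p ≫ j ∧ T.horizontal i ∧ T.vertical p ∧
      T.square i p q j

/-- An isomorphism of grid-shaped diagrams, natural for vertical and horizontal steps. -/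
def gridIsoOfSteps {m n : ℕ} {F G : Fin (m + 1) × Fin (n + 1) ⥤ D}
    (e : ∀ x, F.obj x ≅ G.obj x)
    (hv : ∀ (k : Fin m) (j : Fin (n + 1)),
      F.map (X := (k.castSucc, j)) (Y := (k.succ, j)) (homOfLE (Fin.castSucc_le_succ k), 𝟙 j) ≫
        (e (k.succ, j)).hom = (e (k.castSucc, j)).hom ≫
          G.map (X := (k.castSucc, j)) (Y := (k.succ, j))
            (homOfLE (Fin.castSucc_le_succ k), 𝟙 j))
    (hh : ∀ (i : Fin (m + 1)) (k : Fin n),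
      F.map (X := (i, k.castSucc)) (Y := (i, k.succ)) (𝟙 i, homOfLE (Fin.castSucc_le_succ k)) ≫
        (e (i, k.succ)).hom = (e (i, k.castSucc)).hom ≫
          G.map (X := (i, k.castSucc)) (Y := (i, k.succ))
            (𝟙 i, homOfLE (Fin.castSucc_le_succ k))) : F ≅ G :=
  gridIso e (fun {i k} h j => by
    refine Fin.le_induction_of_steps (P := fun i k h =>
      F.map (X := (i, j)) (Y := (k, j)) (homOfLE h, 𝟙 j) ≫ (e (k, j)).hom =
        (e (i, j)).hom ≫ G.map (X := (i, j)) (Y := (k, j)) (homOfLE h, 𝟙 j)) ?_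
      (fun k => hv k j) ?_ i k h
    · intro i
      rw [map_prod_homOfLE_refl_fst, map_prod_homOfLE_refl_fst, Category.id_comp,
        Category.comp_id]
    · intro i k l h h' h₁ h₂
      rw [map_prod_homOfLE_trans_fst F h h' j, map_prod_homOfLE_trans_fst G h h' j,
        Category.assoc, h₂, reassoc_of% h₁]) hh

section Square

variable {a b c d : D} {i : a ⟶ b} {p : a ⟶ c} {q : b ⟶ d} {j : c ⟶ d} (w : i ≫ q = p ≫ j)
  (hi : T.horizontal i) (hp : T.vertical p) (hq : T.vertical q) (hj : T.horizontal j)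
  (hs : T.square i p q j)

/-- The columns of a square. -/
def squareCol (p : a ⟶ c) (q : b ⟶ d) (j : Fin 2) : Fin 2 ⥤ D :=
  Fin.cases (motive := fun _ => Fin 2 ⥤ D) (ComposableArrows.mk₁ p)
    (fun _ => ComposableArrows.mk₁ q) j

/-- The horizontal step of a square. -/
def squareStep (k : Fin 1) : squareCol p q k.castSucc ⟶ squareCol p q k.succ :=
  match k with
  | 0 => ComposableArrows.homMk₁ (F := ComposableArrows.mk₁ p) (G := ComposableArrows.mk₁ q) i j
      w.symm

lemma vertical_mk₁ (hp : T.vertical p) {k l : Fin 2} (h : k ≤ l) :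
    T.vertical ((ComposableArrows.mk₁ p).map (homOfLE h)) := by
  refine Fin.le_induction_of_steps (n := 1) (P := fun k l h =>
    T.vertical ((ComposableArrows.mk₁ p).map (homOfLE h))) (fun k => ?_) (fun k => ?_) ?_ k l h
  · exact ((ComposableArrows.mk₁ p).map_id k) ▸ T.vertical_of_isIso (𝟙 _)
  · obtain rfl : k = 0 := Subsingleton.elim _ _
    exact hp
  · intro k l m h h' h₁ h₂
    rw [← homOfLE_comp h h', Functor.map_comp]
    exact T.vertical_comp h₁ h₂

/-- The grid consisting of a single distinguished square. -/
def Diagram.ofSquare : T.Diagram ⦋1⦌ ⦋1⦌ :=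
  Diagram.ofChain (q := 1) (n := 1) (squareCol p q) (squareStep w)
    (fun k => by
      induction k using Fin.cases with
      | zero => exact vertical_mk₁ hp
      | succ l => exact vertical_mk₁ hq)
    (fun k l => by
      obtain rfl : k = 0 := Subsingleton.elim _ _
      induction l using Fin.cases with
      | zero => exact hi
      | succ l =>
        obtain rfl : l = 0 := Subsingleton.elim _ _
        exact hj)
    (fun k l m h => by
      obtain rfl : k = 0 := Subsingleton.elim _ _
      refine Fin.le_induction_of_steps (n := 1) (P := fun l m h => T.square
        ((squareStep w 0).app l) ((squareCol p q 0).map (homOfLE h))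
        ((squareCol p q 1).map (homOfLE h)) ((squareStep w 0).app m)) (fun l => ?_)
        (fun l => ?_) ?_ l m h
      · have h₁ := (squareCol p q 0).map_id l
        have h₂ := (squareCol p q 1).map_id l
        have : IsIso ((squareCol p q 0).map (homOfLE (le_refl l))) := by
          exact h₁ ▸ (inferInstance : IsIso (𝟙 _))
        have : IsIso ((squareCol p q 1).map (homOfLE (le_refl l))) := by
          exact h₂ ▸ (inferInstance : IsIso (𝟙 _))
        exact T.square_of_vertical_isIso ((squareStep w 0).naturality _).symm
      · obtain rfl : l = 0 := Subsingleton.elim _ _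
        exact hs
      · intro k l m h h' h₁ h₂
        rw [← homOfLE_comp h h', Functor.map_comp, Functor.map_comp]
        exact T.square_paste_vertical h₁ h₂)

lemma Diagram.ofSquare_map_top : (Diagram.ofSquare w hi hp hq hj hs).diagram.map
    (X := ((0 : Fin 2), (0 : Fin 2))) (Y := ((0 : Fin 2), (1 : Fin 2)))
    (𝟙 _, homOfLE (Fin.zero_le 1)) = i :=
  chainDiagram_map_step (q := 1) (n := 1) (squareCol p q) (squareStep w) 0 0

lemma Diagram.ofSquare_map_bot : (Diagram.ofSquare w hi hp hq hj hs).diagram.map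
    (X := ((1 : Fin 2), (0 : Fin 2))) (Y := ((1 : Fin 2), (1 : Fin 2)))
    (𝟙 _, homOfLE (Fin.zero_le 1)) = j :=
  chainDiagram_map_step (q := 1) (n := 1) (squareCol p q) (squareStep w) 1 0

lemma Diagram.ofSquare_map_left : (Diagram.ofSquare w hi hp hq hj hs).diagram.map
    (X := ((0 : Fin 2), (0 : Fin 2))) (Y := ((1 : Fin 2), (0 : Fin 2)))
    (homOfLE (Fin.zero_le 1), 𝟙 _) = p :=
  chainDiagram_map_vertical (q := 1) (n := 1) (squareCol p q) (squareStep w) (Fin.zero_le 1) 0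

lemma Diagram.ofSquare_map_right : (Diagram.ofSquare w hi hp hq hj hs).diagram.map
    (X := ((0 : Fin 2), (1 : Fin 2))) (Y := ((1 : Fin 2), (1 : Fin 2)))
    (homOfLE (Fin.zero_le 1), 𝟙 _) = q :=
  chainDiagram_map_vertical (q := 1) (n := 1) (squareCol p q) (squareStep w) (Fin.zero_le 1) 1

end Square

section Stable

/-- Restriction of grids along a pair of maps. -/
abbrev restrict (T : SquareClass D) {k l k' l' : ℕ} (a : ⦋k'⦌ ⟶ ⦋k⦌) (b : ⦋l'⦌ ⟶ ⦋l⦌) :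
    Grpd.of (T.Diagram ⦋k⦌ ⦋l⦌) ⟶ Grpd.of (T.Diagram ⦋k'⦌ ⦋l'⦌) :=
  T.reindex (x := (⦋k'⦌, ⦋l'⦌)) (y := (⦋k⦌, ⦋l⦌)) (a, b)

lemma restrict_square {k l : ℕ} (a : ⦋0⦌ ⟶ ⦋k⦌) (b : ⦋0⦌ ⟶ ⦋l⦌) :
    T.restrict a (𝟙 ⦋l⦌) ≫ T.restrict (𝟙 ⦋0⦌) b =
      T.restrict (𝟙 ⦋k⦌) b ≫ T.restrict a (𝟙 ⦋0⦌) := rfl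

/-- The restriction of a `(1 × 1)`-grid to its span of sources. -/
abbrev toSpan (T : SquareClass D) :=
  toTwoPullback (T.restrict (srcVertex 1) (𝟙 ⦋1⦌)) (T.restrict (𝟙 ⦋1⦌) (srcVertex 1))
    (T.restrict (𝟙 ⦋0⦌) (srcVertex 1)) (T.restrict (srcVertex 1) (𝟙 ⦋0⦌))
    (restrict_square (srcVertex 1) (srcVertex 1))

/-- The restriction of a `(1 × 1)`-grid to its cospan of targets. -/
abbrev toCospan (T : SquareClass D) :=
  toTwoPullback (T.restrict (𝟙 ⦋1⦌) (tgtVertex 1)) (T.restrict (tgtVertex 1) (𝟙 ⦋1⦌))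
    (T.restrict (tgtVertex 1) (𝟙 ⦋0⦌)) (T.restrict (𝟙 ⦋0⦌) (tgtVertex 1))
    (restrict_square (tgtVertex 1) (tgtVertex 1)).symm

/-- The component of a morphism of grids, as an isomorphism. -/
def Diagram.compIso {q r : SimplexCategory} {F G : T.Diagram q r} (φ : F ⟶ G)
    (i : Fin (q.len + 1)) (j : Fin (r.len + 1)) : F.diagram.obj (i, j) ≅ G.diagram.obj (i, j) :=
  Iso.app (C := Fin (q.len + 1) × Fin (r.len + 1)) φ (i, j)

lemma Diagram.comp_natural_fst {q r : SimplexCategory} {F G : T.Diagram q r} (φ : F ⟶ G)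
    {i k : Fin (q.len + 1)} (h : i ≤ k) (j : Fin (r.len + 1)) :
    F.diagram.map (X := (i, j)) (Y := (k, j)) (homOfLE h, 𝟙 j) ≫ comp φ k j =
      comp φ i j ≫ G.diagram.map (X := (i, j)) (Y := (k, j)) (homOfLE h, 𝟙 j) :=
  NatTrans.naturality (C := Fin (q.len + 1) × Fin (r.len + 1))
    (Iso.hom (C := Fin (q.len + 1) × Fin (r.len + 1) ⥤ D) φ) _

lemma Diagram.comp_natural_snd {q r : SimplexCategory} {F G : T.Diagram q r} (φ : F ⟶ G)
    (i : Fin (q.len + 1)) {j l : Fin (r.len + 1)} (h : j ≤ l) :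
    F.diagram.map (X := (i, j)) (Y := (i, l)) (𝟙 i, homOfLE h) ≫ comp φ i l =
      comp φ i j ≫ G.diagram.map (X := (i, j)) (Y := (i, l)) (𝟙 i, homOfLE h) :=
  NatTrans.naturality (C := Fin (q.len + 1) × Fin (r.len + 1))
    (Iso.hom (C := Fin (q.len + 1) × Fin (r.len + 1) ⥤ D) φ) _

lemma IsStable.diagram_isPushout (hT : T.IsStable) {q r : SimplexCategory} (F : T.Diagram q r)
    {i k : Fin (q.len + 1)} (h : i ≤ k) {j l : Fin (r.len + 1)} (h' : j ≤ l) :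
    IsPushout (F.diagram.map (X := (i, j)) (Y := (i, l)) (𝟙 i, homOfLE h'))
      (F.diagram.map (X := (i, j)) (Y := (k, j)) (homOfLE h, 𝟙 j))
      (F.diagram.map (X := (i, l)) (Y := (k, l)) (homOfLE h, 𝟙 l))
      (F.diagram.map (X := (k, j)) (Y := (k, l)) (𝟙 k, homOfLE h')) :=
  hT.isPushout (F.horizontal _ _) (F.vertical _ _) (F.vertical _ _) (F.horizontal _ _)
    (F.square _ _)

lemma IsStable.diagram_isPullback (hT : T.IsStable) {q r : SimplexCategory} (F : T.Diagram q r)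
    {i k : Fin (q.len + 1)} (h : i ≤ k) {j l : Fin (r.len + 1)} (h' : j ≤ l) :
    IsPullback (F.diagram.map (X := (i, j)) (Y := (i, l)) (𝟙 i, homOfLE h'))
      (F.diagram.map (X := (i, j)) (Y := (k, j)) (homOfLE h, 𝟙 j))
      (F.diagram.map (X := (i, l)) (Y := (k, l)) (homOfLE h, 𝟙 l))
      (F.diagram.map (X := (k, j)) (Y := (k, l)) (𝟙 k, homOfLE h')) :=
  hT.isPullback (F.horizontal _ _) (F.vertical _ _) (F.vertical _ _) (F.horizontal _ _)
    (F.square _ _)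

/-- An isomorphism of squares. -/
def squareIso {F G : Fin 2 × Fin 2 ⥤ D} (e₀₀ : F.obj (0, 0) ≅ G.obj (0, 0))
    (e₀₁ : F.obj (0, 1) ≅ G.obj (0, 1)) (e₁₀ : F.obj (1, 0) ≅ G.obj (1, 0))
    (e₁₁ : F.obj (1, 1) ≅ G.obj (1, 1))
    (ht : F.map (X := (0, 0)) (Y := (0, 1)) (𝟙 _, homOfLE (Fin.zero_le 1)) ≫ e₀₁.hom =
      e₀₀.hom ≫ G.map (X := (0, 0)) (Y := (0, 1)) (𝟙 _, homOfLE (Fin.zero_le 1)))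
    (hl : F.map (X := (0, 0)) (Y := (1, 0)) (homOfLE (Fin.zero_le 1), 𝟙 _) ≫ e₁₀.hom =
      e₀₀.hom ≫ G.map (X := (0, 0)) (Y := (1, 0)) (homOfLE (Fin.zero_le 1), 𝟙 _))
    (hr : F.map (X := (0, 1)) (Y := (1, 1)) (homOfLE (Fin.zero_le 1), 𝟙 _) ≫ e₁₁.hom =
      e₀₁.hom ≫ G.map (X := (0, 1)) (Y := (1, 1)) (homOfLE (Fin.zero_le 1), 𝟙 _))
    (hb : F.map (X := (1, 0)) (Y := (1, 1)) (𝟙 _, homOfLE (Fin.zero_le 1)) ≫ e₁₁.hom =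
      e₁₀.hom ≫ G.map (X := (1, 0)) (Y := (1, 1)) (𝟙 _, homOfLE (Fin.zero_le 1))) : F ≅ G :=
  gridIsoOfSteps (m := 1) (n := 1)
    (fun x => match x with
      | (0, 0) => e₀₀
      | (0, 1) => e₀₁
      | (1, 0) => e₁₀
      | (1, 1) => e₁₁)
    (fun k j => match k, j with
      | 0, 0 => hl
      | 0, 1 => hr)
    (fun i k => match i, k with
      | 0, 0 => ht
      | 1, 0 => hb)

/-- A distinguished square is a pushout, so a map of squares is determined at the last corner by the
rest, and an isomorphism of spans extends to that corner. Essential surjectivity is the filling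
axiom for spans. -/
lemma toSpan_isEquivalence (hT : T.IsStable) : T.toSpan.IsEquivalence where
  faithful := ⟨fun {F G φ ψ} h => by
    have h₁ (j : Fin 2) : Diagram.comp (T := T) (q := ⦋1⦌) (r := ⦋1⦌) φ 0 j =
        Diagram.comp (T := T) (q := ⦋1⦌) (r := ⦋1⦌) ψ 0 j :=
      congrArg (fun τ => Diagram.comp (T := T) (q := ⦋0⦌) (r := ⦋1⦌)
        (CategoricalPullback.Hom.fst τ) 0 j) h
    have h₂ (i : Fin 2) : Diagram.comp (T := T) (q := ⦋1⦌) (r := ⦋1⦌) φ i 0 =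
        Diagram.comp (T := T) (q := ⦋1⦌) (r := ⦋1⦌) ψ i 0 :=
      congrArg (fun τ => Diagram.comp (T := T) (q := ⦋1⦌) (r := ⦋0⦌)
        (CategoricalPullback.Hom.snd τ) i 0) h
    refine Diagram.hom_ext fun i j => ?_
    match i, j with
    | 0, j => exact h₁ j
    | 1, 0 => exact h₂ 1
    | 1, 1 =>
      refine (hT.diagram_isPushout F (Fin.zero_le (1 : Fin 2)) (Fin.zero_le (1 : Fin 2))).hom_ext
        ?_ ?_
      · exact (Diagram.comp_natural_fst φ (Fin.zero_le (1 : Fin 2)) 1).trans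
          ((congrArg (· ≫ _) (h₁ 1)).trans
            (Diagram.comp_natural_fst ψ (Fin.zero_le (1 : Fin 2)) 1).symm)
      · exact (Diagram.comp_natural_snd φ 1 (Fin.zero_le (1 : Fin 2))).trans
          ((congrArg (· ≫ _) (h₂ 1)).trans
            (Diagram.comp_natural_snd ψ 1 (Fin.zero_le (1 : Fin 2))).symm)⟩
  full := ⟨fun {F G} φ => by
    have hF : IsEqToHom (C := D) (x := F.diagram.obj (0, 0)) (y := F.diagram.obj (0, 0)) _ :=
      Diagram.isEqToHom_comp (T := T) (q := ⦋0⦌) (r := ⦋0⦌)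
        (IsEqToHom.hom_app (restrict_square (T := T) (srcVertex 1) (srcVertex 1)) F) 0 0
    have hG : IsEqToHom (C := D) (x := G.diagram.obj (0, 0)) (y := G.diagram.obj (0, 0)) _ :=
      Diagram.isEqToHom_comp (T := T) (q := ⦋0⦌) (r := ⦋0⦌)
        (IsEqToHom.hom_app (restrict_square (T := T) (srcVertex 1) (srcVertex 1)) G) 0 0
    -- The square of restrictions commutes strictly, so the isomorphisms chosen in the 2-pullback
    -- have identity components here, and compatibility says that the two maps agree at the common
    -- corner.
    have hw : Diagram.comp (T := T) (q := ⦋0⦌) (r := ⦋1⦌) φ.fst 0 0 =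
        Diagram.comp (T := T) (q := ⦋1⦌) (r := ⦋0⦌) φ.snd 0 0 :=
      (Category.comp_id _).symm.trans ((congrArg (_ ≫ ·) hG.eq_id.symm).trans
        ((congrArg (fun τ => Diagram.comp (T := T) (q := ⦋0⦌) (r := ⦋0⦌) τ 0 0) φ.w).trans
          ((congrArg (· ≫ _) hF.eq_id).trans (Category.id_comp _))))
    have ht := Diagram.comp_natural_snd (T := T) (q := ⦋0⦌) (r := ⦋1⦌) φ.fst 0
      (Fin.zero_le (1 : Fin 2))
    have hl := (Diagram.comp_natural_fst (T := T) (q := ⦋1⦌) (r := ⦋0⦌) φ.snd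
      (Fin.zero_le (1 : Fin 2)) 0).trans (congrArg (· ≫ _) hw.symm)
    let e₀₀ := Diagram.compIso (T := T) (q := ⦋0⦌) (r := ⦋1⦌) φ.fst 0 0
    let e₀₁ := Diagram.compIso (T := T) (q := ⦋0⦌) (r := ⦋1⦌) φ.fst 0 1
    let e₁₀ := Diagram.compIso (T := T) (q := ⦋1⦌) (r := ⦋0⦌) φ.snd 1 0
    obtain ⟨e, hr, hb⟩ := IsPushout.exists_iso
      (hT.diagram_isPushout F (Fin.zero_le (1 : Fin 2)) (Fin.zero_le (1 : Fin 2)))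
      (hT.diagram_isPushout G (Fin.zero_le (1 : Fin 2)) (Fin.zero_le (1 : Fin 2)))
      e₀₀ e₀₁ e₁₀ ht hl
    refine ⟨squareIso (F := Diagram.diagram F) (G := Diagram.diagram G) e₀₀ e₀₁ e₁₀ e ht hl hr hb,
      CategoricalPullback.hom_ext ?_ ?_⟩
    · refine Diagram.hom_ext (T := T) (q := ⦋0⦌) (r := ⦋1⦌) fun i j => ?_
      match i, j with
      | 0, 0 => rfl
      | 0, 1 => rfl
    · refine Diagram.hom_ext (T := T) (q := ⦋1⦌) (r := ⦋0⦌) fun i j => ?_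
      match i, j with
      | 0, 0 => exact hw
      | 1, 0 => rfl⟩
  essSurj := ⟨fun x => by
    let e : x.fst.diagram.obj (0, 0) ≅ x.snd.diagram.obj (0, 0) :=
      Diagram.compIso (T := T) (q := ⦋0⦌) (r := ⦋0⦌) x.iso.hom 0 0
    have hi := x.fst.horizontal 0 (Fin.zero_le (1 : Fin 2))
    -- In the 2-pullback the two legs start at objects that are only isomorphic. The isomorphism is
    -- absorbed into the vertical leg.
    have hp := T.vertical_comp (T.vertical_of_isIso e.hom)
      (x.snd.vertical (Fin.zero_le (1 : Fin 2)) 0)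
    obtain ⟨d, q, j, w, hq, hj, hs⟩ := hT.span _ _ hi hp
    let F := Diagram.ofSquare w hi hp hq hj hs
    have hF : IsEqToHom (C := D) (x := F.diagram.obj (0, 0)) (y := F.diagram.obj (0, 0)) _ :=
      Diagram.isEqToHom_comp (T := T) (q := ⦋0⦌) (r := ⦋0⦌)
        (IsEqToHom.hom_app (restrict_square (T := T) (srcVertex 1) (srcVertex 1)) F) 0 0
    let e₁ : (T.restrict (srcVertex 1) (𝟙 ⦋1⦌)).obj F ⟶ x.fst :=
      gridIsoOfSteps (m := 0) (n := 1)
        (fun y => match y with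
          | (0, 0) => Iso.refl _
          | (0, 1) => Iso.refl _)
        (fun k => k.elim0)
        (fun i k => match i, k with
          | 0, 0 => (congrArg (· ≫ _) (Diagram.ofSquare_map_top w hi hp hq hj hs)).trans
              ((Category.comp_id _).trans (Category.id_comp _).symm))
    let e₂ : (T.restrict (𝟙 ⦋1⦌) (srcVertex 1)).obj F ⟶ x.snd :=
      gridIsoOfSteps (m := 1) (n := 0)
        (fun y => match y with
          | (0, 0) => e
          | (1, 0) => Iso.refl _)
        (fun k j => match k, j with
          | 0, 0 => (congrArg (· ≫ _) (Diagram.ofSquare_map_left w hi hp hq hj hs)).trans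
              (Category.comp_id _))
        (fun i k => k.elim0)
    refine ⟨F, ⟨CategoricalPullback.mkIso (Groupoid.isoEquivHom _ _ |>.symm e₁)
      (Groupoid.isoEquivHom _ _ |>.symm e₂) ?_⟩⟩
    refine Diagram.hom_ext (T := T) (q := ⦋0⦌) (r := ⦋0⦌) fun i j => ?_
    match i, j with
    | 0, 0 =>
      exact (Category.id_comp _).trans
        ((Category.id_comp _).symm.trans (congrArg (· ≫ _) hF.eq_id.symm))⟩

/-- Here the missing corner is the initial one and the pullback property is used; uniqueness is
therefore tested in the target grid `G`. -/
lemma toCospan_isEquivalence (hT : T.IsStable) : T.toCospan.IsEquivalence where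
  faithful := ⟨fun {F G φ ψ} h => by
    have h₁ (i : Fin 2) : Diagram.comp (T := T) (q := ⦋1⦌) (r := ⦋1⦌) φ i 1 =
        Diagram.comp (T := T) (q := ⦋1⦌) (r := ⦋1⦌) ψ i 1 :=
      congrArg (fun τ => Diagram.comp (T := T) (q := ⦋1⦌) (r := ⦋0⦌)
        (CategoricalPullback.Hom.fst τ) i 0) h
    have h₂ (j : Fin 2) : Diagram.comp (T := T) (q := ⦋1⦌) (r := ⦋1⦌) φ 1 j =
        Diagram.comp (T := T) (q := ⦋1⦌) (r := ⦋1⦌) ψ 1 j :=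
      congrArg (fun τ => Diagram.comp (T := T) (q := ⦋0⦌) (r := ⦋1⦌)
        (CategoricalPullback.Hom.snd τ) 0 j) h
    refine Diagram.hom_ext fun i j => ?_
    match i, j with
    | 1, j => exact h₂ j
    | 0, 1 => exact h₁ 0
    | 0, 0 =>
      refine (hT.diagram_isPullback G (Fin.zero_le (1 : Fin 2)) (Fin.zero_le (1 : Fin 2))).hom_ext
        ?_ ?_
      · exact (Diagram.comp_natural_snd φ 0 (Fin.zero_le (1 : Fin 2))).symm.trans
          ((congrArg (_ ≫ ·) (h₁ 0)).trans
            (Diagram.comp_natural_snd ψ 0 (Fin.zero_le (1 : Fin 2))))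
      · exact (Diagram.comp_natural_fst φ (Fin.zero_le (1 : Fin 2)) 0).symm.trans
          ((congrArg (_ ≫ ·) (h₂ 0)).trans
            (Diagram.comp_natural_fst ψ (Fin.zero_le (1 : Fin 2)) 0))⟩
  full := ⟨fun {F G} φ => by
    have hF : IsEqToHom (C := D) (x := F.diagram.obj (1, 1)) (y := F.diagram.obj (1, 1)) _ :=
      Diagram.isEqToHom_comp (T := T) (q := ⦋0⦌) (r := ⦋0⦌)
        (IsEqToHom.hom_app (restrict_square (T := T) (tgtVertex 1) (tgtVertex 1)).symm F) 0 0
    have hG : IsEqToHom (C := D) (x := G.diagram.obj (1, 1)) (y := G.diagram.obj (1, 1)) _ :=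
      Diagram.isEqToHom_comp (T := T) (q := ⦋0⦌) (r := ⦋0⦌)
        (IsEqToHom.hom_app (restrict_square (T := T) (tgtVertex 1) (tgtVertex 1)).symm G) 0 0
    have hw : Diagram.comp (T := T) (q := ⦋1⦌) (r := ⦋0⦌) φ.fst 1 0 =
        Diagram.comp (T := T) (q := ⦋0⦌) (r := ⦋1⦌) φ.snd 0 1 :=
      (Category.comp_id _).symm.trans ((congrArg (_ ≫ ·) hG.eq_id.symm).trans
        ((congrArg (fun τ => Diagram.comp (T := T) (q := ⦋0⦌) (r := ⦋0⦌) τ 0 0) φ.w).trans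
          ((congrArg (· ≫ _) hF.eq_id).trans (Category.id_comp _))))
    have hr := Diagram.comp_natural_fst (T := T) (q := ⦋1⦌) (r := ⦋0⦌) φ.fst
      (Fin.zero_le (1 : Fin 2)) 0
    have hb := (congrArg (_ ≫ ·) hw).trans (Diagram.comp_natural_snd (T := T) (q := ⦋0⦌)
      (r := ⦋1⦌) φ.snd 0 (Fin.zero_le (1 : Fin 2)))
    let e₀₁ := Diagram.compIso (T := T) (q := ⦋1⦌) (r := ⦋0⦌) φ.fst 0 0
    let e₁₁ := Diagram.compIso (T := T) (q := ⦋1⦌) (r := ⦋0⦌) φ.fst 1 0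
    let e₁₀ := Diagram.compIso (T := T) (q := ⦋0⦌) (r := ⦋1⦌) φ.snd 0 0
    obtain ⟨e, ht, hl⟩ := IsPullback.exists_iso
      (hT.diagram_isPullback F (Fin.zero_le (1 : Fin 2)) (Fin.zero_le (1 : Fin 2)))
      (hT.diagram_isPullback G (Fin.zero_le (1 : Fin 2)) (Fin.zero_le (1 : Fin 2)))
      e₀₁ e₁₀ e₁₁ hr hb
    refine ⟨squareIso (F := Diagram.diagram F) (G := Diagram.diagram G) e e₀₁ e₁₀ e₁₁ ht hl hr hb,
      CategoricalPullback.hom_ext ?_ ?_⟩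
    · refine Diagram.hom_ext (T := T) (q := ⦋1⦌) (r := ⦋0⦌) fun i j => ?_
      match i, j with
      | 0, 0 => rfl
      | 1, 0 => rfl
    · refine Diagram.hom_ext (T := T) (q := ⦋0⦌) (r := ⦋1⦌) fun i j => ?_
      match i, j with
      | 0, 0 => rfl
      | 0, 1 => exact hw⟩
  essSurj := ⟨fun x => by
    let e : x.fst.diagram.obj (1, 0) ≅ x.snd.diagram.obj (0, 1) :=
      Diagram.compIso (T := T) (q := ⦋0⦌) (r := ⦋0⦌) x.iso.hom 0 0
    -- The isomorphism between the ends of the legs is again absorbed into the vertical one, this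
    -- time after it. This is why `e₁` has `e.symm` at the lower corner.
    have hq := T.vertical_comp (x.fst.vertical (Fin.zero_le (1 : Fin 2)) 0)
      (T.vertical_of_isIso e.hom)
    have hj := x.snd.horizontal 0 (Fin.zero_le (1 : Fin 2))
    obtain ⟨a, i, p, w, hi, hp, hs⟩ := hT.cospan _ _ hq hj
    let F := Diagram.ofSquare w hi hp hq hj hs
    have hF : IsEqToHom (C := D) (x := F.diagram.obj (1, 1)) (y := F.diagram.obj (1, 1)) _ :=
      Diagram.isEqToHom_comp (T := T) (q := ⦋0⦌) (r := ⦋0⦌)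
        (IsEqToHom.hom_app (restrict_square (T := T) (tgtVertex 1) (tgtVertex 1)).symm F) 0 0
    let e₁ : (T.restrict (𝟙 ⦋1⦌) (tgtVertex 1)).obj F ⟶ x.fst :=
      gridIsoOfSteps (m := 1) (n := 0)
        (fun y => match y with
          | (0, 0) => Iso.refl _
          | (1, 0) => e.symm)
        (fun k j => match k, j with
          | 0, 0 => (congrArg (· ≫ _) (Diagram.ofSquare_map_right w hi hp hq hj hs)).trans
              (((Category.assoc _ _ _).trans ((congrArg (_ ≫ ·) e.hom_inv_id).trans
                (Category.comp_id _))).trans (Category.id_comp _).symm))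
        (fun i k => k.elim0)
    let e₂ : (T.restrict (tgtVertex 1) (𝟙 ⦋1⦌)).obj F ⟶ x.snd :=
      gridIsoOfSteps (m := 0) (n := 1)
        (fun y => match y with
          | (0, 0) => Iso.refl _
          | (0, 1) => Iso.refl _)
        (fun k => k.elim0)
        (fun i k => match i, k with
          | 0, 0 => (congrArg (· ≫ _) (Diagram.ofSquare_map_bot w hi hp hq hj hs)).trans
              ((Category.comp_id _).trans (Category.id_comp _).symm))
    refine ⟨F, ⟨CategoricalPullback.mkIso (Groupoid.isoEquivHom _ _ |>.symm e₁)
      (Groupoid.isoEquivHom _ _ |>.symm e₂) ?_⟩⟩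
    refine Diagram.hom_ext (T := T) (q := ⦋0⦌) (r := ⦋0⦌) fun i j => ?_
    match i, j with
    | 0, 0 =>
      exact e.inv_hom_id.trans
        ((Category.comp_id _).symm.trans (congrArg (· ≫ _) hF.eq_id.symm))⟩

end Stable

end SquareClass

end

noncomputable section

/-! ### The category of relative objects of an exact functor -/

section BicartesianPasting

variable {D : Type*} [Category* D]

lemma CategoryTheory.BicartesianSq.paste_horiz {a b c a' b' c' : D} {i : a ⟶ b}
    {i' : b ⟶ c} {p : a ⟶ a'}
    {q : b ⟶ b'} {r : c ⟶ c'} {j : a' ⟶ b'} {j' : b' ⟶ c'} (s : BicartesianSq i p q j)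
    (t : BicartesianSq i' q r j') : BicartesianSq (i ≫ i') p r (j ≫ j') :=
  .of_isPullback_isPushout (s.toIsPullback.paste_horiz t.toIsPullback)
    (s.toIsPushout.paste_horiz t.toIsPushout)

lemma CategoryTheory.BicartesianSq.paste_vert {a b a' b' a'' b'' : D} {i : a ⟶ b}
    {j : a' ⟶ b'} {k : a'' ⟶ b''}
    {p : a ⟶ a'} {q : b ⟶ b'} {p' : a' ⟶ a''} {q' : b' ⟶ b''} (s : BicartesianSq i p q j)
    (t : BicartesianSq j p' q' k) : BicartesianSq i (p ≫ p') (q ≫ q') k :=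
  .of_isPullback_isPushout (s.toIsPullback.paste_vert t.toIsPullback)
    (s.toIsPushout.paste_vert t.toIsPushout)

lemma CategoryTheory.BicartesianSq.of_horiz_isIso {a b c d : D} {i : a ⟶ b} {p : a ⟶ c}
    {q : b ⟶ d} {j : c ⟶ d}
    [IsIso i] [IsIso j] (w : i ≫ q = p ≫ j) : BicartesianSq i p q j :=
  .of_isPullback_isPushout (.of_horiz_isIso ⟨w⟩) (.of_horiz_isIso ⟨w⟩)

lemma CategoryTheory.BicartesianSq.of_vert_isIso {a b c d : D} {i : a ⟶ b} {p : a ⟶ c}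
    {q : b ⟶ d} {j : c ⟶ d}
    [IsIso p] [IsIso q] (w : i ≫ q = p ≫ j) : BicartesianSq i p q j :=
  .of_isPullback_isPushout (.of_vert_isIso ⟨w⟩) (.of_vert_isIso ⟨w⟩)

end BicartesianPasting

variable {A : Type u} [Category.{v} A] {B : Type u} [Category.{v} B] [Preadditive B]
  [HasFiniteBiproducts B]

/-- An object `right` of `A` with an admissible epimorphism onto its image in `B`. -/
structure RelObj (SB : ExactStructure B) (f : A ⥤ B) : Type (max u v) where
  left : B
  right : A
  hom : left ⟶ f.obj right
  mem : SB.E hom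

namespace RelObj

variable {SB : ExactStructure B} {f : A ⥤ B}

/-- Morphisms of relative objects. -/
@[ext]
structure Hom (x y : RelObj SB f) : Type v where
  left : x.left ⟶ y.left
  right : x.right ⟶ y.right
  w : left ≫ y.hom = x.hom ≫ f.map right

instance : Category.{v} (RelObj SB f) where
  Hom := Hom
  id x := ⟨𝟙 _, 𝟙 _, by simp⟩
  comp φ ψ := ⟨φ.left ≫ ψ.left, φ.right ≫ ψ.right, by
    rw [Category.assoc, ψ.w, f.map_comp, ← Category.assoc, φ.w, Category.assoc]⟩
  id_comp _ := Hom.ext (Category.id_comp _) (Category.id_comp _)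
  comp_id _ := Hom.ext (Category.comp_id _) (Category.comp_id _)
  assoc _ _ _ := Hom.ext (Category.assoc _ _ _) (Category.assoc _ _ _)

@[ext]
lemma hom_ext {x y : RelObj SB f} {φ ψ : x ⟶ y} (h : φ.left = ψ.left) (h' : φ.right = ψ.right) :
    φ = ψ := Hom.ext h h'

@[simp] lemma comp_left {x y z : RelObj SB f} (φ : x ⟶ y) (ψ : y ⟶ z) :
    (φ ≫ ψ).left = φ.left ≫ ψ.left := rfl
@[simp] lemma comp_right {x y z : RelObj SB f} (φ : x ⟶ y) (ψ : y ⟶ z) :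
    (φ ≫ ψ).right = φ.right ≫ ψ.right := rfl

/-- The projection to `B`. -/
def leftFunctor (SB : ExactStructure B) (f : A ⥤ B) : RelObj SB f ⥤ B where
  obj x := x.left
  map φ := φ.left

/-- The projection to `A`. -/
def rightFunctor (SB : ExactStructure B) (f : A ⥤ B) : RelObj SB f ⥤ A where
  obj x := x.right
  map φ := φ.right

instance {x y : RelObj SB f} (φ : x ⟶ y) [IsIso φ] : IsIso φ.left :=
  inferInstanceAs (IsIso ((leftFunctor SB f).map φ))

instance {x y : RelObj SB f} (φ : x ⟶ y) [IsIso φ] : IsIso φ.right :=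
  inferInstanceAs (IsIso ((rightFunctor SB f).map φ))

/-- Isomorphisms of relative objects. -/
def isoMk {x y : RelObj SB f} (l : x.left ≅ y.left) (r : x.right ≅ y.right)
    (w : l.hom ≫ y.hom = x.hom ≫ f.map r.hom) : x ≅ y where
  hom := ⟨l.hom, r.hom, w⟩
  inv := ⟨l.inv, r.inv, by
    rw [Iso.inv_comp_eq, ← Category.assoc, w, Category.assoc, ← f.map_comp]
    simp⟩
  hom_inv_id := hom_ext l.hom_inv_id r.hom_inv_id
  inv_hom_id := hom_ext l.inv_hom_id r.inv_hom_id

/-- The pushout is formed in each component: on the left the vertical maps are invertible, on the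
right it is the hypothesis. Compatibility with the structure maps is an equation of maps out of
`d.left`, so it is tested on the left pushout and nothing about `f` is needed. -/
lemma isPushout_of_bicartesianSq {a b c d : RelObj SB f} {i : a ⟶ b} {p : a ⟶ c} {q : b ⟶ d}
    {j : c ⟶ d} (w : i ≫ q = p ≫ j) (hp : IsIso p.left) (hq : IsIso q.left)
    (h : BicartesianSq i.right p.right q.right j.right) : IsPushout i p q j := by
  have wl : i.left ≫ q.left = p.left ≫ j.left := congrArg Hom.left w
  have sl : IsPushout i.left p.left q.left j.left := .of_vert_isIso ⟨wl⟩
  have sr := h.toIsPushout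
  refine ⟨⟨w⟩, ⟨PushoutCocone.IsColimit.mk w
    (fun s => ⟨sl.desc s.inl.left s.inr.left (congrArg Hom.left s.condition),
      sr.desc s.inl.right s.inr.right (congrArg Hom.right s.condition), ?_⟩)
    (fun s => hom_ext (sl.inl_desc _ _ _) (sr.inl_desc _ _ _))
    (fun s => hom_ext (sl.inr_desc _ _ _) (sr.inr_desc _ _ _))
    (fun s m h₁ h₂ => hom_ext (sl.hom_ext ?_ ?_) (sr.hom_ext ?_ ?_))⟩⟩
  · apply sl.hom_ext
    · rw [sl.inl_desc_assoc, s.inl.w, reassoc_of% q.w, ← f.map_comp, sr.inl_desc]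
    · rw [sl.inr_desc_assoc, s.inr.w, reassoc_of% j.w, ← f.map_comp, sr.inr_desc]
  · exact (congrArg Hom.left h₁).trans (sl.inl_desc _ _ _).symm
  · exact (congrArg Hom.left h₂).trans (sl.inr_desc _ _ _).symm
  · exact (congrArg Hom.right h₁).trans (sr.inl_desc _ _ _).symm
  · exact (congrArg Hom.right h₂).trans (sr.inr_desc _ _ _).symm

/-- Unlike for pushouts, compatibility with the structure maps is an equation of maps into `f.obj
a.right`. Testing it on the two projections requires the image square `h'` to be a pullback. -/
lemma isPullback_of_bicartesianSq {a b c d : RelObj SB f} {i : a ⟶ b} {p : a ⟶ c} {q : b ⟶ d}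
    {j : c ⟶ d} (w : i ≫ q = p ≫ j) (hp : IsIso p.left) (hq : IsIso q.left)
    (h : BicartesianSq i.right p.right q.right j.right)
    (h' : BicartesianSq (f.map i.right) (f.map p.right) (f.map q.right) (f.map j.right)) :
    IsPullback i p q j := by
  have wl : i.left ≫ q.left = p.left ≫ j.left := congrArg Hom.left w
  have sl : IsPullback i.left p.left q.left j.left := .of_vert_isIso ⟨wl⟩
  have sr := h.toIsPullback
  refine ⟨⟨w⟩, ⟨PullbackCone.IsLimit.mk w
    (fun s => ⟨sl.lift s.fst.left s.snd.left (congrArg Hom.left s.condition),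
      sr.lift s.fst.right s.snd.right (congrArg Hom.right s.condition), ?_⟩)
    (fun s => hom_ext (sl.lift_fst _ _ _) (sr.lift_fst _ _ _))
    (fun s => hom_ext (sl.lift_snd _ _ _) (sr.lift_snd _ _ _))
    (fun s m h₁ h₂ => hom_ext (sl.hom_ext ?_ ?_) (sr.hom_ext ?_ ?_))⟩⟩
  · apply h'.toIsPullback.hom_ext
    · rw [Category.assoc, Category.assoc, ← i.w, sl.lift_fst_assoc, s.fst.w, ← f.map_comp,
        sr.lift_fst]
    · rw [Category.assoc, Category.assoc, ← p.w, sl.lift_snd_assoc, s.snd.w, ← f.map_comp,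
        sr.lift_snd]
  · exact (congrArg Hom.left h₁).trans (sl.lift_fst _ _ _).symm
  · exact (congrArg Hom.left h₂).trans (sl.lift_snd _ _ _).symm
  · exact (congrArg Hom.right h₁).trans (sr.lift_fst _ _ _).symm
  · exact (congrArg Hom.right h₂).trans (sr.lift_snd _ _ _).symm

variable [Preadditive A] [HasFiniteBiproducts A] {SA : ExactStructure A}

variable (SA) (SB) (f) in
/-- The horizontal and vertical morphisms and the distinguished squares of relative objects. -/
def squareClass : SquareClass (RelObj SB f) where
  horizontal {x y} φ := SB.M φ.left ∧ SA.M φ.right ∧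
    BicartesianSq φ.left x.hom y.hom (f.map φ.right)
  vertical φ := IsIso φ.left ∧ SA.E φ.right
  square i p q j := i ≫ q = p ≫ j ∧ BicartesianSq i.right p.right q.right j.right
  horizontal_of_isIso φ _ := ⟨SB.M_of_isIso _, SA.M_of_isIso _, .of_horiz_isIso φ.w⟩
  horizontal_comp h h' := ⟨h.1.comp h'.1, h.2.1.comp h'.2.1, by
    rw [comp_right, f.map_comp]
    exact h.2.2.paste_horiz h'.2.2⟩
  vertical_of_isIso φ _ := ⟨inferInstance, SA.E_of_isIso _⟩
  vertical_comp h h' := ⟨by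
    have := h.1
    have := h'.1
    rw [comp_left]
    infer_instance, h.2.comp h'.2⟩
  square_of_horizontal_isIso h := ⟨h, .of_horiz_isIso (congrArg Hom.right h)⟩
  square_of_vertical_isIso h := ⟨h, .of_vert_isIso (congrArg Hom.right h)⟩
  square_paste_horizontal h h' := ⟨by
    rw [Category.assoc, h'.1, ← Category.assoc, h.1, Category.assoc], h.2.paste_horiz h'.2⟩
  square_paste_vertical h h' := ⟨by
    rw [← Category.assoc, h.1, Category.assoc, h'.1, Category.assoc], h.2.paste_vert h'.2⟩

/-- Fillers are built in `A` and carried to `B` by `f`. The new triple keeps the `B`-object of `b`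
for spans and of `c` for cospans, so the new vertical map is the identity on the left. What has to
be verified is that the new horizontal map has a bicartesian square and, for cospans, that the new
structure map is in `E`. -/
lemma squareClass_isStable (hf : IsExactFunctor SA SB f) : (squareClass SB f SA).IsStable where
  isPushout hi hp hq hj hs := isPushout_of_bicartesianSq hs.1 hp.1 hq.1 hs.2
  isPullback hi hp hq hj hs := isPullback_of_bicartesianSq hs.1 hp.1 hq.1 hs.2
    (hf.map_bicartesianSq hs.2 hi.2.1 hp.2 hq.2 hj.2.1)
  span {a b c} i p hi hp := by
    have := hp.1
    obtain ⟨d, q, j, sq, hj⟩ := SA.pushout_mono p.right i.right hi.2.1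
    have hq : SA.E q := .of_isPushout sq hi.2.1 hp.2
    have sq' := ExactStructure.bicartesianSq_of_isPushout sq hi.2.1
    have sqf := hf.map_bicartesianSq sq' hi.2.1 hp.2 hq hj
    let z : RelObj SB f := ⟨b.left, d, b.hom ≫ f.map q, b.mem.comp (hf.map_E hq)⟩
    have hc : inv p.left ≫ a.hom ≫ f.map p.right = c.hom := by
      rw [← p.w, IsIso.inv_hom_id_assoc]
    -- The bicartesian square of `i` is pasted with the image of the pushout square, and `inv
    -- p.left` then replaces `a.left` by `c.left`.
    have bl : BicartesianSq (inv p.left ≫ i.left) c.hom z.hom (f.map j) := by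
      have := (BicartesianSq.of_horiz_isIso (i := inv p.left) (j := 𝟙 _) (p := c.hom)
        (q := a.hom ≫ f.map p.right) (by rw [hc, Category.comp_id])).paste_horiz
        (hi.2.2.paste_vert sqf)
      rwa [Category.id_comp] at this
    refine ⟨z, ⟨𝟙 _, q, Category.id_comp _⟩, ⟨inv p.left ≫ i.left, j, bl.w⟩, ?_, ⟨?_, hq⟩,
      ⟨(SB.M_of_isIso _).comp hi.1, hj, bl⟩, ?_, sq'⟩
    · apply hom_ext
      · simp
      · exact sq.w
    · exact (inferInstance : IsIso (𝟙 b.left))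
    · apply hom_ext
      · simp
      · exact sq.w
  cospan {b c d} q j hq hj := by
    have := hq.1
    obtain ⟨a, i, p, sq, hp⟩ := SA.pullback_epi j.right q.right hq.2
    have hi : SA.M i := .of_isPullback sq hq.2 hj.2.1
    have sq' := ExactStructure.bicartesianSq_of_isPullback sq hq.2
    have sqf := hf.map_bicartesianSq sq' hi hp hq.2 hj.2.1
    have bl : BicartesianSq (j.left ≫ inv q.left) c.hom (b.hom ≫ f.map q.right)
        (f.map j.right) := by
      have := hj.2.2.paste_horiz (BicartesianSq.of_horiz_isIso (i := inv q.left) (j := 𝟙 _)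
        (p := d.hom) (q := b.hom ≫ f.map q.right)
        (by rw [← q.w, IsIso.inv_hom_id_assoc, Category.comp_id]))
      rwa [Category.comp_id] at this
    -- The structure map of the new triple exists because `f.obj a` is still a pullback in `B`.
    let h : c.left ⟶ f.obj a := sqf.toIsPullback.lift (j.left ≫ inv q.left ≫ b.hom) c.hom
      (by simpa using bl.w)
    have h₁ : h ≫ f.map i = (j.left ≫ inv q.left) ≫ b.hom := by
      rw [Category.assoc]
      exact sqf.toIsPullback.lift_fst _ _ _
    have h₂ : h ≫ f.map p = c.hom := sqf.toIsPullback.lift_snd _ _ _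
    -- The square `bl` is this square stacked on the image of the pullback square. Cancelling the
    -- latter shows that `h` is a pullback of `b.hom`, hence in `E`.
    have pb : IsPullback (j.left ≫ inv q.left) h b.hom (f.map i) :=
      IsPullback.of_bot (by rw [h₂]; exact bl.toIsPullback) h₁.symm sqf.toIsPullback
    let z : RelObj SB f := ⟨c.left, a, h, .of_isPullback pb b.mem⟩
    refine ⟨z, ⟨j.left ≫ inv q.left, i, h₁.symm⟩, ⟨𝟙 _, p, ?_⟩, ?_,
      ⟨hj.1.comp (SB.M_of_isIso _), hi, ExactStructure.bicartesianSq_of_isPullback pb b.mem⟩,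
      ⟨?_, hp⟩, ?_, sq'⟩
    · exact (Category.id_comp _).trans h₂.symm
    · apply hom_ext
      · simp
      · exact sq.w
    · exact (inferInstance : IsIso (𝟙 c.left))
    · apply hom_ext
      · simp
      · exact sq.w

end RelObj

end

/-! ### Relative objects with zero component in `A` -/

noncomputable section

namespace SquareClass

variable {D : Type u} [Category.{v} D] {T : SquareClass D}

/-- The vertical map is realised as a column of a degenerate square with identity horizontal sides,
so `ofSquare` also supplies grids with a single column. The horizontal case is the same with
identity vertical sides. -/
lemma exists_diagram_of_vertical (o : T.Diagram ⦋0⦌ ⦋0⦌) {z : D} (p : o.diagram.obj (0, 0) ⟶ z)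
    (hp : T.vertical p) : ∃ F : T.Diagram ⦋1⦌ ⦋0⦌, F.diagram.obj (1, 0) = z ∧
      Nonempty ((T.restrict (srcVertex 1) (𝟙 ⦋0⦌)).obj F ≅ o) := by
  have w : 𝟙 _ ≫ p = p ≫ 𝟙 _ := by simp
  refine ⟨(T.restrict (𝟙 ⦋1⦌) (srcVertex 1)).obj (Diagram.ofSquare w (T.horizontal_of_isIso _) hp
    hp (T.horizontal_of_isIso _) (T.square_of_horizontal_isIso w)), rfl,
    ⟨(Groupoid.isoEquivHom _ _).symm (gridIsoOfSteps (m := 0) (n := 0) (fun x => match x with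
      | (0, 0) => Iso.refl _) (fun k => k.elim0) (fun _ k => k.elim0))⟩⟩

lemma exists_diagram_of_horizontal (o : T.Diagram ⦋0⦌ ⦋0⦌) {z : D}
    (i : z ⟶ o.diagram.obj (0, 0)) (hi : T.horizontal i) :
    ∃ F : T.Diagram ⦋0⦌ ⦋1⦌, F.diagram.obj (0, 0) = z ∧
      Nonempty ((T.restrict (𝟙 ⦋0⦌) (tgtVertex 1)).obj F ≅ o) := by
  have w : i ≫ 𝟙 _ = 𝟙 _ ≫ i := by simp
  refine ⟨(T.restrict (srcVertex 1) (𝟙 ⦋1⦌)).obj (Diagram.ofSquare w hi (T.vertical_of_isIso _)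
    (T.vertical_of_isIso _) hi (T.square_of_vertical_isIso w)), rfl,
    ⟨(Groupoid.isoEquivHom _ _).symm (gridIsoOfSteps (m := 0) (n := 0) (fun x => match x with
      | (0, 0) => Iso.refl _) (fun k => k.elim0) (fun _ k => k.elim0))⟩⟩

end SquareClass

namespace RelObj

open SquareClass ZeroObject

variable {A : Type u} [Category.{v} A] {B : Type u} [Category.{v} B] [Preadditive B]
  [HasFiniteBiproducts B] [Preadditive A] [HasFiniteBiproducts A] {SA : ExactStructure A}
  {SB : ExactStructure B} {f : A ⥤ B}

/-- A relative object with zero component in `A` is determined by its component in `B`, and a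
vertical map is invertible there. The map at the target is therefore forced by the one at the
source, and can be defined by conjugation. -/
lemma vertical_restrict_bijective (hf : IsExactFunctor SA SB f)
    (F G : (squareClass SB f SA).Diagram ⦋1⦌ ⦋0⦌) (hF : IsZero (F.diagram.obj (1, 0)).right)
    (hG : IsZero (G.diagram.obj (1, 0)).right) : Function.Bijective
      (((squareClass SB f SA).restrict (srcVertex 1) (𝟙 ⦋0⦌)).map : (F ⟶ G) → _) := by
  have vF := (F.vertical (Fin.zero_le (1 : Fin 2)) 0).1
  have vG := (G.vertical (Fin.zero_le (1 : Fin 2)) 0).1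
  constructor
  · intro φ ψ h
    have h₀ : Diagram.comp φ 0 0 = Diagram.comp ψ 0 0 :=
      congrArg (fun τ => Diagram.comp (T := squareClass SB f SA) (q := ⦋0⦌) (r := ⦋0⦌) τ 0 0) h
    refine Diagram.hom_ext fun i j => ?_
    match i, j with
    | 0, 0 => exact h₀
    | 1, 0 =>
      refine hom_ext ?_ (hF.eq_of_src _ _)
      have h₁ := congrArg Hom.left (Diagram.comp_natural_fst φ (Fin.zero_le (1 : Fin 2)) 0)
      have h₂ := congrArg Hom.left (Diagram.comp_natural_fst ψ (Fin.zero_le (1 : Fin 2)) 0)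
      rw [h₀, ← h₂] at h₁
      exact (cancel_epi _).1 h₁
  · intro φ
    let e : F.diagram.obj (0, 0) ≅ G.diagram.obj (0, 0) :=
      Diagram.compIso (T := squareClass SB f SA) (q := ⦋0⦌) (r := ⦋0⦌) φ 0 0
    let uF := F.diagram.map (X := (0, 0)) (Y := (1, 0)) (homOfLE (Fin.zero_le (1 : Fin 2)), 𝟙 _)
    let uG := G.diagram.map (X := (0, 0)) (Y := (1, 0)) (homOfLE (Fin.zero_le (1 : Fin 2)), 𝟙 _)
    have iF : IsIso uF.left := vF
    have iG : IsIso uG.left := vG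
    let el : (F.diagram.obj (0, 0)).left ≅ (G.diagram.obj (0, 0)).left :=
      (leftFunctor SB f).mapIso e
    let e₁ : F.diagram.obj (1, 0) ≅ G.diagram.obj (1, 0) :=
      isoMk ((asIso uF.left).symm ≪≫ el ≪≫ asIso uG.left)
        (hF.iso hG) ((hf.map_isZero hG).eq_of_tgt _ _)
    have he : uF ≫ e₁.hom = e.hom ≫ uG :=
      hom_ext (IsIso.hom_inv_id_assoc uF.left (e.hom.left ≫ uG.left)) (hG.eq_of_tgt _ _)
    refine ⟨gridIsoOfSteps (m := 1) (n := 0) (F := F.diagram) (G := G.diagram)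
      (fun x => match x with
        | (0, 0) => e
        | (1, 0) => e₁)
      (fun k j => match k, j with
        | 0, 0 => he)
      (fun _ k => k.elim0), ?_⟩
    refine Diagram.hom_ext (T := squareClass SB f SA) (q := ⦋0⦌) (r := ⦋0⦌) fun i j => ?_
    match i, j with
    | 0, 0 => rfl

/-- The square of a horizontal map out of such an object has a zero object in one corner, so its
source is a kernel of the structure map of its target. Kernels are functorial for isomorphisms, and
the kernel inclusion is monic, which gives uniqueness. -/
lemma horizontal_restrict_bijective (hf : IsExactFunctor SA SB f)
    (F G : (squareClass SB f SA).Diagram ⦋0⦌ ⦋1⦌) (hF : IsZero (F.diagram.obj (0, 0)).right)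
    (hG : IsZero (G.diagram.obj (0, 0)).right) : Function.Bijective
      (((squareClass SB f SA).restrict (𝟙 ⦋0⦌) (tgtVertex 1)).map : (F ⟶ G) → _) := by
  let uF := F.diagram.map (X := (0, 0)) (Y := (0, 1)) (𝟙 _, homOfLE (Fin.zero_le (1 : Fin 2)))
  let uG := G.diagram.map (X := (0, 0)) (Y := (0, 1)) (𝟙 _, homOfLE (Fin.zero_le (1 : Fin 2)))
  obtain ⟨_, _, sF⟩ := F.horizontal 0 (Fin.zero_le (1 : Fin 2))
  obtain ⟨hm, _, sG⟩ := G.horizontal 0 (Fin.zero_le (1 : Fin 2))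
  have := hm.mono
  constructor
  · intro φ ψ h
    have h₀ : Diagram.comp φ 0 1 = Diagram.comp ψ 0 1 :=
      congrArg (fun τ => Diagram.comp (T := squareClass SB f SA) (q := ⦋0⦌) (r := ⦋0⦌) τ 0 0) h
    refine Diagram.hom_ext fun i j => ?_
    match i, j with
    | 0, 1 => exact h₀
    | 0, 0 =>
      refine hom_ext ?_ (hF.eq_of_src _ _)
      have h₁ := congrArg Hom.left (Diagram.comp_natural_snd φ 0 (Fin.zero_le (1 : Fin 2)))
      have h₂ := congrArg Hom.left (Diagram.comp_natural_snd ψ 0 (Fin.zero_le (1 : Fin 2)))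
      rw [h₀, h₂] at h₁
      exact (cancel_mono _).1 h₁.symm
  · intro φ
    let e : F.diagram.obj (0, 1) ≅ G.diagram.obj (0, 1) :=
      Diagram.compIso (T := squareClass SB f SA) (q := ⦋0⦌) (r := ⦋0⦌) φ 0 0
    obtain ⟨l, hl, hl'⟩ := IsPullback.exists_iso sF.toIsPullback sG.toIsPullback
      ((leftFunctor SB f).mapIso e) (f.mapIso (hF.iso hG))
      (f.mapIso ((rightFunctor SB f).mapIso e)) e.hom.w.symm
      ((hf.map_isZero hF).eq_of_src _ _)
    let e₀ : F.diagram.obj (0, 0) ≅ G.diagram.obj (0, 0) := isoMk l (hF.iso hG) hl'.symm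
    have he : uF ≫ e.hom = e₀.hom ≫ uG := hom_ext hl (hF.eq_of_src _ _)
    refine ⟨gridIsoOfSteps (m := 0) (n := 1) (F := F.diagram) (G := G.diagram)
      (fun x => match x with
        | (0, 0) => e₀
        | (0, 1) => e)
      (fun k => k.elim0)
      (fun i k => match i, k with
        | 0, 0 => he), ?_⟩
    refine Diagram.hom_ext (T := squareClass SB f SA) (q := ⦋0⦌) (r := ⦋0⦌) fun i j => ?_
    match i, j with
    | 0, 0 => rfl

/-- The triple b ↠ f a maps to b ↠ f 0 by the identity of b. -/
lemma exists_vertical_to_zero (hf : IsExactFunctor SA SB f) (x : RelObj SB f) :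
    ∃ (z : RelObj SB f) (p : x ⟶ z), IsZero z.right ∧ (squareClass SB f SA).vertical p := by
  have := hasZeroObject_of_hasFiniteBiproducts A
  have hZ : IsZero (0 : A) := isZero_zero A
  have hZ' := hf.map_isZero hZ
  let z : RelObj SB f := ⟨x.left, 0, 0, ExactStructure.E_of_isZero hZ' _⟩
  exact ⟨z, ⟨𝟙 _, 0, hZ'.eq_of_tgt _ _⟩, hZ, (inferInstance : IsIso (𝟙 x.left)),
    ExactStructure.E_of_isZero hZ _⟩

/-- The kernel K of b ↠ f a gives the triple K ↠ f 0, and the conflation read as a square with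
corner `f 0` is bicartesian. -/
lemma exists_horizontal_from_zero (hf : IsExactFunctor SA SB f) (x : RelObj SB f) :
    ∃ (z : RelObj SB f) (i : z ⟶ x), IsZero z.right ∧ (squareClass SB f SA).horizontal i := by
  have := hasZeroObject_of_hasFiniteBiproducts A
  have hZ : IsZero (0 : A) := isZero_zero A
  have hZ' := hf.map_isZero hZ
  obtain ⟨K, k, w, h⟩ := x.mem
  let z : RelObj SB f := ⟨K, 0, 0, ExactStructure.E_of_isZero hZ' _⟩
  have sq := ExactStructure.bicartesianSq_of_conflation h hZ' z.hom (f.map 0)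
  exact ⟨z, ⟨k, 0, sq.w⟩, hZ, ⟨_, _, w, h⟩, ExactStructure.M_of_isZero hZ _, sq⟩

end RelObj

end

noncomputable section

/-! ### Comparison of the relative exact nerve with the nerve of relative objects -/

variable {A : Type u} [Category.{v} A] {B : Type u} [Category.{v} B] [Preadditive A]
  [HasFiniteBiproducts A] [Preadditive B] [HasFiniteBiproducts B] {SA : ExactStructure A}
  {SB : ExactStructure B} {f : A ⥤ B}

namespace Grid

variable {S : ExactStructure A} {q r : SimplexCategory}

/-- The component of a morphism of grids. -/
def comp {F G : Grid S q r} (φ : F ⟶ G) (i : Fin (q.len + 1)) (j : Fin (r.len + 1)) :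
    F.diagram.obj (i, j) ⟶ G.diagram.obj (i, j) :=
  (Iso.hom (C := Fin (q.len + 1) × Fin (r.len + 1) ⥤ A) φ).app (i, j)

lemma hom_ext {F G : Grid S q r} {φ ψ : F ⟶ G} (h : ∀ i j, comp φ i j = comp ψ i j) :
    φ = ψ := by
  apply Iso.ext
  ext ⟨i, j⟩
  exact h i j

lemma comp_natural {F G : Grid S q r} (φ : F ⟶ G) {x y : Fin (q.len + 1) × Fin (r.len + 1)}
    (g : x ⟶ y) : F.diagram.map g ≫ comp φ y.1 y.2 = comp φ x.1 x.2 ≫ G.diagram.map g :=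
  NatTrans.naturality (Iso.hom (C := Fin (q.len + 1) × Fin (r.len + 1) ⥤ A) φ) g

lemma comp_eqToHom {F G : Grid S q r} (h : F = G) (i : Fin (q.len + 1)) (j : Fin (r.len + 1)) :
    comp (eqToHom h) i j = eqToHom (Functor.congr_obj (congrArg diagram h) (i, j)) := by
  subst h
  rfl

end Grid

/-- The groupoid of the relative exact nerve in degree `(q, r)`. -/
abbrev RelGrid (hf : IsExactFunctor SA SB f) (q r : SimplexCategory) :=
  StrictPullback (Grid.mapFunctor hf q r)
    (Grid.reindex SB (x := (q, r)) (y := (joinPoint.obj q, r)) (joinPointFace.app q, 𝟙 r))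

namespace RelGrid

variable {hf : IsExactFunctor SA SB f} {q r : SimplexCategory}

section Object

variable (X : RelGrid hf q r)

/-- The diagram in `B` underlying an object of the relative exact nerve. -/
def total : Fin (q.len + 1 + 1) × Fin (r.len + 1) ⥤ B := X.snd.diagram

lemma obj_eq (x : Fin (q.len + 1) × Fin (r.len + 1)) :
    f.obj (X.fst.diagram.obj x) = X.total.obj (x.1.succ, x.2) :=
  Functor.congr_obj (congrArg Grid.diagram X.eq) x

/-- The shift of a map of `[q] × [r]` to the rows of positive index in `[1 + q] × [r]`. -/
abbrev shift {x y : Fin (q.len + 1) × Fin (r.len + 1)} (g : x ⟶ y) :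
    ((x.1.succ, x.2) : Fin (q.len + 1 + 1) × Fin (r.len + 1)) ⟶ (y.1.succ, y.2) :=
  (homOfLE (Fin.succ_le_succ_iff.2 g.1.le), g.2)

lemma map_eq {x y : Fin (q.len + 1) × Fin (r.len + 1)} (g : x ⟶ y) :
    f.map (X.fst.diagram.map g) ≫ eqToHom (X.obj_eq y) =
      eqToHom (X.obj_eq x) ≫ X.total.map (shift g) :=
  eqToHom_congr_functor_obj (congrArg Grid.diagram X.eq) g

lemma map_eq' {x y : Fin (q.len + 1) × Fin (r.len + 1)} (g : x ⟶ y) :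
    eqToHom (X.obj_eq x).symm ≫ f.map (X.fst.diagram.map g) =
      X.total.map (shift g) ≫ eqToHom (X.obj_eq y).symm := by
  rw [← cancel_mono (eqToHom (X.obj_eq y)), Category.assoc, X.map_eq, Category.assoc,
    eqToHom_trans, eqToHom_refl, Category.comp_id, eqToHom_trans_assoc, eqToHom_refl,
    Category.id_comp]

/-- The maps from the initial row to the row of index `i + 1`. -/
abbrev drop (x : Fin (q.len + 1) × Fin (r.len + 1)) :
    ((0, x.2) : Fin (q.len + 1 + 1) × Fin (r.len + 1)) ⟶ (x.1.succ, x.2) :=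
  (homOfLE (Fin.zero_le _), 𝟙 _)

/-- The map of the initial row induced by a map of `[q] × [r]`. -/
abbrev base {x y : Fin (q.len + 1) × Fin (r.len + 1)} (g : x ⟶ y) :
    ((0, x.2) : Fin (q.len + 1 + 1) × Fin (r.len + 1)) ⟶ (0, y.2) :=
  (𝟙 0, g.2)

/-- The relative object in position `x`. -/
def relObj (x : Fin (q.len + 1) × Fin (r.len + 1)) : RelObj SB f where
  left := X.total.obj (0, x.2)
  right := X.fst.diagram.obj x
  hom := X.total.map (drop x) ≫ eqToHom (X.obj_eq x).symm
  mem := by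
    have h : SB.E (X.total.map (drop x)) := X.snd.vertical (Fin.zero_le x.1.succ) x.2
    exact h.comp (SB.E_of_isIso (eqToHom (X.obj_eq x).symm))

/-- The diagram of relative objects underlying an object of the relative exact nerve. -/
def relDiagram : Fin (q.len + 1) × Fin (r.len + 1) ⥤ RelObj SB f where
  obj := X.relObj
  map {x y} g := ⟨X.total.map (base g), X.fst.diagram.map g, by
    change X.total.map (base g) ≫ X.total.map (drop y) ≫ eqToHom _ =
      (X.total.map (drop x) ≫ eqToHom _) ≫ f.map (X.fst.diagram.map g)
    rw [Category.assoc, X.map_eq', ← Functor.map_comp_assoc, ← Functor.map_comp_assoc]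
    rfl⟩
  map_id x := RelObj.hom_ext (X.total.map_id _) (X.fst.diagram.map_id _)
  map_comp g h := RelObj.hom_ext (X.total.map_comp (base g) (base h))
    (X.fst.diagram.map_comp _ _)

/-- The grid of relative objects underlying an object of the relative exact nerve. -/
def toDiagram : (RelObj.squareClass SB f SA).Diagram q r where
  diagram := X.relDiagram
  horizontal i j l h := by
    refine ⟨X.snd.horizontal 0 h, X.fst.horizontal i h, ?_⟩
    -- The structure maps end with the identification of the lower rows of `X.total` with the image
    -- of `f`. This square accounts for it and is pasted below the square between the rows 0 and `i
    -- + 1`.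
    have s := BicartesianSq.of_vert_isIso
      (X.map_eq' (x := (i, j)) (y := (i, l)) (𝟙 i, homOfLE h)).symm
    exact (X.snd.bicartesian (Fin.zero_le i.succ) h).paste_vert s
  vertical {i k} h j := by
    refine ⟨?_, X.fst.vertical h j⟩
    -- A vertical move does not affect the initial row, so the left component is the image of an
    -- identity.
    have : IsIso (X.total.map (𝟙 ((0, j) : Fin (q.len + 1 + 1) × Fin (r.len + 1)))) :=
      inferInstance
    exact this
  square h _ _ h' := by
    refine ⟨?_, X.fst.bicartesian h h'⟩
    exact map_prod_comm X.relDiagram h h'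

end Object

section Morphism

variable {X Y : RelGrid hf q r} (φ : X ⟶ Y)

/-- The components in `A` of a morphism of the relative exact nerve. -/
def fstIso (x : Fin (q.len + 1) × Fin (r.len + 1)) :
    X.fst.diagram.obj x ≅ Y.fst.diagram.obj x :=
  Iso.app (C := Fin (q.len + 1) × Fin (r.len + 1)) φ.fst x

/-- The components in `B` of a morphism of the relative exact nerve. -/
def totalIso (y : Fin (q.len + 1 + 1) × Fin (r.len + 1)) : X.total.obj y ≅ Y.total.obj y :=
  Iso.app (C := Fin (q.len + 1 + 1) × Fin (r.len + 1)) φ.snd y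

lemma fstIso_natural {x y : Fin (q.len + 1) × Fin (r.len + 1)} (g : x ⟶ y) :
    X.fst.diagram.map g ≫ (fstIso φ y).hom = (fstIso φ x).hom ≫ Y.fst.diagram.map g :=
  Grid.comp_natural φ.fst g

lemma totalIso_natural {x y : Fin (q.len + 1 + 1) × Fin (r.len + 1)} (g : x ⟶ y) :
    X.total.map g ≫ (totalIso φ y).hom = (totalIso φ x).hom ≫ Y.total.map g :=
  Grid.comp_natural (q := joinPoint.obj q) φ.snd g

/-- The components of a morphism are compatible. -/
lemma iso_eq (x : Fin (q.len + 1) × Fin (r.len + 1)) :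
    f.map (fstIso φ x).hom ≫ eqToHom (Y.obj_eq x) =
      eqToHom (X.obj_eq x) ≫ (totalIso φ (x.1.succ, x.2)).hom := by
  have h := congrArg (fun τ => Grid.comp τ x.1 x.2) φ.eq
  have h₁ := Grid.comp_eqToHom X.eq x.1 x.2
  have h₂ := Grid.comp_eqToHom Y.eq x.1 x.2
  exact (congrArg (_ ≫ ·) h₂.symm).trans (h.trans (congrArg (· ≫ _) h₁))

lemma iso_eq' (x : Fin (q.len + 1) × Fin (r.len + 1)) :
    eqToHom (X.obj_eq x).symm ≫ f.map (fstIso φ x).hom =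
      (totalIso φ (x.1.succ, x.2)).hom ≫ eqToHom (Y.obj_eq x).symm := by
  have h := iso_eq φ x
  rw [← cancel_mono (eqToHom (Y.obj_eq x)), Category.assoc, h, Category.assoc,
    eqToHom_trans, eqToHom_refl, Category.comp_id, eqToHom_trans_assoc, eqToHom_refl,
    Category.id_comp]

/-- The morphism of diagrams of relative objects underlying a morphism of the relative exact
nerve. -/
def relDiagramIso : X.relDiagram ≅ Y.relDiagram :=
  NatIso.ofComponents (F := X.relDiagram) (G := Y.relDiagram)
    (fun x => RelObj.isoMk (x := X.relObj x) (y := Y.relObj x) (totalIso φ (0, x.2))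
      (fstIso φ x) (by
        change (totalIso φ (0, x.2)).hom ≫ Y.total.map (drop x) ≫ eqToHom _ =
          (X.total.map (drop x) ≫ eqToHom _) ≫ f.map (fstIso φ x).hom
        rw [Category.assoc, iso_eq', reassoc_of% (totalIso_natural φ (drop x))]))
    (fun g => RelObj.hom_ext (totalIso_natural φ (base g)) (fstIso_natural φ g))

end Morphism

variable (hf q r) in
/-- The comparison functor to grids of relative objects. -/
def comparison : RelGrid hf q r ⥤ (RelObj.squareClass SB f SA).Diagram q r where
  obj X := X.toDiagram
  map φ := relDiagramIso φ
  map_id _ := Iso.ext (NatTrans.ext (funext fun _ => rfl))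
  map_comp _ _ := Iso.ext (NatTrans.ext (funext fun _ => rfl))

/-- The left components record the initial row in `B`. The components in the remaining rows are
images under `f` of the components in `A`, up to the equalities of the strict pullback. -/
instance : (comparison hf q r).Faithful where
  map_injective {X Y φ ψ} h := by
    have h₁ (x : Fin (q.len + 1) × Fin (r.len + 1)) : (fstIso φ x).hom = (fstIso ψ x).hom :=
      congrArg (fun τ : X.relDiagram ≅ Y.relDiagram => RelObj.Hom.right (τ.hom.app x)) h
    have h₂ (j : Fin (r.len + 1)) : (totalIso φ (0, j)).hom = (totalIso ψ (0, j)).hom :=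
      congrArg (fun τ : X.relDiagram ≅ Y.relDiagram => RelObj.Hom.left (τ.hom.app (0, j))) h
    have h₃ (i : Fin (q.len + 1 + 1)) (j : Fin (r.len + 1)) :
        (totalIso φ (i, j)).hom = (totalIso ψ (i, j)).hom := by
      induction i using Fin.cases with
      | zero => exact h₂ j
      | succ k =>
        refine (cancel_epi (eqToHom (X.obj_eq (k, j)))).1 ?_
        exact (iso_eq φ (k, j)).symm.trans
          ((congrArg (fun τ => f.map τ ≫ _) (h₁ (k, j))).trans (iso_eq ψ (k, j)))
    exact StrictPullback.Hom.ext (Grid.hom_ext fun i j => h₁ (i, j))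
      (Grid.hom_ext (q := joinPoint.obj q) h₃)

end RelGrid

end

/-! ### Adjoining an initial row, and fullness of the comparison -/

noncomputable section

section Prepend

variable {C Q : Type*} [Category* C] [Category* Q] {n : ℕ} (R : Fin (n + 1) × Q ⥤ C) (L : Q ⥤ C)
  (η : ∀ j, L.obj j ⟶ R.obj (0, j))

/-- The objects of `prependRow`. -/
def prependObj (i : Fin (n + 2)) (j : Q) : C :=
  Fin.cases (motive := fun _ => C) (L.obj j) (fun k => R.obj (k, j)) i

/-- The maps of `prependRow`. -/
def prependMap {i i' : Fin (n + 2)} {j j' : Q} : i ≤ i' → (j ⟶ j') →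
    (prependObj R L i j ⟶ prependObj R L i' j') :=
  Fin.cases (motive := fun i => i ≤ i' → (j ⟶ j') →
      (prependObj R L i j ⟶ prependObj R L i' j'))
    (Fin.cases (motive := fun i' => 0 ≤ i' → (j ⟶ j') →
        (prependObj R L 0 j ⟶ prependObj R L i' j'))
      (fun _ g => L.map g)
      (fun k _ g => L.map g ≫ η j' ≫
        R.map (X := (0, j')) (Y := (k, j')) (homOfLE (Fin.zero_le _), 𝟙 j')) i')
    (fun l => Fin.cases (motive := fun i' => l.succ ≤ i' → (j ⟶ j') →
        (prependObj R L l.succ j ⟶ prependObj R L i' j'))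
      (fun h _ => absurd h (by simp))
      (fun k h g => R.map (X := (l, j)) (Y := (k, j')) (homOfLE (Fin.succ_le_succ_iff.1 h), g)) i')
    i

variable (hη : ∀ {j j' : Q} (g : j ⟶ j'), L.map g ≫ η j' =
  η j ≫ R.map (X := (0, j)) (Y := (0, j')) (𝟙 _, g))

/-- Adjoin an initial row to a diagram of shape `[n] × Q`. -/
def prependRow : Fin (n + 2) × Q ⥤ C where
  obj x := prependObj R L x.1 x.2
  map g := prependMap R L η g.1.le g.2
  map_id x := by
    obtain ⟨i, j⟩ := x
    induction i using Fin.cases with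
    | zero => exact L.map_id j
    | succ k => exact R.map_id (k, j)
  map_comp {x y z} g h := by
    obtain ⟨i, j⟩ := x
    obtain ⟨i', j'⟩ := y
    obtain ⟨i'', j''⟩ := z
    obtain ⟨g, g'⟩ := g
    obtain ⟨h, h'⟩ := h
    have hg := g.le
    have hh := h.le
    induction i'' using Fin.cases with
    | zero =>
      obtain rfl : i' = 0 := Fin.le_zero_iff.1 hh
      obtain rfl : i = 0 := Fin.le_zero_iff.1 hg
      exact L.map_comp g' h'
    | succ k'' =>
      induction i' using Fin.cases with
      | zero =>
        obtain rfl : i = 0 := Fin.le_zero_iff.1 hg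
        exact (congrArg (· ≫ _) (L.map_comp g' h')).trans (Category.assoc _ _ _)
      | succ k' =>
        induction i using Fin.cases with
        | zero =>
          have e₁ : R.map (X := (0, j')) (Y := (k', j')) (homOfLE (Fin.zero_le _), 𝟙 j') ≫
              R.map (X := (k', j')) (Y := (k'', j''))
                (homOfLE (Fin.succ_le_succ_iff.1 hh), h') =
              R.map (X := (0, j')) (Y := (0, j'')) (𝟙 _, h') ≫
              R.map (X := (0, j'')) (Y := (k'', j'')) (homOfLE (Fin.zero_le _), 𝟙 j'') := by
            rw [← R.map_comp, ← R.map_comp, prod_comp, prod_comp, Category.id_comp,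
              Category.comp_id]
            rfl
          have : L.map (g' ≫ h') ≫ η j'' ≫
              R.map (X := (0, j'')) (Y := (k'', j'')) (homOfLE (Fin.zero_le _), 𝟙 j'') =
              (L.map g' ≫ η j' ≫
                R.map (X := (0, j')) (Y := (k', j')) (homOfLE (Fin.zero_le _), 𝟙 j')) ≫
              R.map (X := (k', j')) (Y := (k'', j''))
                (homOfLE (Fin.succ_le_succ_iff.1 hh), h') := by
            rw [Category.assoc, Category.assoc, e₁, L.map_comp, Category.assoc,
              reassoc_of% (hη h')]
          exact this
        | succ k =>
          exact R.map_comp (X := (k, j)) (Y := (k', j')) (Z := (k'', j''))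
            (homOfLE (Fin.succ_le_succ_iff.1 hg), g') (homOfLE (Fin.succ_le_succ_iff.1 hh), h')

end Prepend

namespace RelGrid

variable {A : Type u} [Category.{v} A] {B : Type u} [Category.{v} B] [Preadditive A]
  [HasFiniteBiproducts A] [Preadditive B] [HasFiniteBiproducts B] {SA : ExactStructure A}
  {SB : ExactStructure B} {f : A ⥤ B} {hf : IsExactFunctor SA SB f} {q r : SimplexCategory}

section Full

variable {X Y : RelGrid hf q r} (τ : X.relDiagram ≅ Y.relDiagram)

/-- The components of the morphism of total diagrams induced by a morphism of relative objects. -/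
def totalComponent (i : Fin (q.len + 1 + 1)) (j : Fin (r.len + 1)) :
    X.total.obj (i, j) ≅ Y.total.obj (i, j) :=
  Fin.cases (motive := fun i => X.total.obj (i, j) ≅ Y.total.obj (i, j))
    ((RelObj.leftFunctor SB f).mapIso (τ.app (0, j)))
    (fun k => eqToIso (X.obj_eq (k, j)).symm ≪≫
      f.mapIso ((RelObj.rightFunctor SB f).mapIso (τ.app (k, j))) ≪≫ eqToIso (Y.obj_eq (k, j))) i

/-- The component in `A` of a morphism of relative diagrams. -/
def relRight (x : Fin (q.len + 1) × Fin (r.len + 1)) :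
    X.fst.diagram.obj x ⟶ Y.fst.diagram.obj x := RelObj.Hom.right (τ.hom.app x)

/-- The component in `B` of a morphism of relative diagrams. -/
def relLeft (x : Fin (q.len + 1) × Fin (r.len + 1)) :
    X.total.obj (0, x.2) ⟶ Y.total.obj (0, x.2) := RelObj.Hom.left (τ.hom.app x)

lemma totalComponent_succ (x : Fin (q.len + 1) × Fin (r.len + 1)) :
    (totalComponent τ x.1.succ x.2).hom = eqToHom (X.obj_eq x).symm ≫ f.map (relRight τ x) ≫
      eqToHom (Y.obj_eq x) := rfl

lemma relRight_natural {x y : Fin (q.len + 1) × Fin (r.len + 1)} (g : x ⟶ y) :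
    X.fst.diagram.map g ≫ relRight τ y = relRight τ x ≫ Y.fst.diagram.map g :=
  congrArg RelObj.Hom.right (τ.hom.naturality g)

lemma relLeft_comp (x : Fin (q.len + 1) × Fin (r.len + 1)) :
    relLeft τ x ≫ Y.total.map (drop x) ≫ eqToHom (Y.obj_eq x).symm =
      (X.total.map (drop x) ≫ eqToHom (X.obj_eq x).symm) ≫ f.map (relRight τ x) :=
  (τ.hom.app x).w

lemma totalComponent_shift {x y : Fin (q.len + 1) × Fin (r.len + 1)} (g : x ⟶ y) :
    X.total.map (shift g) ≫ (totalComponent τ y.1.succ y.2).hom =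
      (totalComponent τ x.1.succ x.2).hom ≫ Y.total.map (shift g) := by
  rw [totalComponent_succ, totalComponent_succ, ← reassoc_of% (X.map_eq' g), ← f.map_comp_assoc,
    relRight_natural, Category.assoc, Category.assoc, ← Y.map_eq g, f.map_comp_assoc]

/-- Naturality of the steps leaving the initial row is the condition `w` on morphisms of relative
objects. -/
lemma totalComponent_relLeft (x : Fin (q.len + 1) × Fin (r.len + 1)) :
    X.total.map (drop x) ≫ (totalComponent τ x.1.succ x.2).hom =
      relLeft τ x ≫ Y.total.map (drop x) := by
  have h := relLeft_comp τ x
  rw [totalComponent_succ, ← cancel_mono (eqToHom (Y.obj_eq x).symm), Category.assoc,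
    Category.assoc, Category.assoc, Category.assoc, h, eqToHom_trans, eqToHom_refl,
    Category.comp_id, Category.assoc]

/-- The morphism of total diagrams induced by a morphism of relative objects. -/
def totalDiagramIso : X.total ≅ Y.total :=
  SquareClass.gridIsoOfSteps (m := q.len + 1) (n := r.len)
    (fun x => totalComponent τ x.1 x.2)
    (fun k j => by
      induction k using Fin.cases with
      | zero => exact totalComponent_relLeft τ (0, j)
      | succ k =>
        exact totalComponent_shift τ (x := (k.castSucc, j)) (y := (k.succ, j))
          (homOfLE (Fin.castSucc_le_succ k), 𝟙 j))
    (fun i k => by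
      induction i using Fin.cases with
      | zero =>
        exact congrArg RelObj.Hom.left (τ.hom.naturality (X := (0, k.castSucc)) (Y := (0, k.succ))
          (𝟙 _, homOfLE (Fin.castSucc_le_succ k)))
      | succ i =>
        exact totalComponent_shift τ (x := (i, k.castSucc)) (y := (i, k.succ))
          (𝟙 i, homOfLE (Fin.castSucc_le_succ k)))

/-- The morphism of the relative exact nerve induced by a morphism of relative objects. -/
def homOfRelDiagramIso : X ⟶ Y where
  fst := Functor.isoWhiskerRight τ (RelObj.rightFunctor SB f)
  snd := totalDiagramIso τ
  eq := by
    refine Grid.hom_ext fun i j => ?_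
    have h₁ := Grid.comp_eqToHom X.eq i j
    have h₂ := Grid.comp_eqToHom Y.eq i j
    refine (congrArg (_ ≫ ·) h₂).trans (Eq.trans ?_ (congrArg (· ≫ _) h₁).symm)
    have : f.map (relRight τ (i, j)) ≫ eqToHom (Y.obj_eq (i, j)) =
        eqToHom (X.obj_eq (i, j)) ≫ eqToHom (X.obj_eq (i, j)).symm ≫
          f.map (relRight τ (i, j)) ≫ eqToHom (Y.obj_eq (i, j)) := by
      rw [eqToHom_trans_assoc, eqToHom_refl, Category.id_comp]
    exact this

end Full

/-- The preimage is built from the left components of `τ` in row 0 only. Those in row `i` coincide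
with them by naturality along the vertical map from row 0, which has an identity as left component
at both ends. -/
instance : (comparison hf q r).Full where
  map_surjective {X Y} τ := by
    refine ⟨homOfRelDiagramIso τ, Iso.ext (NatTrans.ext (funext fun x => RelObj.hom_ext ?_ rfl))⟩
    obtain ⟨i, j⟩ := x
    have h := congrArg RelObj.Hom.left (NatTrans.naturality
      (Iso.hom (C := Fin (q.len + 1) × Fin (r.len + 1) ⥤ RelObj SB f) τ)
      (X := (0, j)) (Y := (i, j)) (homOfLE (Fin.zero_le i), 𝟙 j))
    exact (Category.comp_id _).symm.trans ((congrArg (_ ≫ ·) (Y.total.map_id (0, j)).symm).trans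
      (h.symm.trans ((congrArg (· ≫ _) (X.total.map_id (0, j))).trans (Category.id_comp _))))

end RelGrid

end

/-! ### Essential surjectivity of the comparison -/

noncomputable section

lemma CategoryTheory.BicartesianSq.congr_vertical {D : Type u} [Category.{v} D] {a b c d : D}
    {i : a ⟶ b} {p p' : a ⟶ c} {q q' : b ⟶ d} {j : c ⟶ d} (h : BicartesianSq i p q j)
    (hp : p' = p) (hq : q' = q) : BicartesianSq i p' q' j := by
  subst hp hq
  exact h

namespace RelGrid

variable {A : Type u} [Category.{v} A] {B : Type u} [Category.{v} B] [Preadditive A]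
  [HasFiniteBiproducts A] [Preadditive B] [HasFiniteBiproducts B] {SA : ExactStructure A}
  {SB : ExactStructure B} {f : A ⥤ B} {q r : SimplexCategory}

section EssSurj

variable (H : (RelObj.squareClass SB f SA).Diagram q r)

/-- The grid in `A` underlying a grid of relative objects. -/
def rightGrid : Grid SA q r where
  diagram := H.diagram ⋙ RelObj.rightFunctor SB f
  horizontal i _ _ h := (H.horizontal i h).2.1
  vertical h j := (H.vertical h j).2
  bicartesian h _ _ h' := (H.square h h').2

/-- The diagram in `B` underlying a grid of relative objects. -/
def leftDiagram : Fin (q.len + 2) × Fin (r.len + 1) ⥤ B :=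
  prependRow (n := q.len) (Q := Fin (r.len + 1)) ((rightGrid H).diagram ⋙ f)
    (Prod.sectR 0 _ ⋙ H.diagram ⋙ RelObj.leftFunctor SB f)
    (fun j => (H.diagram.obj (0, j)).hom)
    (fun {j j'} g => (H.diagram.map (X := (0, j)) (Y := (0, j')) (𝟙 _, g)).w)

/-- The adjoined row contributes the image of an identity at the front, so the equation is not
definitional. -/
lemma leftDiagram_map_zero_succ (k : Fin (q.len + 1)) (j : Fin (r.len + 1)) :
    (leftDiagram H).map (X := (0, j)) (Y := (k.succ, j)) (homOfLE (Fin.zero_le _), 𝟙 j) =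
      (H.diagram.obj (0, j)).hom ≫
        f.map ((rightGrid H).diagram.map (X := (0, j)) (Y := (k, j))
          (homOfLE (Fin.zero_le _), 𝟙 j)) :=
  (congrArg (· ≫ _) ((Prod.sectR 0 _ ⋙ H.diagram ⋙ RelObj.leftFunctor SB f).map_id j)).trans
    (Category.id_comp _)

/-- The grid in `B` underlying a grid of relative objects. -/
def leftGrid (hf : IsExactFunctor SA SB f) : Grid SB (joinPoint.obj q) r where
  diagram := leftDiagram H
  horizontal i j l h := by
    induction i using Fin.cases with
    | zero => exact (H.horizontal 0 h).1
    | succ i => exact hf.map_M ((rightGrid H).horizontal i h)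
  vertical {i k} h j := by
    induction k using Fin.cases with
    | zero =>
      obtain rfl : i = 0 := Fin.le_zero_iff.1 h
      have : IsIso ((leftDiagram H).map (𝟙 ((0, j) : Fin (q.len + 2) × Fin (r.len + 1)))) :=
        inferInstance
      exact @ExactStructure.E_of_isIso _ _ _ _ SB _ _ _ this
    | succ k =>
      induction i using Fin.cases with
      | zero =>
        have h' : SB.E ((H.diagram.obj (0, j)).hom ≫
            f.map ((rightGrid H).diagram.map (X := (0, j)) (Y := (k, j))
              (homOfLE (Fin.zero_le _), 𝟙 j))) :=
          (H.diagram.obj (0, j)).mem.comp (hf.map_E ((rightGrid H).vertical _ j))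
        exact (leftDiagram_map_zero_succ H k j).symm ▸ h'
      | succ i => exact hf.map_E ((rightGrid H).vertical (Fin.succ_le_succ_iff.1 h) j)
  bicartesian {i k} h j l h' := by
    induction k using Fin.cases with
    | zero =>
      obtain rfl : i = 0 := Fin.le_zero_iff.1 h
      have h₁ : IsIso ((leftDiagram H).map (𝟙 ((0, j) : Fin (q.len + 2) × Fin (r.len + 1)))) :=
        inferInstance
      have h₂ : IsIso ((leftDiagram H).map (𝟙 ((0, l) : Fin (q.len + 2) × Fin (r.len + 1)))) :=
        inferInstance
      exact @BicartesianSq.of_vert_isIso _ _ _ _ _ _ _ _ _ _ h₁ h₂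
        (map_prod_comm (leftDiagram H) (i := 0) (k := 0) le_rfl h')
    | succ k =>
      induction i using Fin.cases with
      | zero =>
        -- A square leaving the initial row is the one carried by a horizontal map of relative
        -- objects, followed by the image of a bicartesian square of `A`.
        have s := (H.horizontal 0 h').2.2.paste_vert
          (((Grid.mapFunctor hf q r).obj (rightGrid H)).bicartesian (i := (0 : Fin (q.len + 1)))
            (k := k) (Fin.zero_le (n := q.len + 1) _) h')
        exact s.congr_vertical (leftDiagram_map_zero_succ H k j) (leftDiagram_map_zero_succ H k l)
      | succ i =>
        have hik : i ≤ k := Fin.succ_le_succ_iff.1 h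
        exact Grid.bicartesian ((Grid.mapFunctor hf q r).obj (rightGrid H)) (h' := h') hik

/-- The object of the relative exact nerve underlying a grid of relative objects. -/
def ofDiagram (hf : IsExactFunctor SA SB f) : RelGrid hf q r := ⟨rightGrid H, leftGrid H hf, rfl⟩

/-- The component at `x` of the comparison of a grid of relative objects with the one whose
vertical maps have identities as their components in `B`. -/
def ofDiagramIsoApp (hf : IsExactFunctor SA SB f) (x : Fin (q.len + 1) × Fin (r.len + 1)) :
    (ofDiagram H hf).relObj x ≅ H.diagram.obj x :=
  let φ : H.diagram.obj (0, x.2) ⟶ H.diagram.obj x :=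
    H.diagram.map (X := (0, x.2)) (Y := (x.1, x.2)) (homOfLE (Fin.zero_le _), 𝟙 x.2)
  have h : IsIso (RelObj.Hom.left φ) := (H.vertical (Fin.zero_le x.1) x.2).1
  let ℓ : (H.diagram.obj (0, x.2)).left ≅ (H.diagram.obj x).left := asIso (RelObj.Hom.left φ)
  RelObj.isoMk (x := (ofDiagram H hf).relObj x) ℓ (Iso.refl _) (by
    refine (RelObj.Hom.w φ).trans (Eq.symm ?_)
    refine (congrArg (_ ≫ ·) (f.map_id _)).trans ((Category.comp_id _).trans ?_)
    exact (Category.comp_id _).trans (leftDiagram_map_zero_succ H x.1 x.2))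

/-- The comparison of a grid of relative objects with the one whose vertical maps have identities
as their components in `B`. -/
def ofDiagramIso (hf : IsExactFunctor SA SB f) : (ofDiagram H hf).relDiagram ≅ H.diagram :=
  NatIso.ofComponents (ofDiagramIsoApp H hf) (fun {x y} g => by
    -- Both composites go from row 0 in column `x.2` to `y`; their left components give naturality
    -- in `B`.
    have h : H.diagram.map (X := (0, x.2)) (Y := (0, y.2)) (𝟙 _, g.2) ≫
          H.diagram.map (X := (0, y.2)) (Y := (y.1, y.2)) (homOfLE (Fin.zero_le _), 𝟙 y.2) =
        H.diagram.map (X := (0, x.2)) (Y := (x.1, x.2)) (homOfLE (Fin.zero_le _), 𝟙 x.2) ≫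
          H.diagram.map g := by
      rw [← H.diagram.map_comp, ← H.diagram.map_comp]
      rfl
    have h' := congrArg RelObj.Hom.left h
    exact RelObj.hom_ext h'
      ((Category.comp_id _).trans (Category.id_comp _).symm))

end EssSurj

variable {hf : IsExactFunctor SA SB f}

/-- The rows of `leftDiagram` of positive index are by construction the image of `rightGrid`, so the
strict pullback condition holds by `rfl`. Only row 0 of the `B`-objects of `H` is retained; the
others are recovered through the invertible left components of the vertical maps. -/
instance : (comparison hf q r).EssSurj where
  mem_essImage H := ⟨ofDiagram H hf, ⟨(Groupoid.isoEquivHom _ _).symm (ofDiagramIso H hf)⟩⟩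

instance : (comparison hf q r).IsEquivalence where

end RelGrid

end

/-! ### The double Segal and stability conditions -/

noncomputable section

namespace RelGrid

variable {A : Type u} [Category.{v} A] {B : Type u} [Category.{v} B] [Preadditive A]
  [HasFiniteBiproducts A] [Preadditive B] [HasFiniteBiproducts B] {SA : ExactStructure A}
  {SB : ExactStructure B} {f : A ⥤ B} (hf : IsExactFunctor SA SB f)

/-- The comparison of the relative exact nerve with the nerve of relative objects. -/
def comparisonNatTrans :
    underlying (relativeExactNerve hf) ⟶ (RelObj.squareClass SB f SA).nerve where
  app x := comparison hf x.unop.1 x.unop.2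
  naturality _ _ _ := rfl

lemma isDoubleSegal : IsDoubleSegal (relativeExactNerve hf) where
  segal_snd q := IsSegal.of_levelwise_equivalence
    (X' := (RelObj.squareClass SB f SA).nerveRow q)
    (Functor.whiskerLeft (Prod.sectR ⦋q⦌ SimplexCategory).op (comparisonNatTrans hf))
    (fun n => (inferInstance : (comparison hf ⦋q⦌ ⦋n⦌).IsEquivalence))
    (SquareClass.isSegal_nerveRow _ q)
  segal_fst r := IsSegal.of_levelwise_equivalence
    (X' := (RelObj.squareClass SB f SA).nerveCol r)
    (Functor.whiskerLeft (Prod.sectL SimplexCategory ⦋r⦌).op (comparisonNatTrans hf))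
    (fun n => (inferInstance : (comparison hf ⦋n⦌ ⦋r⦌).IsEquivalence))
    (SquareClass.isSegal_nerveCol _ r)

/-- Joining a point to a map of simplices fixes the initial vertex, so reindexing respects the
initial row and the comparison is strictly natural. These are the squares along which all conditions
are transported. -/
lemma bimap_comparison {k l k' l' : ℕ} (a : ⦋k'⦌ ⟶ ⦋k⦌) (b : ⦋l'⦌ ⟶ ⦋l⦌) :
    bimap (relativeExactNerve hf) a b ≫ (comparisonNatTrans hf).app (op (⦋k'⦌, ⦋l'⦌)) =
      (comparisonNatTrans hf).app (op (⦋k⦌, ⦋l⦌)) ≫ (RelObj.squareClass SB f SA).restrict a b :=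
  rfl

lemma isStable : IsStable (relativeExactNerve hf) where
  span := toTwoPullback_isEquivalence_of_equivalence _ _ _ _ (bimap_comparison hf _ _)
    (bimap_comparison hf _ _) (bimap_comparison hf _ _) (bimap_comparison hf _ _)
    (inferInstance : (comparison hf ⦋1⦌ ⦋1⦌).IsEquivalence)
    (inferInstance : (comparison hf ⦋0⦌ ⦋1⦌).IsEquivalence)
    (inferInstance : (comparison hf ⦋1⦌ ⦋0⦌).IsEquivalence)
    (inferInstance : (comparison hf ⦋0⦌ ⦋0⦌).IsEquivalence)
    (SquareClass.toSpan_isEquivalence (RelObj.squareClass_isStable hf))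
  cospan := toTwoPullback_isEquivalence_of_equivalence _ _ _ _ (bimap_comparison hf _ _)
    (bimap_comparison hf _ _) (bimap_comparison hf _ _) (bimap_comparison hf _ _)
    (inferInstance : (comparison hf ⦋1⦌ ⦋1⦌).IsEquivalence)
    (inferInstance : (comparison hf ⦋1⦌ ⦋0⦌).IsEquivalence)
    (inferInstance : (comparison hf ⦋0⦌ ⦋1⦌).IsEquivalence)
    (inferInstance : (comparison hf ⦋0⦌ ⦋0⦌).IsEquivalence)
    (SquareClass.toCospan_isEquivalence (RelObj.squareClass_isStable hf))

end RelGrid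

end

noncomputable section

/-! ### The augmentation of the relative exact nerve -/

/-- The construction composes `a` with the action of an endomorphism of the terminal object (0, 0),
which is an identity. -/
lemma augMap_mkPreaugmented {C : Type*} [Category* C]
    (X : (SimplexCategory × SimplexCategory)ᵒᵖ ⥤ C) (E : C) (a : E ⟶ X.obj (op (⦋0⦌, ⦋0⦌))) :
    augMap (mkPreaugmented X E a) = a := by
  let τ : ((⦋0⦌, ⦋0⦌) : SimplexCategory × SimplexCategory) ⟶ (⦋0⦌, ⦋0⦌) :=
    (SimplexCategory.isTerminalZero.from _, SimplexCategory.isTerminalZero.from _)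
  have h : τ = 𝟙 _ := Prod.ext (SimplexCategory.isTerminalZero.hom_ext _ _)
    (SimplexCategory.isTerminalZero.hom_ext _ _)
  change a ≫ X.map τ.op = a
  rw [h, op_id, X.map_id, Category.comp_id]

namespace StrictPullback

variable {C D E : Type u} [Groupoid.{v} C] [Groupoid.{v} D] [Groupoid.{v} E] {F : C ⥤ E}
  {G : D ⥤ E}

lemma pr₁_faithful [G.Faithful] : (pr₁ F G).Faithful where
  map_injective {x y φ ψ} h := by
    have h₁ : φ.fst = ψ.fst := h
    refine Hom.ext h₁ (G.map_injective ?_)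
    rw [← cancel_epi (eqToHom x.eq), ← φ.eq, ← ψ.eq, h₁]

lemma pr₁_full [G.Full] : (pr₁ F G).Full where
  map_surjective {x y} φ := ⟨⟨φ, G.preimage (eqToHom x.eq.symm ≫ F.map φ ≫ eqToHom y.eq), by
    rw [G.map_preimage, eqToHom_trans_assoc, eqToHom_refl, Category.id_comp]
    rfl⟩, rfl⟩

end StrictPullback

section Levelwise

variable {J : Type*} [Category* J] {X Y Z : J ⥤ Grpd.{v, u}} (α : X ⟶ Z) (β : Y ⟶ Z) {j k : J}
  (φ : j ⟶ k)

lemma levelwisePullback_map_faithful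
    (hX : Functor.Faithful (C := X.obj j) (D := X.obj k) (X.map φ))
    (hY : Functor.Faithful (C := Y.obj j) (D := Y.obj k) (Y.map φ)) :
    Functor.Faithful (C := (levelwisePullback α β).obj j) (D := (levelwisePullback α β).obj k)
      ((levelwisePullback α β).map φ) where
  map_injective h := StrictPullback.Hom.ext (hX.map_injective (congrArg StrictPullback.Hom.fst h))
    (hY.map_injective (congrArg StrictPullback.Hom.snd h))

/-- Preimages chosen separately in `X` and `Y` need not agree in `Z`. The hypothesis `hZ` removes
this obstruction; it applies in degree -1, where `Z` is the groupoid of zero objects of `B`. -/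
lemma levelwisePullback_map_full
    (hX : Functor.Full (C := X.obj j) (D := X.obj k) (X.map φ))
    (hY : Functor.Full (C := Y.obj j) (D := Y.obj k) (Y.map φ))
    (hZ : ∀ (x y : Z.obj j) (φ ψ : x ⟶ y), φ = ψ) :
    Functor.Full (C := (levelwisePullback α β).obj j) (D := (levelwisePullback α β).obj k)
      ((levelwisePullback α β).map φ) where
  map_surjective τ := by
    obtain ⟨a, ha⟩ := hX.map_surjective (StrictPullback.Hom.fst τ)
    obtain ⟨b, hb⟩ := hY.map_surjective (StrictPullback.Hom.snd τ)
    exact ⟨⟨a, b, hZ _ _ _ _⟩, StrictPullback.Hom.ext ha hb⟩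

end Levelwise

variable {A : Type u} [Category.{v} A] {B : Type u} [Category.{v} B] [Preadditive A]
  [HasFiniteBiproducts A] [Preadditive B] [HasFiniteBiproducts B] {SA : ExactStructure A}
  {SB : ExactStructure B} {f : A ⥤ B}

instance ZeroObj.incl_faithful : (ZeroObj.incl SA).Faithful where
  map_injective {X _ _ _} _ := Iso.ext (X.isZero.eq_of_src _ _)

instance ZeroObj.incl_full : (ZeroObj.incl SA).Full where
  map_surjective {X Y} _ := ⟨X.isZero.iso Y.isZero, Grid.hom_ext fun _ _ => X.isZero.eq_of_src _ _⟩

variable (SB) in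
lemma augMap_initialPath_exactNerve : augMap (initialPath (exactNerve SB)) =
    StrictPullback.pr₁ ((pathFace (exactNerve SB)).app (op (⦋0⦌, ⦋0⦌))) (augMap (exactNerve SB)) :=
  augMap_mkPreaugmented _ _ _

lemma augMap_exactNerve_faithful : Functor.Faithful
    (C := (exactNerve SA).obj (op WithTerminal.star))
    (D := (underlying (exactNerve SA)).obj (op (⦋0⦌, ⦋0⦌))) (augMap (exactNerve SA)) :=
  (inferInstance : (ZeroObj.incl SA).Faithful)

lemma augMap_exactNerve_full : Functor.Full
    (C := (exactNerve SA).obj (op WithTerminal.star))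
    (D := (underlying (exactNerve SA)).obj (op (⦋0⦌, ⦋0⦌))) (augMap (exactNerve SA)) :=
  (inferInstance : (ZeroObj.incl SA).Full)

lemma augMap_initialPath_faithful : Functor.Faithful
    (C := (initialPath (exactNerve SB)).obj (op WithTerminal.star))
    (D := (underlying (initialPath (exactNerve SB))).obj (op (⦋0⦌, ⦋0⦌)))
    (augMap (initialPath (exactNerve SB))) := by
  rw [augMap_initialPath_exactNerve]
  have := augMap_exactNerve_faithful (SA := SB)
  exact StrictPullback.pr₁_faithful

lemma augMap_initialPath_full : Functor.Full
    (C := (initialPath (exactNerve SB)).obj (op WithTerminal.star))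
    (D := (underlying (initialPath (exactNerve SB))).obj (op (⦋0⦌, ⦋0⦌)))
    (augMap (initialPath (exactNerve SB))) := by
  rw [augMap_initialPath_exactNerve]
  have := augMap_exactNerve_full (SA := SB)
  exact StrictPullback.pr₁_full

namespace RelGrid

variable (hf : IsExactFunctor SA SB f)

lemma augMap_faithful : Functor.Faithful
    (C := (relativeExactNerve hf).obj (op WithTerminal.star))
    (D := (underlying (relativeExactNerve hf)).obj (op (⦋0⦌, ⦋0⦌)))
    (augMap (relativeExactNerve hf)) :=
  levelwisePullback_map_faithful _ _ _ augMap_exactNerve_faithful augMap_initialPath_faithful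

lemma augMap_full : Functor.Full
    (C := (relativeExactNerve hf).obj (op WithTerminal.star))
    (D := (underlying (relativeExactNerve hf)).obj (op (⦋0⦌, ⦋0⦌)))
    (augMap (relativeExactNerve hf)) :=
  levelwisePullback_map_full _ _ _ augMap_exactNerve_full augMap_initialPath_full
    (fun x _ _ _ => Iso.ext ((ZeroObj.isZero x).eq_of_src _ _))

lemma isZero_of_augMap (X : (relativeExactNerve hf).obj (op WithTerminal.star)) :
    IsZero (Grid.diagram (StrictPullback.fst (F := Grid.mapFunctor hf ⦋0⦌ ⦋0⦌)
      ((augMap (relativeExactNerve hf)).obj X))|>.obj (0, 0)) :=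
  ZeroObj.isZero (StrictPullback.fst X)

/-- If the `A`-component is zero then so is its image, and the given admissible epimorphism in `B`,
together with that image, is already an object of degree -1 of the path construction. -/
lemma mem_essImage_augMap (o : RelGrid hf ⦋0⦌ ⦋0⦌) (h : IsZero (o.fst.diagram.obj (0, 0))) :
    Functor.essImage (C := (relativeExactNerve hf).obj (op WithTerminal.star))
      (D := (underlying (relativeExactNerve hf)).obj (op (⦋0⦌, ⦋0⦌)))
      (augMap (relativeExactNerve hf)) o := by
  let Z : ZeroObj.{v} A := ⟨o.fst.diagram.obj (0, 0), h⟩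
  have hx (x : Fin 1 × Fin 1) : o.fst.diagram.obj x = Z.obj :=
    congrArg o.fst.diagram.obj (Subsingleton.elim (α := Fin 1 × Fin 1) _ _)
  have hz (x : Fin 1 × Fin 1) : IsZero (o.fst.diagram.obj x) := (hx x).symm ▸ h
  -- The strict pullback requires equality with a constant diagram. It holds because the index
  -- category has one object and maps out of a zero object are unique.
  have e : (Grid.mapFunctor hf ⦋0⦌ ⦋0⦌).obj o.fst =
      (ZeroObj.incl SB).obj ((ZeroObj.mapFunctor hf).obj Z) :=
    Grid.ext (CategoryTheory.Functor.ext (fun x => congrArg f.obj (hx x))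
      (fun x _ _ => (hf.map_isZero (hz x)).eq_of_src _ _))
  let W : pathAug (exactNerve SB) := ⟨o.snd, (ZeroObj.mapFunctor hf).obj Z, o.eq.symm.trans e⟩
  let X : (relativeExactNerve hf).obj (op WithTerminal.star) := ⟨Z, W, rfl⟩
  let i : (Functor.const (Fin 1 × Fin 1)).obj Z.obj ≅ o.fst.diagram :=
    NatIso.ofComponents (fun x => h.iso (hz x)) (fun _ => h.eq_of_src _ _)
  -- The `B`-part is a transport because the augmentation of the path construction equals the first
  -- projection only propositionally.
  let φ : (augMap (relativeExactNerve hf)).obj X ⟶ o :=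
    ⟨i, eqToHom (Functor.congr_obj (augMap_initialPath_exactNerve SB) W), Grid.hom_ext fun _ _ =>
      (hf.map_isZero h).eq_of_src _ _⟩
  exact ⟨X, ⟨(Groupoid.isoEquivHom _ _).symm φ⟩⟩

variable (SA) (SB) (f) in
/-- The relative objects whose component in `A` is zero. -/
def isZeroRight : ObjectProperty ((RelObj.squareClass SB f SA).Diagram ⦋0⦌ ⦋0⦌) :=
  fun F => IsZero (F.diagram.obj (0, 0)).right

instance isZeroRight_isClosedUnderIsomorphisms :
    (isZeroRight SA SB f).IsClosedUnderIsomorphisms where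
  of_iso e h := h.of_iso ((RelObj.rightFunctor SB f).mapIso
    (SquareClass.Diagram.compIso e.hom 0 0)).symm

lemma essImage_augMap_iff (o : RelGrid hf ⦋0⦌ ⦋0⦌) :
    Functor.essImage (C := (relativeExactNerve hf).obj (op WithTerminal.star))
      (D := (underlying (relativeExactNerve hf)).obj (op (⦋0⦌, ⦋0⦌)))
      (augMap (relativeExactNerve hf)) o ↔
    isZeroRight SA SB f ((comparison hf ⦋0⦌ ⦋0⦌).obj o) := by
  refine ⟨?_, mem_essImage_augMap hf o⟩
  rintro ⟨X, ⟨e⟩⟩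
  exact (isZeroRight SA SB f).prop_of_iso ((comparison hf ⦋0⦌ ⦋0⦌).mapIso e)
    (isZero_of_augMap hf X)

/-- The augmentation is fully faithful and its essential image consists of the objects with zero
component in `A`. The two conditions then say that a relative object is, uniquely up to isomorphism,
the source of a vertical map to such an object and the target of a horizontal map from one. -/
lemma isAugmented : IsAugmented (relativeExactNerve hf) where
  vertical := by
    refine twoPullback_fst_comp_isEquivalence_of_equivalence
      (s' := (RelObj.squareClass SB f SA).restrict (srcVertex 1) (𝟙 ⦋0⦌))
      (t' := (RelObj.squareClass SB f SA).restrict (tgtVertex 1) (𝟙 ⦋0⦌))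
      (augMap_full hf) (augMap_faithful hf) (comparison hf ⦋1⦌ ⦋0⦌) (comparison hf ⦋0⦌ ⦋0⦌)
      (inferInstance : (comparison hf ⦋1⦌ ⦋0⦌).IsEquivalence)
      (inferInstance : (comparison hf ⦋0⦌ ⦋0⦌).IsEquivalence)
      (eqToIso (bimap_comparison hf _ _)) (eqToIso (bimap_comparison hf _ _))
      (isZeroRight SA SB f) isZeroRight_isClosedUnderIsomorphisms (essImage_augMap_iff hf)
      (RelObj.vertical_restrict_bijective hf) (fun o => ?_)
    obtain ⟨z, p, hz, hp⟩ := RelObj.exists_vertical_to_zero hf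
      (SquareClass.Diagram.diagram o |>.obj (0, 0))
    obtain ⟨F, rfl, e⟩ := SquareClass.exists_diagram_of_vertical o p hp
    exact ⟨F, hz, e⟩
  horizontal := by
    refine twoPullback_fst_comp_isEquivalence_of_equivalence
      (s' := (RelObj.squareClass SB f SA).restrict (𝟙 ⦋0⦌) (tgtVertex 1))
      (t' := (RelObj.squareClass SB f SA).restrict (𝟙 ⦋0⦌) (srcVertex 1))
      (augMap_full hf) (augMap_faithful hf) (comparison hf ⦋0⦌ ⦋1⦌) (comparison hf ⦋0⦌ ⦋0⦌)
      (inferInstance : (comparison hf ⦋0⦌ ⦋1⦌).IsEquivalence)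
      (inferInstance : (comparison hf ⦋0⦌ ⦋0⦌).IsEquivalence)
      (eqToIso (bimap_comparison hf _ _)) (eqToIso (bimap_comparison hf _ _))
      (isZeroRight SA SB f) isZeroRight_isClosedUnderIsomorphisms (essImage_augMap_iff hf)
      (RelObj.horizontal_restrict_bijective hf) (fun o => ?_)
    obtain ⟨z, p, hz, hp⟩ := RelObj.exists_horizontal_from_zero hf
      (SquareClass.Diagram.diagram o |>.obj (0, 0))
    obtain ⟨F, rfl, e⟩ := SquareClass.exists_diagram_of_horizontal o p hp
    exact ⟨F, hz, e⟩

end RelGrid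

end

/-- The relative exact nerve of an exact functor between exact categories is an augmented stable
double Segal groupoid. -/
theorem mainTheorem4 {A B : Type u} [Category.{v} A] [Preadditive A] [HasFiniteBiproducts A]
    [Category.{v} B] [Preadditive B] [HasFiniteBiproducts B] (SA : ExactStructure A)
    (SB : ExactStructure B) (f : A ⥤ B) (hf : IsExactFunctor SA SB f) :
    IsAugmentedStableDoubleSegal (relativeExactNerve hf) :=
  ⟨RelGrid.isDoubleSegal hf, RelGrid.isStable hf, RelGrid.isAugmented hf⟩
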